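/- Let $\lambda>0$ and $\alpha>0$. Let $\Omega\subset\mathbb R^2$ be a Lebesgue measurable set with $|\Omega|=\pi$ and finite perimeter $P(\Omega)<\infty$. Let $\partial^*\Omega$ be its (De Giorgi) reduced boundary, $\nu(y)$ the measure-theoretic outward unit normal of $\Omega$ at $y\in\partial^*\Omega$, and $\mathcal H^1$ the one-dimensional Hausdorff measure. Put $$F_{\lambda,\alpha}(\Omega):=P(\Omega)-\frac{\lambda^2}{4\pi}\int_\Omega\int_{\mathbb R^2\setminus\Omega}\frac{e^{-\lambda\alpha|x-y|}}{|x-y|}\,d^2y\,d^2x .$$ For a unit vector $\nu=(\nu_1,\nu_2)$ let $H_-^0(\nu):=\{x\in\mathbb R^2:\nu\cdot x<0\}$, $\nu^\perp:=(-\nu_2,\nu_1)$ and $R_\nu:=e_2\otimes\nu-e_1\otimes\nu^\perp$ (the rotation that takes $\nu$ to $e_2$), and let $A_\lambda:=\lambda\,e_1\otimes e_1+\lambda^2\,e_2\otimes e_2$. Write $\Delta$ for the symmetric difference of sets and $z=(z_1,z_2)$. Then all the integrals above and below are finite, and $$\begin{aligned} F_{\lambda,\alpha}(\Omega) &=\Big(1-\frac1{2\pi\alpha^2}\Big)P(\Omega)+\frac1{4\pi\alpha}\int_{\partial^*\Omega}\int_{H_-^0(\nu(y))\,\Delta\,\lambda(\Omega-y)}\Big|\nu(y)\cdot\frac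 z{|z|}\Big|\frac{e^{-\alpha|z|}}{|z|}\,d^2z\,d\mathcal H^1(y)\\ &=\Big(1-\frac1{2\pi\alpha^2}\Big)P(\Omega)+\frac1{4\pi\alpha\lambda^2}\int_{\partial^*\Omega}\int_{H_-^0(e_2)\,\Delta\,A_\lambda R_{\nu(y)}(\Omega-y)}|z_2|\,\frac{e^{-\alpha\sqrt{z_1^2+z_2^2/\lambda^2}}}{z_1^2+z_2^2/\lambda^2}\,d^2z\,d\mathcal H^1(y). \end{aligned}$$ In particular, $$F_{\lambda,\alpha}(\Omega)\ge\Big(1-\frac1{2\pi\alpha^2}\Big)P(\Omega).$$ -/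

import Mathlib

open MeasureTheory Filter Topology
open scoped ENNReal symmDiff

noncomputable section

namespace ScreenedPerimeter

/-- The Euclidean plane `ℝ²`, with the Euclidean norm and Lebesgue measure `volume`. -/
abbrev Plane : Type := EuclideanSpace ℝ (Fin 2)

/-- The standard basis vectors of the plane. -/
def e₁ : Plane := !₂[1, 0]

def e₂ : Plane := !₂[0, 1]

/-- The divergence of a vector field. -/
def divergence (T : Plane → Plane) (x : Plane) : ℝ :=
  (fderiv ℝ T x e₁) 0 + (fderiv ℝ T x e₂) 1

/-- Test vector fields: continuously differentiable with compact support. -/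
def IsTestField (T : Plane → Plane) : Prop :=
  ContDiff ℝ 1 T ∧ HasCompactSupport T

/-- The perimeter
`P(Ω) = sup {∫_Ω div T : T ∈ C_c¹(ℝ²; ℝ²), |T| ≤ 1}`, an extended nonnegative number. -/
def perimeter (Ω : Set Plane) : ℝ≥0∞ :=
  ⨆ T ∈ {T : Plane → Plane | IsTestField T ∧ ∀ x, ‖T x‖ ≤ 1},
    ENNReal.ofReal (∫ x in Ω, divergence T x)

/-- The admissible class: Lebesgue measurable sets of measure `m` and finite perimeter. -/
def admissible (m : ℝ) : Set (Set Plane) :=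
  {Ω | NullMeasurableSet Ω volume ∧ volume Ω = ENNReal.ofReal m ∧ perimeter Ω < ∞}

/-- `(μ, σ)` is the polar decomposition of the Gauss–Green measure `-Dχ_Ω`: `μ` is a Radon
measure, `|σ| = 1` holds `μ`-almost everywhere, and `∫_Ω div T = ∫ T ⋅ σ dμ` for all test
fields `T`. By uniqueness in the Riesz theorem, `μ` (which is `|Dχ_Ω|`) is determined by `Ω`,
and so is `σ` up to `μ`-null sets. -/
def IsGaussGreenPolar (Ω : Set Plane) (μ : Measure Plane) (σ : Plane → Plane) : Prop :=
  IsLocallyFiniteMeasure μ ∧ Measurable σ ∧ (∀ᵐ x ∂μ, ‖σ x‖ = 1) ∧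
    ∀ T : Plane → Plane, IsTestField T →
      ∫ x in Ω, divergence T x = ∫ x, inner ℝ (T x) (σ x) ∂μ

/-- `ν` is the measure-theoretic outward unit normal of `Ω` at `y`, in the sense of De Giorgi:
`y` lies in the support of `μ = |Dχ_Ω|`, and the averages `-Dχ_Ω(B_r(y)) / |Dχ_Ω|(B_r(y))`
converge, as `r ↓ 0`, to the unit vector `ν`. -/
def IsOutwardNormal (Ω : Set Plane) (y ν : Plane) : Prop :=
  ∃ (μ : Measure Plane) (σ : Plane → Plane), IsGaussGreenPolar Ω μ σ ∧
    (∀ r : ℝ, 0 < r → 0 < μ (Metric.ball y r)) ∧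
    Tendsto (fun r : ℝ => ⨍ x in Metric.ball y r, σ x ∂μ) (𝓝[>] 0) (𝓝 ν) ∧
    ‖ν‖ = 1

/-- The reduced boundary `∂*Ω`. -/
def reducedBoundary (Ω : Set Plane) : Set Plane :=
  {y | ∃ ν, IsOutwardNormal Ω y ν}

open Classical in
/-- The outward unit normal `ν(y)` of `Ω` at a point `y` of the reduced boundary
(and `0` at all other points). -/
def outwardNormal (Ω : Set Plane) (y : Plane) : Plane :=
  if h : ∃ ν, IsOutwardNormal Ω y ν then h.choose else 0

/-- The open half-plane `H₋⁰(ν) = {x : ν ⋅ x < 0}`. -/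
def halfPlane (ν : Plane) : Set Plane := {x | inner ℝ ν x < 0}

/-- The counter-clockwise rotation by 90 degrees, `ν^⊥ = (-ν₂, ν₁)`. -/
def perp (ν : Plane) : Plane := !₂[-ν 1, ν 0]

/-- `R_ν = e₂ ⊗ ν - e₁ ⊗ ν^⊥`; for a unit vector `ν`, the rotation that takes `ν` to `e₂`. -/
def rotate (ν x : Plane) : Plane :=
  inner ℝ ν x • e₂ - inner ℝ (perp ν) x • e₁

/-- `A_λ = λ e₁ ⊗ e₁ + λ² e₂ ⊗ e₂`. -/
def dilate (lam : ℝ) (x : Plane) : Plane :=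
  (lam * inner ℝ e₁ x) • e₁ + (lam ^ 2 * inner ℝ e₂ x) • e₂

/-- The double integral
`∫_Ω ∫_{Ωᶜ} e^{-λα|x-y|} / |x-y| dy dx` of a nonnegative function. -/
def nonlocalTerm (lam α : ℝ) (Ω : Set Plane) : ℝ≥0∞ :=
  ∫⁻ x in Ω, ∫⁻ y in Ωᶜ, ENNReal.ofReal (Real.exp (-(lam * α * ‖x - y‖)) / ‖x - y‖)

/-- The energy
`F_{λ,α}(Ω) = P(Ω) - λ²/(4π) ∫_Ω ∫_{Ωᶜ} e^{-λα|x-y|} / |x-y| dy dx`. -/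
def energy (lam α : ℝ) (Ω : Set Plane) : ℝ :=
  (perimeter Ω).toReal - lam ^ 2 / (4 * Real.pi) * (nonlocalTerm lam α Ω).toReal

/-- `∫_{∂*Ω} ∫_{H₋⁰(ν(y)) Δ λ(Ω - y)} |ν(y) ⋅ z/|z|| e^{-α|z|} / |z| dz dℋ¹(y)`. -/
def boundaryBulk (lam α : ℝ) (Ω : Set Plane) : ℝ≥0∞ :=
  ∫⁻ y in reducedBoundary Ω,
    (∫⁻ z in halfPlane (outwardNormal Ω y) ∆ ((fun x => lam • (x - y)) '' Ω),
      ENNReal.ofReal (|inner ℝ (outwardNormal Ω y) (‖z‖⁻¹ • z)| *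
        (Real.exp (-(α * ‖z‖)) / ‖z‖))) ∂Measure.hausdorffMeasure 1

/-- `∫_{∂*Ω} ∫_{H₋⁰(e₂) Δ A_λ R_{ν(y)}(Ω - y)}
|z₂| e^{-α √(z₁² + z₂²/λ²)} / (z₁² + z₂²/λ²) dz dℋ¹(y)`. -/
def anisotropicBoundaryBulk (lam α : ℝ) (Ω : Set Plane) : ℝ≥0∞ :=
  ∫⁻ y in reducedBoundary Ω,
    (∫⁻ z in halfPlane e₂ ∆
        ((fun x => dilate lam (rotate (outwardNormal Ω y) (x - y))) '' Ω),
      ENNReal.ofReal (|z 1| *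
        (Real.exp (-(α * √((z 0) ^ 2 + (z 1) ^ 2 / lam ^ 2))) /
          ((z 0) ^ 2 + (z 1) ^ 2 / lam ^ 2)))) ∂Measure.hausdorffMeasure 1

end ScreenedPerimeter

end

open scoped CompactlySupported

noncomputable section

namespace ScreenedPerimeter

/-! Put κ = λα, K(h) = e^{-κ|h|}/|h|, and let χ be the characteristic function of Ω. By Fubini the
double integral equals ∫ K(h) g(h) dh with g(h) = -∫ χ(x) (χ(x+h) - χ(x)) dx. If the first χ is
replaced by a test function ψ, the fundamental theorem of calculus along the segment [0, h] and the
Gauss–Green formula give ∫₀¹ ∫ ψ(y - th) h⋅σ(y) dμ(y) dt, where μ = |Dχ| and σ is the outward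
normal. For fixed y, the substitution z = th and ∫₀¹ e^{-a/t} t⁻² dt = e^{-a}/a collapse the
integrals over h and t into ∫ ψ(y - z) `flux κ (σ y) z` dz (`integral_dilations`). Since `flux` is
integrable in z, ψ may tend to χ almost everywhere, and the double integral becomes ∫ ∫ χ(y - z)
`flux κ (σ y) z` dz dμ(y).

The flux is odd in z and its absolute value has integral 4/κ², so its integral over the half-plane
H₋⁰(σ(y)) is -2/κ². It is nonpositive on that half-plane and nonnegative off it, so replacing the
half-plane by Ω - y raises its integral by exactly the integral of |flux| over the symmetric
difference (`bulk_eq`). Hence the double integral is 2P/κ² - ∫ `bulk` dμ. The linear maps λ and A_λ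
R_ν turn `bulk` into the two stated inner integrals, and the lower bound is the nonnegativity of
`bulk`.

The rest identifies (μ, σ) with ℋ¹ on ∂*Ω and ν. Existence of (μ, σ) comes from vague limits of the
positive and negative parts of the difference quotients of χ (`exists_isGaussGreenPolar`);
uniqueness and total mass P follow by testing (`IsGaussGreenPolar.unique`,
`IsGaussGreenPolar.perimeter_eq`). De Giorgi's identity μ = ℋ¹ on ∂*Ω is obtained from density
bounds, without blow-up limits or rectifiability. Where σ is close to ν in mean, translating a set A
by -sν changes |A ∩ Ω| by about s times the perimeter that is swept. Applied to rectangles this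
gives μ(S) ≤ (1+η) d for small sets S of diameter at most d containing a point of ∂*Ω
(`IsNormalAt.exists_measure_le`). Applied to a thin slab it gives μ(B_s) ≥ (2-η) s
(`IsNormalAt.exists_measureReal_ball_ge`), once a decay iteration has shown that Ω and its
complement have positive density at the point. Covering arguments turn both bounds into equality of
measures. -/

/-! ### Test functions and difference quotients of the characteristic function -/

/-- The characteristic function of a set of the plane. -/
def chi (Ω : Set Plane) (x : Plane) : ℝ := Ω.indicator (fun _ => (1 : ℝ)) x

theorem measurable_chi {Ω : Set Plane} (hΩ : MeasurableSet Ω) : Measurable (chi Ω) :=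
  measurable_const.indicator hΩ

theorem chi_nonneg (Ω : Set Plane) (x : Plane) : 0 ≤ chi Ω x :=
  Set.indicator_nonneg (fun _ _ => zero_le_one) x

theorem chi_le_one (Ω : Set Plane) (x : Plane) : chi Ω x ≤ 1 :=
  Set.indicator_le_self' (f := fun _ => (1 : ℝ)) (fun _ _ => zero_le_one) x

theorem chi_of_mem {Ω : Set Plane} {x : Plane} (hx : x ∈ Ω) : chi Ω x = 1 :=
  Set.indicator_of_mem hx _

theorem chi_of_notMem {Ω : Set Plane} {x : Plane} (hx : x ∉ Ω) : chi Ω x = 0 :=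
  Set.indicator_of_notMem hx _

theorem setIntegral_eq_integral_mul_chi {Ω : Set Plane} (hΩ : MeasurableSet Ω) (f : Plane → ℝ) :
    ∫ x in Ω, f x = ∫ x, f x * chi Ω x := by
  rw [← integral_indicator hΩ]
  congr 1 with x
  by_cases hx : x ∈ Ω <;> simp [chi, hx]

theorem coord_decomp (h : Plane) : h = h 0 • e₁ + h 1 • e₂ := by
  ext i; fin_cases i <;> simp [e₁, e₂]

theorem divergence_smul_const {ψ : Plane → ℝ} (hψ : ContDiff ℝ 1 ψ) (h x : Plane) :
    divergence (fun x => ψ x • h) x = fderiv ℝ ψ x h := by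
  have hd : DifferentiableAt ℝ ψ x := hψ.differentiable (by norm_num) x
  have h1 : fderiv ℝ (fun x => ψ x • h) x = (fderiv ℝ ψ x).smulRight h :=
    (hd.hasFDerivAt.smul_const h).fderiv
  rw [divergence, h1]
  conv_rhs => rw [coord_decomp h, map_add, map_smul, map_smul]
  simp
  ring

theorem isTestField_smul_const {ψ : Plane → ℝ} (hψ : ContDiff ℝ 1 ψ) (hc : HasCompactSupport ψ)
    (h : Plane) : IsTestField (fun x => ψ x • h) :=
  ⟨hψ.smul contDiff_const, hc.smul_right⟩

theorem contDiff_translate {ψ : Plane → ℝ} (hψ : ContDiff ℝ 1 ψ) (h : Plane) :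
    ContDiff ℝ 1 (fun x => ψ (x - h)) :=
  hψ.comp (contDiff_id.sub contDiff_const)

theorem hasCompactSupport_translate {ψ : Plane → ℝ} (hc : HasCompactSupport ψ) (h : Plane) :
    HasCompactSupport (fun x => ψ (x - h)) :=
  hc.comp_homeomorph (Homeomorph.subRight h)

theorem fderiv_translate (ψ : Plane → ℝ) (h x : Plane) :
    fderiv ℝ (fun x => ψ (x - h)) x = fderiv ℝ ψ (x - h) := by
  simpa using fderiv_comp_sub (f := ψ) (x := x) h

/-- A jointly measurable bounded function of `(t, x)` that vanishes for `x` outside a compact set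
is integrable on `[0, 1] × ℝ²` for each locally finite measure. -/
theorem integrable_unitInterval_prod {μ : Measure Plane} [IsLocallyFiniteMeasure μ]
    {F : ℝ → Plane → ℝ}
    (hF : AEStronglyMeasurable (Function.uncurry F) ((volume.restrict (Set.uIoc 0 1)).prod μ))
    {C R : ℝ} (hC : ∀ᵐ p ∂((volume.restrict (Set.uIoc (0 : ℝ) 1)).prod μ),
      |Function.uncurry F p| ≤ C * (Metric.closedBall (0 : Plane) R).indicator 1 p.2) :
    Integrable (Function.uncurry F) ((volume.restrict (Set.uIoc 0 1)).prod μ) := by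
  refine Integrable.mono' (g := fun p : ℝ × Plane =>
    C * (Metric.closedBall (0 : Plane) R).indicator 1 p.2) ?_ hF hC
  have hfin : IsFiniteMeasure (volume.restrict (Set.uIoc (0 : ℝ) 1)) := by
    rw [Set.uIoc_of_le zero_le_one]; infer_instance
  have h1 : Integrable ((Metric.closedBall (0 : Plane) R).indicator (1 : Plane → ℝ)) μ := by
    rw [integrable_indicator_iff Metric.isClosed_closedBall.measurableSet]
    exact integrableOn_const (isCompact_closedBall _ _).measure_lt_top.ne
  exact (h1.comp_snd _).const_mul C

theorem exists_closedBall_of_hasCompactSupport {E : Type*} [Zero E] {f : Plane → E}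
    (hc : HasCompactSupport f) : ∃ R : ℝ, 0 ≤ R ∧ ∀ x, R < ‖x‖ → f x = 0 := by
  obtain ⟨R, hR⟩ := hc.isCompact.isBounded.subset_closedBall 0
  refine ⟨max R 0, le_max_right _ _, fun x hx => ?_⟩
  by_contra hne
  have := hR (subset_tsupport f hne)
  rw [mem_closedBall_zero_iff] at this
  exact absurd hx (not_lt.2 (this.trans (le_max_left _ _)))

theorem norm_sub_unitInterval_smul {t : ℝ} (ht : t ∈ Set.uIoc (0 : ℝ) 1) (x h : Plane) {R : ℝ}
    (hx : R + ‖h‖ < ‖x‖) : R < ‖x - t • h‖ := by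
  rw [Set.uIoc_of_le zero_le_one] at ht
  have h1 : ‖t • h‖ ≤ ‖h‖ := by
    rw [norm_smul, Real.norm_of_nonneg ht.1.le]
    exact mul_le_of_le_one_left (norm_nonneg _) ht.2
  have h2 := norm_sub_norm_le x (t • h)
  linarith

theorem continuous_fderiv_translate {ψ : Plane → ℝ} (hψ : ContDiff ℝ 1 ψ) (h : Plane) :
    Continuous (fun p : ℝ × Plane => fderiv ℝ ψ (p.2 - p.1 • h) h) :=
  ((hψ.continuous_fderiv (by norm_num)).comp (by fun_prop)).clm_apply continuous_const

theorem integrable_fderiv_translate {ψ : Plane → ℝ} (hψ : ContDiff ℝ 1 ψ)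
    (hc : HasCompactSupport ψ) (Ω : Set Plane) (h : Plane) :
    Integrable (Function.uncurry fun (t : ℝ) (x : Plane) => fderiv ℝ ψ (x - t • h) h)
      ((volume.restrict (Set.uIoc 0 1)).prod (volume.restrict Ω)) := by
  obtain ⟨R, hR0, hR⟩ := exists_closedBall_of_hasCompactSupport (hc.fderiv (𝕜 := ℝ))
  obtain ⟨C, hC⟩ := (hψ.continuous_fderiv (by norm_num)).bounded_above_of_compact_support
    (hc.fderiv (𝕜 := ℝ))
  refine integrable_unitInterval_prod (C := C * ‖h‖) (R := R + ‖h‖)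
    (continuous_fderiv_translate hψ h).aestronglyMeasurable ?_
  have hmem : ∀ᵐ p ∂((volume.restrict (Set.uIoc (0 : ℝ) 1)).prod (volume.restrict Ω)),
      p.1 ∈ Set.uIoc (0 : ℝ) 1 :=
    Measure.quasiMeasurePreserving_fst.ae (ae_restrict_mem measurableSet_uIoc)
  filter_upwards [hmem] with p hp
  by_cases hx : p.2 ∈ Metric.closedBall (0 : Plane) (R + ‖h‖)
  · simp only [Function.uncurry, Set.indicator_of_mem hx, Pi.one_apply, mul_one]
    exact ((fderiv ℝ ψ (p.2 - p.1 • h)).le_opNorm h).trans (by gcongr; exact hC _)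
  · simp only [mem_closedBall_zero_iff, not_le] at hx
    simp [Function.uncurry, hR _ (norm_sub_unitInterval_smul hp _ _ hx), hx]

/-- Difference quotients of a test function, integrated over a set. -/
theorem integral_sub_translate {ψ : Plane → ℝ} (hψ : ContDiff ℝ 1 ψ) (hc : HasCompactSupport ψ)
    (Ω : Set Plane) (h : Plane) :
    ∫ x in Ω, (ψ (x - h) - ψ x) =
      -∫ t in (0 : ℝ)..1, ∫ x in Ω, fderiv ℝ ψ (x - t • h) h := by
  have hcont := continuous_fderiv_translate hψ h
  rw [intervalIntegral_integral_swap (integrable_fderiv_translate hψ hc Ω h), ← integral_neg]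
  congr 1 with x
  have hderiv : ∀ t ∈ Set.uIcc (0 : ℝ) 1,
      HasDerivAt (fun t : ℝ => ψ (x - t • h)) (-(fderiv ℝ ψ (x - t • h) h)) t := by
    intro t _
    have h1 : HasDerivAt (fun t : ℝ => x - t • h) (-h) t := by
      simpa using ((hasDerivAt_id t).smul_const h).const_sub x
    have h2 := ((hψ.differentiable (by norm_num)) (x - t • h)).hasFDerivAt.comp_hasDerivAt t h1
    rw [map_neg] at h2
    exact h2
  have hci : IntervalIntegrable (fun t : ℝ => -(fderiv ℝ ψ (x - t • h) h)) volume 0 1 :=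
    ((hcont.comp (Continuous.prodMk_left x)).neg).intervalIntegrable _ _
  have := intervalIntegral.integral_eq_sub_of_hasDerivAt hderiv hci
  rw [intervalIntegral.integral_neg] at this
  simp at this
  linarith

theorem integrable_mul_chi {ψ : Plane → ℝ} (hψ : Integrable ψ) {Ω : Set Plane}
    (hΩ : MeasurableSet Ω) (h : Plane) : Integrable (fun x => ψ x * chi Ω (x + h)) := by
  refine hψ.mul_bdd (c := 1)
    ((measurable_chi hΩ).comp (measurable_id.add_const h)).aestronglyMeasurable ?_
  refine Eventually.of_forall fun x => ?_
  rw [Real.norm_of_nonneg (chi_nonneg _ _)]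
  exact chi_le_one _ _

/-- Translation invariance moves the difference from the rough factor to ψ, where the fundamental
theorem of calculus applies. -/
theorem integral_mul_chi_sub_chi {ψ : Plane → ℝ} (hψ : ContDiff ℝ 1 ψ)
    (hc : HasCompactSupport ψ) {Ω : Set Plane} (hΩ : MeasurableSet Ω) (h : Plane) :
    ∫ x, ψ x * (chi Ω (x + h) - chi Ω x) =
      -∫ t in (0 : ℝ)..1, ∫ x in Ω, fderiv ℝ ψ (x - t • h) h := by
  have hi : Integrable ψ := hψ.continuous.integrable_of_hasCompactSupport hc
  have hi' : Integrable (fun x => ψ (x - h)) :=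
    (contDiff_translate hψ h).continuous.integrable_of_hasCompactSupport
      (hasCompactSupport_translate hc h)
  have h0 : Integrable (fun x => ψ x * chi Ω x) := by simpa using integrable_mul_chi hi hΩ 0
  have h0' : Integrable (fun x => ψ (x - h) * chi Ω x) := by
    simpa using integrable_mul_chi hi' hΩ 0
  rw [← integral_sub_translate hψ hc, setIntegral_eq_integral_mul_chi hΩ]
  simp_rw [mul_sub, sub_mul]
  rw [integral_sub (integrable_mul_chi hi hΩ h) h0, integral_sub h0' h0]
  congr 1
  rw [← integral_add_right_eq_self (fun x => ψ (x - h) * chi Ω x) h]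
  simp

/-- Smooth approximations of a bounded measurable function. -/
theorem exists_mollification {g : Plane → ℝ} (hg : Measurable g) {M : ℝ}
    (hM : ∀ x, |g x| ≤ M) :
    ∃ ψ : ℕ → Plane → ℝ, (∀ n, ContDiff ℝ 1 (ψ n)) ∧ (∀ n, HasCompactSupport (ψ n)) ∧
      (∀ n x, |ψ n x| ≤ M) ∧ (∀ᵐ x, Tendsto (fun n => ψ n x) atTop (𝓝 (g x))) ∧
      (∀ n x, (∀ z, 0 ≤ g z) → 0 ≤ ψ n x) ∧
      (∀ (n : ℕ) x, (∀ z ∈ Metric.ball x (1 / ((n : ℝ) + 1)), g z = 0) → ψ n x = 0) ∧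
      (∀ (n : ℕ) x c, ‖x‖ ≤ n + 1 → (∀ z ∈ Metric.ball x (1 / ((n : ℝ) + 1)), g z = c) → ψ n x = c) := by
  have hpos : ∀ n : ℕ, (0 : ℝ) < 1 / ((n : ℝ) + 1) := fun n => by positivity
  let φ : ℕ → ContDiffBump (0 : Plane) := fun n =>
    ⟨1 / ((n : ℝ) + 1) / 2, 1 / ((n : ℝ) + 1), half_pos (hpos n), half_lt_self (hpos n)⟩
  -- Mollification alone need not give compact support; this cutoff does, and it equals 1 on the
  -- ball of radius n + 1, so pointwise limits are unaffected.
  let η : ℕ → ContDiffBump (0 : Plane) := fun n =>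
    ⟨(n : ℝ) + 1, (n : ℝ) + 2, by positivity, by linarith⟩
  have hM0 : 0 ≤ M := (abs_nonneg _).trans (hM 0)
  have hgl : LocallyIntegrable g := by
    refine (locallyIntegrable_const M).mono hg.aestronglyMeasurable (Eventually.of_forall fun x => ?_)
    rw [Real.norm_eq_abs, Real.norm_of_nonneg hM0]; exact hM x
  let u : ℕ → Plane → ℝ := fun n =>
    convolution ((φ n).normed volume) g (ContinuousLinearMap.lsmul ℝ ℝ) volume
  have hdist : ∀ (n : ℕ) x z₀ ε, 0 ≤ ε → (∀ z ∈ Metric.ball x (1 / ((n : ℝ) + 1)), dist (g z) z₀ ≤ ε) →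
      dist (u n x) z₀ ≤ ε := fun n x z₀ ε hε hz =>
    dist_convolution_le hε (φ n).support_normed_eq.subset (φ n).nonneg_normed (φ n).integral_normed
      hg.aestronglyMeasurable hz
  have hη0 : ∀ n x, 0 ≤ η n x := fun n x => (η n).nonneg
  have hη1 : ∀ n x, η n x ≤ 1 := fun n x => (η n).le_one
  refine ⟨fun n x => η n x * u n x, fun n => ?_, fun n => ?_, fun n x => ?_, ?_, fun n x h0 => ?_,
    fun n x h0 => ?_, fun n x c hx h0 => ?_⟩
  · refine (η n).contDiff.mul ?_
    exact HasCompactSupport.contDiff_convolution_left _ (n := 1) (φ n).hasCompactSupport_normed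
      (φ n).contDiff_normed hgl
  · exact (η n).hasCompactSupport.mul_right
  · have := hdist n x 0 M hM0 (fun z _ => by simpa using hM z)
    rw [dist_zero_right, Real.norm_eq_abs] at this
    rw [abs_mul, abs_of_nonneg (hη0 n x)]
    exact (mul_le_of_le_one_left (abs_nonneg _) (hη1 n x)).trans this
  · have hae := ContDiffBump.ae_convolution_tendsto_right_of_locallyIntegrable
      (μ := (volume : Measure Plane)) (φ := φ) (l := atTop) (K := 2)
      tendsto_one_div_add_atTop_nhds_zero_nat
      (Eventually.of_forall fun n => by simp only [φ]; linarith) hgl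
    filter_upwards [hae] with x hx
    refine hx.congr' ?_
    filter_upwards [eventually_ge_atTop ⌈‖x‖⌉₊] with n hn
    have hxn : ‖x‖ ≤ n := (Nat.le_ceil _).trans (by exact_mod_cast hn)
    have : η n x = 1 := (η n).one_of_mem_closedBall (by
      simp only [mem_closedBall_zero_iff, η]; linarith)
    simp [this, u]
  -- A nonnegative function bounded by M stays within M/2 of M/2, so its local averages do too.
  · have := hdist n x (M / 2) (M / 2) (by positivity) (fun z _ => by
      have h1 := hM z
      rw [abs_of_nonneg (h0 z)] at h1
      rw [Real.dist_eq, abs_le]; constructor <;> linarith [h0 z])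
    rw [Real.dist_eq, abs_le] at this
    exact mul_nonneg (hη0 n x) (by linarith)
  · have := hdist n x 0 0 le_rfl (fun z hz => by simp [h0 z hz])
    rw [dist_le_zero] at this
    simp [this]
  · have h1 := hdist n x c 0 le_rfl (fun z hz => by simp [h0 z hz])
    rw [dist_le_zero] at h1
    have : η n x = 1 := (η n).one_of_mem_closedBall (by
      simp only [mem_closedBall_zero_iff, η]; linarith)
    simp [this, h1]

theorem setIntegral_divergence_le {Ω : Set Plane} (hP : perimeter Ω < ∞) {T : Plane → Plane}
    (hT : IsTestField T) (h1 : ∀ x, ‖T x‖ ≤ 1) :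
    ∫ x in Ω, divergence T x ≤ (perimeter Ω).toReal := by
  have h : ENNReal.ofReal (∫ x in Ω, divergence T x) ≤ perimeter Ω :=
    le_iSup₂_of_le (f := fun T (_ : T ∈ {T : Plane → Plane | IsTestField T ∧ ∀ x, ‖T x‖ ≤ 1}) =>
      ENNReal.ofReal (∫ x in Ω, divergence T x)) T ⟨hT, h1⟩ le_rfl
  exact (ENNReal.ofReal_le_iff_le_toReal hP.ne).1 h

/-- The field ψ h / (M|h|) is admissible in the supremum that defines the perimeter. -/
theorem setIntegral_fderiv_le {Ω : Set Plane} (hP : perimeter Ω < ∞) {ψ : Plane → ℝ}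
    (hψ : ContDiff ℝ 1 ψ) (hc : HasCompactSupport ψ) {M : ℝ} (hM : ∀ x, |ψ x| ≤ M) (h : Plane) :
    ∫ x in Ω, fderiv ℝ ψ x h ≤ M * ‖h‖ * (perimeter Ω).toReal := by
  have hM0 : 0 ≤ M := (abs_nonneg _).trans (hM 0)
  rcases eq_or_lt_of_le (mul_nonneg hM0 (norm_nonneg h)) with h0 | hpos
  · have : ∀ x, fderiv ℝ ψ x h = 0 := by
      rcases mul_eq_zero.1 h0.symm with h1 | h1
      · have : ψ = fun _ => 0 := funext fun x => abs_nonpos_iff.1 (h1 ▸ hM x)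
        simp [this]
      · simp [norm_eq_zero.1 h1]
    simp [this, ← h0]
  · set c := M * ‖h‖ with hc'
    have h1 := setIntegral_divergence_le hP (isTestField_smul_const hψ hc (c⁻¹ • h)) (fun x => by
      rw [norm_smul, norm_smul, norm_inv, Real.norm_of_nonneg hpos.le, Real.norm_eq_abs,
        mul_left_comm, inv_mul_le_iff₀ hpos, mul_one]
      exact mul_le_mul_of_nonneg_right (hM x) (norm_nonneg h))
    simp only [divergence_smul_const hψ, map_smul, smul_eq_mul] at h1
    rwa [integral_const_mul, inv_mul_le_iff₀ hpos] at h1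

theorem integral_chi_sub_chi_le {Ω : Set Plane} (hΩ : MeasurableSet Ω) (hP : perimeter Ω < ∞)
    {ψ : Plane → ℝ} (hψ : ContDiff ℝ 1 ψ) (hc : HasCompactSupport ψ) {M : ℝ}
    (hM : ∀ x, |ψ x| ≤ M) (h : Plane) :
    |∫ x, ψ x * (chi Ω (x + h) - chi Ω x)| ≤ M * ‖h‖ * (perimeter Ω).toReal := by
  rw [integral_mul_chi_sub_chi hψ hc hΩ, abs_neg, ← Real.norm_eq_abs]
  refine (intervalIntegral.norm_integral_le_of_norm_le_const
    (C := M * ‖h‖ * (perimeter Ω).toReal) fun t _ => ?_).trans (by simp)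
  have h1 := setIntegral_fderiv_le hP (contDiff_translate hψ (t • h))
    (hasCompactSupport_translate hc (t • h)) (fun x => hM _) h
  have h2 := setIntegral_fderiv_le hP (contDiff_translate hψ (t • h))
    (hasCompactSupport_translate hc (t • h)) (fun x => hM _) (-h)
  simp only [fderiv_translate, map_neg, integral_neg, norm_neg] at h1 h2
  rw [Real.norm_eq_abs, abs_le]
  constructor <;> linarith

theorem integrable_chi {Ω : Set Plane} (hΩ : MeasurableSet Ω) (hfin : volume Ω < ∞) :
    Integrable (chi Ω) := by
  have : chi Ω = Ω.indicator (fun _ => (1 : ℝ)) := rfl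
  rw [this, integrable_indicator_iff hΩ]
  exact integrableOn_const hfin.ne

theorem integrable_chi_sub_chi {Ω : Set Plane} (hΩ : MeasurableSet Ω) (hfin : volume Ω < ∞)
    (h : Plane) : Integrable (fun x => chi Ω (x + h) - chi Ω x) :=
  ((integrable_chi hΩ hfin).comp_add_right h).sub (integrable_chi hΩ hfin)

theorem tendsto_integral_mul_of_bounded {ψ : ℕ → Plane → ℝ} {g f : Plane → ℝ} {M : ℝ}
    (hψ : ∀ n, AEStronglyMeasurable (ψ n)) (hM : ∀ n x, |ψ n x| ≤ M)
    (hlim : ∀ᵐ x, Tendsto (fun n => ψ n x) atTop (𝓝 (g x))) (hf : Integrable f) :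
    Tendsto (fun n => ∫ x, ψ n x * f x) atTop (𝓝 (∫ x, g x * f x)) := by
  refine tendsto_integral_of_dominated_convergence (fun x => M * ‖f x‖)
    (fun n => (hψ n).mul hf.aestronglyMeasurable) (hf.norm.const_mul M)
    (fun n => Eventually.of_forall fun x => ?_) ?_
  · rw [norm_mul]
    exact mul_le_mul_of_nonneg_right (hM n x) (norm_nonneg _)
  · filter_upwards [hlim] with x hx using hx.mul_const _

/-- The difference quotients of the characteristic function of a set of finite perimeter are
bounded in `L¹` by the perimeter. -/
theorem abs_integral_mul_chi_sub_chi_le {Ω : Set Plane} (hΩ : MeasurableSet Ω)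
    (hfin : volume Ω < ∞) (hP : perimeter Ω < ∞) {g : Plane → ℝ} (hg : Measurable g) {M : ℝ}
    (hM : ∀ x, |g x| ≤ M) (h : Plane) :
    |∫ x, g x * (chi Ω (x + h) - chi Ω x)| ≤ M * ‖h‖ * (perimeter Ω).toReal := by
  obtain ⟨ψ, h1, h2, h3, h4, -⟩ := exists_mollification hg hM
  have hlim := tendsto_integral_mul_of_bounded (fun n => (h1 n).continuous.aestronglyMeasurable)
    h3 h4 (integrable_chi_sub_chi hΩ hfin h)
  exact le_of_tendsto hlim.abs
    (Eventually.of_forall fun n => integral_chi_sub_chi_le hΩ hP (h1 n) (h2 n) (h3 n) h)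

/-! ### Translating sets against the Gauss–Green measure -/

section Polar

variable {Ω : Set Plane} {μ : Measure Plane} {σ : Plane → Plane}

theorem IsGaussGreenPolar.setIntegral_fderiv (hpol : IsGaussGreenPolar Ω μ σ) {ψ : Plane → ℝ}
    (hψ : ContDiff ℝ 1 ψ) (hc : HasCompactSupport ψ) (h : Plane) :
    ∫ x in Ω, fderiv ℝ ψ x h = ∫ x, ψ x * inner ℝ h (σ x) ∂μ := by
  have := hpol.2.2.2 _ (isTestField_smul_const hψ hc h)
  simpa only [divergence_smul_const hψ, real_inner_smul_left] using this

theorem IsGaussGreenPolar.integral_mul_chi_sub_chi (hpol : IsGaussGreenPolar Ω μ σ)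
    (hΩ : MeasurableSet Ω) {ψ : Plane → ℝ}
    (hψ : ContDiff ℝ 1 ψ) (hc : HasCompactSupport ψ) (h : Plane) :
    ∫ x, ψ x * (chi Ω (x + h) - chi Ω x) =
      -∫ t in (0 : ℝ)..1, ∫ x, ψ (x - t • h) * inner ℝ h (σ x) ∂μ := by
  rw [ScreenedPerimeter.integral_mul_chi_sub_chi hψ hc hΩ]
  congr 2 with t
  rw [← hpol.setIntegral_fderiv (contDiff_translate hψ (t • h))
    (hasCompactSupport_translate hc (t • h))]
  simp_rw [fderiv_translate]

/-- The quantity is an average over t ∈ [0, 1] of the integrals that are assumed to lie in [a, b].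
Integrability in t is read off from the volume form ∫_Ω ∂_h ψ(x - th) dx. -/
theorem IsGaussGreenPolar.neg_integral_mem_Icc (hpol : IsGaussGreenPolar Ω μ σ)
    (hΩ : MeasurableSet Ω) {ψ : Plane → ℝ}
    (hψ : ContDiff ℝ 1 ψ) (hc : HasCompactSupport ψ) (h : Plane) {a b : ℝ}
    (hab : ∀ t ∈ Set.Icc (0 : ℝ) 1,
      ∫ x, ψ (x - t • h) * inner ℝ h (σ x) ∂μ ∈ Set.Icc a b) :
    -∫ x, ψ x * (chi Ω (x + h) - chi Ω x) ∈ Set.Icc a b := by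
  rw [hpol.integral_mul_chi_sub_chi hΩ hψ hc, neg_neg]
  have hJ : ∀ t : ℝ, ∫ x, ψ (x - t • h) * inner ℝ h (σ x) ∂μ =
      ∫ x in Ω, fderiv ℝ ψ (x - t • h) h := fun t => by
    rw [← hpol.setIntegral_fderiv (contDiff_translate hψ (t • h))
      (hasCompactSupport_translate hc (t • h))]
    simp_rw [fderiv_translate]
  simp_rw [hJ] at hab ⊢
  have hInt : IntervalIntegrable (fun t : ℝ => ∫ x in Ω, fderiv ℝ ψ (x - t • h) h) volume 0 1 := by
    rw [intervalIntegrable_iff]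
    exact (integrable_fderiv_translate hψ hc Ω h).integral_prod_left
  have hca := intervalIntegral.integral_mono_on zero_le_one
    (intervalIntegrable_const (μ := volume) (c := a)) hInt (fun t ht => (hab t ht).1)
  have hcb := intervalIntegral.integral_mono_on zero_le_one hInt
    (intervalIntegrable_const (μ := volume) (c := b)) (fun t ht => (hab t ht).2)
  simp at hca hcb
  exact ⟨hca, hcb⟩

/-- Bounds on the translates of smooth cutoffs of a bounded set pass to the set. -/
theorem IsGaussGreenPolar.neg_setIntegral_mem_Icc (hpol : IsGaussGreenPolar Ω μ σ)
    (hΩ : MeasurableSet Ω) {A : Set Plane} (hA : MeasurableSet A) (hAb : Bornology.IsBounded A)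
    (h : Plane) {δ : ℝ} (hδ : 0 < δ) {a b : ℝ}
    (hab : ∀ ψ : Plane → ℝ, ContDiff ℝ 1 ψ → HasCompactSupport ψ → (∀ x, 0 ≤ ψ x) →
      (∀ x, ψ x ≤ 1) → (∀ x, (∀ z ∈ Metric.ball x δ, z ∉ A) → ψ x = 0) →
      (∀ x, Metric.ball x δ ⊆ A → ψ x = 1) →
      ∀ t ∈ Set.Icc (0 : ℝ) 1, ∫ x, ψ (x - t • h) * inner ℝ h (σ x) ∂μ ∈ Set.Icc a b) :
    -∫ x in A, (chi Ω (x + h) - chi Ω x) ∈ Set.Icc a b := by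
  obtain ⟨R, hR⟩ := hAb.subset_closedBall 0
  obtain ⟨ψ, h1, h2, h3, h4, h5, h6, h7⟩ := exists_mollification (measurable_chi hA) (M := 1)
    (fun x => by rw [abs_of_nonneg (chi_nonneg _ _)]; exact chi_le_one _ _)
  have hmeas : Measurable (fun x => chi Ω (x + h) - chi Ω x) :=
    ((measurable_chi hΩ).comp (measurable_id.add_const h)).sub (measurable_chi hΩ)
  have hlim : Tendsto (fun n => ∫ x, ψ n x * (chi Ω (x + h) - chi Ω x)) atTop
      (𝓝 (∫ x, chi A x * (chi Ω (x + h) - chi Ω x))) := by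
    refine tendsto_integral_of_dominated_convergence
      ((Metric.closedBall (0 : Plane) (R + 1)).indicator 1)
      (fun n => ((h1 n).continuous.aestronglyMeasurable).mul hmeas.aestronglyMeasurable) ?_
      (fun n => Eventually.of_forall fun x => ?_) ?_
    · rw [integrable_indicator_iff Metric.isClosed_closedBall.measurableSet]
      exact integrableOn_const (isCompact_closedBall _ _).measure_lt_top.ne
    · have hle : ‖chi Ω (x + h) - chi Ω x‖ ≤ 1 := by
        rw [Real.norm_eq_abs, abs_le]
        constructor <;> linarith [chi_nonneg Ω x, chi_le_one Ω x, chi_nonneg Ω (x + h),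
          chi_le_one Ω (x + h)]
      by_cases hx : x ∈ Metric.closedBall (0 : Plane) (R + 1)
      · rw [Set.indicator_of_mem hx, norm_mul, Pi.one_apply]
        exact mul_le_one₀ (h3 n x) (norm_nonneg _) hle
      · rw [Set.indicator_of_notMem hx, h6 n x, zero_mul, norm_zero]
        intro z hz
        refine chi_of_notMem fun hzA => hx ?_
        have hz1 := hR hzA
        rw [mem_closedBall_zero_iff] at hz1 ⊢
        rw [Metric.mem_ball, dist_eq_norm] at hz
        have : 1 / ((n : ℝ) + 1) ≤ 1 := by
          rw [div_le_one (by positivity)]; linarith [n.cast_nonneg (α := ℝ)]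
        have := norm_sub_norm_le x z
        rw [norm_sub_rev] at this
        linarith
    · filter_upwards [h4] with x hx using hx.mul_const _
  have hchi : ∫ x in A, (chi Ω (x + h) - chi Ω x) =
      ∫ x, chi A x * (chi Ω (x + h) - chi Ω x) := by
    rw [setIntegral_eq_integral_mul_chi hA]
    simp_rw [mul_comm]
  rw [hchi]
  refine isClosed_Icc.mem_of_tendsto hlim.neg ?_
  have hsmall : ∀ᶠ n : ℕ in atTop, 1 / ((n : ℝ) + 1) < δ :=
    tendsto_one_div_add_atTop_nhds_zero_nat.eventually (gt_mem_nhds hδ)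
  filter_upwards [hsmall, eventually_ge_atTop ⌈R⌉₊] with n hn hnR
  refine hpol.neg_integral_mem_Icc hΩ (h1 n) (h2 n) h (hab (ψ n) (h1 n) (h2 n)
    (fun x => h5 n x (chi_nonneg A)) (fun x => (le_abs_self _).trans (h3 n x)) ?_ ?_)
  · intro x hx
    exact h6 n x fun z hz => chi_of_notMem (hx z (Metric.ball_subset_ball hn.le hz))
  · intro x hx
    refine h7 n x 1 ?_ fun z hz => chi_of_mem (hx (Metric.ball_subset_ball hn.le hz))
    have := hR (hx (Metric.mem_ball_self hδ))
    rw [mem_closedBall_zero_iff] at this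
    have h8 : R ≤ n := (Nat.le_ceil _).trans (by exact_mod_cast hnR)
    linarith

theorem IsGaussGreenPolar.integrableOn_norm_sub (hpol : IsGaussGreenPolar Ω μ σ) {U : Set Plane}
    (hUμ : μ U < ∞) (ν : Plane) : IntegrableOn (fun x => ‖σ x - ν‖) U μ := by
  have : IsFiniteMeasure (μ.restrict U) := ⟨by simpa using hUμ⟩
  refine Integrable.of_bound (C := 1 + ‖ν‖)
    (hpol.2.1.sub_const ν).norm.aestronglyMeasurable ?_
  filter_upwards [ae_restrict_of_ae hpol.2.2.1] with x hx
  rw [norm_norm]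
  exact (norm_sub_le _ _).trans (by rw [hx])

theorem IsGaussGreenPolar.integrable_mul_inner (hpol : IsGaussGreenPolar Ω μ σ) {ψ : Plane → ℝ}
    (hψ : Continuous ψ) (hc : HasCompactSupport ψ) (h : Plane) :
    Integrable (fun x => ψ x * inner ℝ h (σ x)) μ := by
  have := hpol.1
  refine (hψ.integrable_of_hasCompactSupport hc).mul_bdd (c := ‖h‖)
    (measurable_const.inner hpol.2.1).aestronglyMeasurable ?_
  filter_upwards [hpol.2.2.1] with x hx
  exact (norm_inner_le_norm _ _).trans (by rw [hx, mul_one])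

end Polar

section Polar

variable {Ω : Set Plane} {μ : Measure Plane} {σ : Plane → Plane}

theorem neg_norm_sub_le_inner {h ν s : Plane} (hν : 0 ≤ inner ℝ h ν) :
    -(‖h‖ * ‖s - ν‖) ≤ inner ℝ h s := by
  have h1 : inner ℝ h s = inner ℝ h ν + inner ℝ h (s - ν) := by rw [inner_sub_right]; ring
  have h2 := neg_le_of_abs_le (abs_real_inner_le_norm h (s - ν))
  linarith

/-- Moving a bounded set in a direction that is not opposite to `ν` decreases the volume of `Ω`
up to the excess of the normal with respect to `ν`. -/
theorem IsGaussGreenPolar.setIntegral_translate_le (hpol : IsGaussGreenPolar Ω μ σ)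
    (hΩ : MeasurableSet Ω) {A U : Set Plane} (hA : MeasurableSet A)
    (hAb : Bornology.IsBounded A) (hU : MeasurableSet U) (hUμ : μ U < ∞) {h ν : Plane}
    (hν : 0 ≤ inner ℝ h ν) {δ : ℝ} (hδ : 0 < δ)
    (hAU : ∀ x, ∀ t ∈ Set.Icc (0 : ℝ) 1, ∀ z ∈ Metric.ball (x - t • h) δ, z ∈ A → x ∈ U) :
    ∫ x in A, (chi Ω (x + h) - chi Ω x) ≤ ‖h‖ * ∫ x in U, ‖σ x - ν‖ ∂μ := by
  have key : -∫ x in A, (chi Ω (x + h) - chi Ω x) ∈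
      Set.Icc (∫ x in U, -(‖h‖ * ‖σ x - ν‖) ∂μ) (∫ x in U, ‖h‖ ∂μ) := by
    refine hpol.neg_setIntegral_mem_Icc hΩ hA hAb h hδ ?_
    intro ψ hψ hc h0 h1 hz _ t ht
    have hInt := hpol.integrable_mul_inner (contDiff_translate hψ (t • h)).continuous
      (hasCompactSupport_translate hc (t • h)) h
    have hzero : ∀ x, x ∉ U → ψ (x - t • h) = 0 := fun x hx =>
      hz _ fun z hzb hzA => hx (hAU x t ht z hzb hzA)
    rw [← integral_indicator hU, ← integral_indicator hU]
    constructor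
    · refine integral_mono_ae ?_ hInt ?_
      · rw [integrable_indicator_iff hU]
        exact ((hpol.integrableOn_norm_sub hUμ ν).const_mul _).neg
      · refine Eventually.of_forall fun x => ?_
        by_cases hx : x ∈ U
        · have := neg_norm_sub_le_inner (s := σ x) hν
          have h2 : 0 ≤ ‖h‖ * ‖σ x - ν‖ := by positivity
          simp only [Set.indicator_of_mem hx]
          nlinarith [h0 (x - t • h), h1 (x - t • h)]
        · simp [hzero x hx, hx]
    · refine integral_mono_ae hInt ?_ ?_
      · rw [integrable_indicator_iff hU]
        exact integrableOn_const hUμ.ne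
      · filter_upwards [hpol.2.2.1] with x hx1
        by_cases hx : x ∈ U
        · have := le_of_abs_le (abs_real_inner_le_norm h (σ x))
          rw [hx1, mul_one] at this
          simp only [Set.indicator_of_mem hx]
          nlinarith [h0 (x - t • h), h1 (x - t • h), norm_nonneg h]
        · simp [hzero x hx, hx]
  have := key.1
  rw [integral_neg, integral_const_mul] at this
  linarith

/-- Moving a bounded set by `-s ν` increases the volume of `Ω` by about `s` times the perimeter
of `Ω` in the region swept out. -/
theorem IsGaussGreenPolar.setIntegral_translate_normal (hpol : IsGaussGreenPolar Ω μ σ)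
    (hΩ : MeasurableSet Ω) {A U V : Set Plane} (hA : MeasurableSet A)
    (hAb : Bornology.IsBounded A) (hU : MeasurableSet U) (hUμ : μ U < ∞) (hV : MeasurableSet V)
    {ν : Plane} (hν : ‖ν‖ = 1) {s : ℝ} (hs : 0 ≤ s) {δ : ℝ} (hδ : 0 < δ)
    (hAU : ∀ x, ∀ t ∈ Set.Icc (0 : ℝ) 1, ∀ z ∈ Metric.ball (x + (t * s) • ν) δ, z ∈ A → x ∈ U)
    (hVA : ∀ x ∈ V, ∀ t ∈ Set.Icc (0 : ℝ) 1, Metric.ball (x + (t * s) • ν) δ ⊆ A) :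
    s * (μ.real V - ∫ x in U, ‖σ x - ν‖ ∂μ) ≤ ∫ x in A, (chi Ω (x - s • ν) - chi Ω x) ∧
    ∫ x in A, (chi Ω (x - s • ν) - chi Ω x) ≤ s * μ.real U := by
  have hVU : V ⊆ U := fun x hx => hAU x 0 ⟨le_rfl, zero_le_one⟩ _ (Metric.mem_ball_self hδ)
    (hVA x hx 0 ⟨le_rfl, zero_le_one⟩ (Metric.mem_ball_self hδ))
  have hVμ : μ V < ∞ := (measure_mono hVU).trans_lt hUμ
  have hi1 : Integrable (U.indicator fun x => ‖σ x - ν‖) μ := by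
    rw [integrable_indicator_iff hU]; exact hpol.integrableOn_norm_sub hUμ ν
  have hi2 : Integrable (V.indicator fun _ => (1 : ℝ)) μ := by
    rw [integrable_indicator_iff hV]; exact integrableOn_const hVμ.ne
  have hi3 : Integrable (U.indicator fun _ => (1 : ℝ)) μ := by
    rw [integrable_indicator_iff hU]; exact integrableOn_const hUμ.ne
  have key : -∫ x in A, (chi Ω (x + -(s • ν)) - chi Ω x) ∈
      Set.Icc (∫ x, (-s) * U.indicator (fun _ => (1 : ℝ)) x ∂μ)
        (∫ x, (-s) * (V.indicator (fun _ => (1 : ℝ)) x - U.indicator (fun x => ‖σ x - ν‖) x) ∂μ) := by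
    refine hpol.neg_setIntegral_mem_Icc hΩ hA hAb (-(s • ν)) hδ ?_
    intro ψ hψ hc h0 h1 hz hz1 t ht
    have hInt := hpol.integrable_mul_inner (contDiff_translate hψ (t • -(s • ν))).continuous
      (hasCompactSupport_translate hc (t • -(s • ν))) (-(s • ν))
    have harg : ∀ x, x - t • -(s • ν) = x + (t * s) • ν := fun x => by
      rw [smul_neg, sub_neg_eq_add, smul_smul]
    simp only [harg, inner_neg_left, real_inner_smul_left] at hInt ⊢
    have hzero : ∀ x, x ∉ U → ψ (x + (t * s) • ν) = 0 := fun x hx =>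
      hz _ fun z hzb hzA => hx (hAU x t ht z hzb hzA)
    have hone : ∀ x, x ∈ V → ψ (x + (t * s) • ν) = 1 := fun x hx => hz1 _ (hVA x hx t ht)
    constructor
    · refine integral_mono_ae (hi3.const_mul _) hInt ?_
      filter_upwards [hpol.2.2.1] with x hx1
      by_cases hx : x ∈ U
      · have := le_of_abs_le (abs_real_inner_le_norm ν (σ x))
        rw [hx1, hν, mul_one] at this
        simp only [Set.indicator_of_mem hx]
        have h3 : ψ (x + (t * s) • ν) * inner ℝ ν (σ x) ≤ 1 := by
          nlinarith [h0 (x + (t * s) • ν), h1 (x + (t * s) • ν)]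
        nlinarith
      · simp [hzero x hx, hx]
    · refine integral_mono_ae hInt ((hi2.sub hi1).const_mul _) ?_
      refine Eventually.of_forall fun x => ?_
      by_cases hx : x ∈ U
      · have h4 : 1 - ‖σ x - ν‖ ≤ inner ℝ ν (σ x) := by
          have h5 : inner ℝ ν (σ x) = inner ℝ ν ν + inner ℝ ν (σ x - ν) := by
            rw [inner_sub_right]; ring
          have h6 := neg_le_of_abs_le (abs_real_inner_le_norm ν (σ x - ν))
          rw [real_inner_self_eq_norm_sq, hν] at h5
          rw [hν] at h6
          linarith
        -- On V the cutoff is 1 and ν⋅σ ≥ 1 - |σ - ν|. Off V it is only known to lie in [0, 1], and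
        -- ν⋅σ ≥ -|σ - ν| up to a positive term.
        have h7 : V.indicator (fun _ => (1 : ℝ)) x - ‖σ x - ν‖ ≤
            ψ (x + (t * s) • ν) * inner ℝ ν (σ x) := by
          by_cases hxV : x ∈ V
          · rw [hone x hxV, Set.indicator_of_mem hxV]; linarith
          · rw [Set.indicator_of_notMem hxV]
            have h8 := norm_nonneg (σ x - ν)
            nlinarith [h0 (x + (t * s) • ν), h1 (x + (t * s) • ν)]
        simp only [Set.indicator_of_mem hx]
        nlinarith
      · have hxV : x ∉ V := fun h => hx (hVU h)
        simp [hzero x hx, hx, hxV]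
  rw [integral_const_mul, integral_const_mul, integral_sub hi2 hi1, integral_indicator hU,
    integral_indicator hU, integral_indicator hV] at key
  simp only [← sub_eq_add_neg, integral_const, smul_eq_mul, mul_one, measureReal_restrict_apply_univ,
    Set.mem_Icc] at key
  constructor <;> linarith [key.1, key.2]

/-- The divergence of a compactly supported field has integral zero over the plane. Density bounds
for Ω thereby transfer to the complement with the opposite normal. -/
theorem IsGaussGreenPolar.compl (hpol : IsGaussGreenPolar Ω μ σ) (hΩ : NullMeasurableSet Ω volume) :
    IsGaussGreenPolar Ωᶜ μ (fun x => -σ x) := by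
  refine ⟨hpol.1, hpol.2.1.neg, by simpa using hpol.2.2.1, fun T hT => ?_⟩
  have hcd : Continuous (divergence T) := by
    have h1 := hT.1.continuous_fderiv (by norm_num)
    unfold divergence
    have h2 : ∀ e : Plane, Continuous fun x => fderiv ℝ T x e := fun e =>
      h1.clm_apply continuous_const
    exact ((EuclideanSpace.proj 0).continuous.comp (h2 e₁)).add
      ((EuclideanSpace.proj 1).continuous.comp (h2 e₂))
  have hcs : HasCompactSupport (divergence T) := by
    refine (hT.2.fderiv (𝕜 := ℝ)).mono fun x hx => ?_
    contrapose! hx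
    simp only [Function.mem_support, not_not] at hx ⊢
    simp [divergence, hx]
  have hInt : Integrable (divergence T) := hcd.integrable_of_hasCompactSupport hcs
  have hzero : ∫ x, divergence T x = 0 := by
    have hii : ∀ i (e : Plane), Integrable fun x => (fderiv ℝ T x e) i := fun i e => by
      refine Continuous.integrable_of_hasCompactSupport ?_ ?_
      · exact (EuclideanSpace.proj (𝕜 := ℝ) i).continuous.comp
          ((hT.1.continuous_fderiv (by norm_num)).clm_apply continuous_const)
      · refine (hT.2.fderiv (𝕜 := ℝ)).mono fun x hx => ?_
        contrapose! hx
        simp only [Function.mem_support, not_not] at hx ⊢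
        simp [hx]
    have hi : ∀ i (e : Plane), ∫ x, (fderiv ℝ T x e) i = 0 := fun i e => by
      have hTi : ContDiff ℝ 1 (fun x => T x i) := (EuclideanSpace.proj (𝕜 := ℝ) i).contDiff.comp hT.1
      have hsi : HasCompactSupport (fun x => T x i) := by
        refine hT.2.mono fun x hx => ?_
        contrapose! hx
        simp only [Function.mem_support, not_not] at hx ⊢
        simp [hx]
      have hfd : ∀ x, (fderiv ℝ T x e) i = fderiv ℝ (fun x => T x i) x e := fun x => by
        have h1 := ((EuclideanSpace.proj (𝕜 := ℝ) i : Plane →L[ℝ] ℝ).hasFDerivAt.comp x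
          (hT.1.differentiable (by norm_num) x).hasFDerivAt).fderiv
        have h2 : (fun x => T x i) = (EuclideanSpace.proj (𝕜 := ℝ) i) ∘ T := rfl
        rw [h2, h1]; rfl
      simp_rw [hfd]
      have h3 := integral_mul_fderiv_eq_neg_fderiv_mul_of_integrable (μ := (volume : Measure Plane))
        (f := fun _ => (1 : ℝ)) (g := fun x => T x i) (v := e) (by simp)
        (by simpa only [one_mul, hfd] using hii i e)
        (by simpa using hTi.continuous.integrable_of_hasCompactSupport hsi)
        (by simp) (fun x _ => hTi.differentiable (by norm_num) x)
      simpa using h3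
    unfold divergence
    rw [integral_add (hii _ _) (hii _ _), hi, hi, add_zero]
  have h1 := integral_add_compl₀ hΩ hInt
  rw [hzero, hpol.2.2.2 T hT] at h1
  simp_rw [inner_neg_right, integral_neg]
  linarith

end Polar

/-! ### Density estimates in balls where the normal oscillates little -/

/-- The oscillation of the normal `σ` around `ν` in the ball `B_s(y)`. -/
def excess (μ : Measure Plane) (σ : Plane → Plane) (y ν : Plane) (s : ℝ) : ℝ :=
  ∫ x in Metric.ball y s, ‖σ x - ν‖ ∂μ

theorem setIntegral_chi_translate {Ω A : Set Plane} (hΩ : MeasurableSet Ω) (h : Plane) :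
    ∫ x in A, chi Ω (x + h) = volume.real (A ∩ (fun x => x + h) ⁻¹' Ω) := by
  have hm : MeasurableSet ((fun x => x + h) ⁻¹' Ω) := hΩ.preimage (measurable_add_const h)
  have h1 : (fun x => chi Ω (x + h)) = ((fun x => x + h) ⁻¹' Ω).indicator (fun _ => (1 : ℝ)) := by
    rfl
  rw [h1, integral_indicator hm, integral_const, smul_eq_mul, mul_one,
    measureReal_restrict_apply_univ, measureReal_def, Measure.restrict_apply hm, measureReal_def,
    Set.inter_comm]

theorem integrableOn_chi_translate {Ω A : Set Plane} (hΩ : MeasurableSet Ω) (hA : volume A < ∞)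
    (h : Plane) : IntegrableOn (fun x => chi Ω (x + h)) A := by
  have : IsFiniteMeasure ((volume : Measure Plane).restrict A) := ⟨by simpa using hA⟩
  refine Integrable.of_bound (C := 1)
    ((measurable_chi hΩ).comp (measurable_id.add_const h)).aestronglyMeasurable ?_
  refine Eventually.of_forall fun x => ?_
  rw [Real.norm_of_nonneg (chi_nonneg _ _)]; exact chi_le_one _ _

theorem setIntegral_chi_sub_chi {Ω A : Set Plane} (hΩ : MeasurableSet Ω) (hA : volume A < ∞)
    (h : Plane) : ∫ x in A, (chi Ω (x + h) - chi Ω x) =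
      volume.real (A ∩ (fun x => x + h) ⁻¹' Ω) - volume.real (A ∩ Ω) := by
  have h0 : IntegrableOn (chi Ω) A := by simpa using integrableOn_chi_translate hΩ hA 0
  have h1 : ∫ x in A, chi Ω x = volume.real (A ∩ Ω) := by
    simpa using setIntegral_chi_translate (A := A) hΩ 0
  rw [integral_sub (integrableOn_chi_translate hΩ hA h) h0, setIntegral_chi_translate hΩ, h1]

theorem measureReal_inter_preimage_le {A B : Set Plane} (h : Plane) {C : Set Plane}
    (hC : volume C < ∞)
    (hAB : ∀ x ∈ A, x + h ∈ B → x + h ∈ C) :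
    volume.real (A ∩ (fun x => x + h) ⁻¹' B) ≤ volume.real C := by
  have h1 : volume ((fun x => x + h) ⁻¹' C) = volume C := measure_preimage_add_right volume h C
  have h2 : volume.real ((fun x => x + h) ⁻¹' C) = volume.real C := by
    simp only [measureReal_def, h1]
  rw [← h2]
  exact measureReal_mono (fun x hx => hAB x hx.1 hx.2) (by rw [h1]; exact hC.ne)

theorem volume_real_ball (x : Plane) {r : ℝ} (hr : 0 ≤ r) :
    volume.real (Metric.ball x r) = r ^ 2 * Real.pi := by
  rw [measureReal_def, EuclideanSpace.volume_ball_fin_two, ENNReal.toReal_mul, ENNReal.toReal_pow,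
    ENNReal.toReal_ofReal hr, ENNReal.toReal_ofReal Real.pi_pos.le]

theorem volume_ball_lt_top (x : Plane) (r : ℝ) : volume (Metric.ball x r) < ∞ :=
  measure_ball_lt_top

theorem volume_inter_ball_lt_top (Ω : Set Plane) (x : Plane) (r : ℝ) :
    volume (Ω ∩ Metric.ball x r) < ∞ :=
  (measure_mono Set.inter_subset_right).trans_lt measure_ball_lt_top

section Polar

variable {Ω : Set Plane} {μ : Measure Plane} {σ : Plane → Plane} {y ν : Plane}

theorem IsGaussGreenPolar.measure_ball_lt_top (hpol : IsGaussGreenPolar Ω μ σ) (x : Plane) (r : ℝ) :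
    μ (Metric.ball x r) < ∞ := by
  have := hpol.1
  exact MeasureTheory.measure_ball_lt_top

theorem IsGaussGreenPolar.measureReal_ball_mono (hpol : IsGaussGreenPolar Ω μ σ) {s t : ℝ}
    (hst : s ≤ t) : μ.real (Metric.ball y s) ≤ μ.real (Metric.ball y t) :=
  measureReal_mono (Metric.ball_subset_ball hst) (hpol.measure_ball_lt_top y t).ne

theorem excess_nonneg (s : ℝ) : 0 ≤ excess μ σ y ν s :=
  integral_nonneg fun _ => norm_nonneg _

theorem IsGaussGreenPolar.excess_mono (hpol : IsGaussGreenPolar Ω μ σ) {s t : ℝ} (hst : s ≤ t) :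
    excess μ σ y ν s ≤ excess μ σ y ν t :=
  setIntegral_mono_set (hpol.integrableOn_norm_sub (hpol.measure_ball_lt_top y t) ν)
    (Eventually.of_forall fun _ => norm_nonneg _) (Metric.ball_subset_ball hst).eventuallyLE

theorem volume_real_inter_ball_mono {s t : ℝ} (hst : s ≤ t) :
    volume.real (Ω ∩ Metric.ball y s) ≤ volume.real (Ω ∩ Metric.ball y t) :=
  measureReal_mono (Set.inter_subset_inter_right _ (Metric.ball_subset_ball hst))
    (volume_inter_ball_lt_top _ _ _).ne

theorem norm_smul_unit_le (hν : ‖ν‖ = 1) {t ρ : ℝ} (ht : t ∈ Set.Icc (0 : ℝ) 1) (hρ : 0 ≤ ρ) :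
    ‖(t * ρ) • ν‖ ≤ ρ := by
  rw [norm_smul, hν, mul_one, Real.norm_of_nonneg (mul_nonneg ht.1 hρ)]
  exact mul_le_of_le_one_left hρ ht.2

/-- The perimeter in a ball is controlled by the volume in a larger ball. -/
theorem IsGaussGreenPolar.measureReal_ball_le (hpol : IsGaussGreenPolar Ω μ σ)
    (hΩ : MeasurableSet Ω) (hν : ‖ν‖ = 1) (s : ℝ) {ρ : ℝ} (hρ : 0 < ρ) :
    ρ * (μ.real (Metric.ball y s) - excess μ σ y ν (s + 3 * ρ)) ≤
      volume.real (Ω ∩ Metric.ball y (s + 3 * ρ)) := by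
  have h1 := (hpol.setIntegral_translate_normal hΩ (A := Metric.ball y (s + 3 / 2 * ρ))
    (U := Metric.ball y (s + 3 * ρ)) (V := Metric.ball y s) measurableSet_ball
    Metric.isBounded_ball measurableSet_ball (hpol.measure_ball_lt_top _ _) measurableSet_ball hν
    hρ.le (δ := ρ / 2) (by positivity) ?_ ?_).1
  · refine h1.trans ?_
    have h2 := setIntegral_chi_sub_chi hΩ (volume_ball_lt_top y (s + 3 / 2 * ρ)) (-(ρ • ν))
    simp_rw [← sub_eq_add_neg] at h2
    rw [h2]
    have h3 := measureReal_inter_preimage_le (A := Metric.ball y (s + 3 / 2 * ρ)) (B := Ω)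
      (-(ρ • ν)) (C := Ω ∩ Metric.ball y (s + 3 * ρ)) (volume_inter_ball_lt_top _ _ _) ?_
    · simp_rw [← sub_eq_add_neg] at h3
      have : 0 ≤ volume.real (Metric.ball y (s + 3 / 2 * ρ) ∩ Ω) := measureReal_nonneg
      linarith
    · intro x hx hxΩ
      refine ⟨hxΩ, ?_⟩
      rw [mem_ball_iff_norm] at hx ⊢
      have h4 : ‖x + -(ρ • ν) - y‖ ≤ ‖x - y‖ + ‖ρ • ν‖ := by
        rw [show x + -(ρ • ν) - y = (x - y) - ρ • ν by abel]; exact norm_sub_le _ _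
      rw [norm_smul, hν, Real.norm_of_nonneg hρ.le, mul_one] at h4
      linarith
  · intro x t ht z hz hzA
    rw [mem_ball_iff_norm] at hz hzA ⊢
    have h4 := norm_smul_unit_le hν ht hρ.le
    have h5 : ‖x - y‖ ≤ ‖z - y‖ + ‖z - (x + (t * ρ) • ν)‖ + ‖(t * ρ) • ν‖ := by
      rw [show x - y = (z - y) - (z - (x + (t * ρ) • ν)) - (t * ρ) • ν by abel]
      exact (norm_sub_le _ _).trans (by gcongr; exact norm_sub_le _ _)
    linarith
  · intro x hx t ht z hz
    rw [mem_ball_iff_norm] at hz hx ⊢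
    have h4 := norm_smul_unit_le hν ht hρ.le
    have h5 : ‖z - y‖ ≤ ‖z - (x + (t * ρ) • ν)‖ + ‖x - y‖ + ‖(t * ρ) • ν‖ := by
      rw [show z - y = (z - (x + (t * ρ) • ν)) + (x - y) + (t * ρ) • ν by abel]
      exact norm_add₃_le
    linarith

/-- Upper density bound for the perimeter measure. -/
theorem IsGaussGreenPolar.exists_measureReal_ball_le (hpol : IsGaussGreenPolar Ω μ σ)
    (hΩ : MeasurableSet Ω) (hν : ‖ν‖ = 1) {r : ℝ} (hr : 0 < r)
    (hE : ∀ s, 0 < s → s ≤ r → excess μ σ y ν s ≤ μ.real (Metric.ball y s) / 8) :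
    ∃ C : ℝ, 0 < C ∧ ∀ s, 0 < s → s ≤ r → μ.real (Metric.ball y s) ≤ C * s := by
  -- The second entry settles r/4 ≤ s ≤ r by monotonicity. The first makes the step from 4s to s
  -- close: μ(B_s) ≤ 16πs + μ(B_{4s})/8 ≤ 16πs + Cs/2 ≤ Cs.
  set C : ℝ := max (32 * Real.pi) (4 * μ.real (Metric.ball y r) / r) with hC
  have hC1 : 32 * Real.pi ≤ C := le_max_left _ _
  have hC2 : 4 * μ.real (Metric.ball y r) / r ≤ C := le_max_right _ _
  refine ⟨C, lt_of_lt_of_le (by positivity) hC1, ?_⟩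
  have key : ∀ n : ℕ, ∀ s, 0 < s → s ≤ r → r ≤ 4 ^ (n + 1) * s →
      μ.real (Metric.ball y s) ≤ C * s := by
    intro n
    induction n with
    | zero =>
      intro s hs hsr h4
      have h1 := hpol.measureReal_ball_mono (y := y) hsr
      rw [div_le_iff₀ hr] at hC2
      have hC0 : 0 ≤ C := le_trans (by positivity) hC1
      rw [zero_add, pow_one] at h4
      nlinarith
    | succ n ih =>
      intro s hs hsr h4
      by_cases hlt : 4 * s ≤ r
      · have h1 := ih (4 * s) (by linarith) hlt (by rw [pow_succ] at h4; linarith)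
        have h2 := hpol.measureReal_ball_le (y := y) hΩ hν s hs
        rw [show s + 3 * s = 4 * s by ring] at h2
        have h3 := hE (4 * s) (by linarith) hlt
        have h5 : volume.real (Ω ∩ Metric.ball y (4 * s)) ≤ (4 * s) ^ 2 * Real.pi := by
          rw [← volume_real_ball y (by linarith)]
          exact measureReal_mono Set.inter_subset_right (volume_ball_lt_top _ _).ne
        have h6 : s * (μ.real (Metric.ball y s) - excess μ σ y ν (4 * s)) ≤
            s * (16 * s * Real.pi) := by
          refine (h2.trans h5).trans (le_of_eq (by ring))
        have h7 := le_of_mul_le_mul_left h6 hs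
        nlinarith
      · have h1 := hpol.measureReal_ball_mono (y := y) hsr
        rw [div_le_iff₀ hr] at hC2
        have hC0 : 0 ≤ C := le_trans (by positivity) hC1
        nlinarith
  intro s hs hsr
  obtain ⟨n, hn⟩ := pow_unbounded_of_one_lt (r / s) (by norm_num : (1 : ℝ) < 4)
  refine key n s hs hsr ?_
  rw [div_lt_iff₀ hs] at hn
  rw [pow_succ]
  nlinarith [pow_pos (by norm_num : (0 : ℝ) < 4) n]

/-- The volume entering `Ω` under a translation in a direction `h` with `h ⋅ ν ≥ 0` is controlled
by the excess. -/
theorem IsGaussGreenPolar.volume_real_translate_le (hpol : IsGaussGreenPolar Ω μ σ)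
    (hΩ : MeasurableSet Ω) {h : Plane} (hh : 0 ≤ inner ℝ h ν) {r R : ℝ} (hR : r + ‖h‖ < R) :
    volume.real ((Metric.ball y r \ Ω) ∩ (fun x => x + h) ⁻¹' Ω) ≤ ‖h‖ * excess μ σ y ν R := by
  have hfin : volume (Metric.ball y r \ Ω) < ∞ :=
    (measure_mono Set.sdiff_subset).trans_lt (volume_ball_lt_top y r)
  have h1 := hpol.setIntegral_translate_le hΩ (A := Metric.ball y r \ Ω) (U := Metric.ball y R)
    (measurableSet_ball.diff hΩ) (Metric.isBounded_ball.subset Set.sdiff_subset) measurableSet_ball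
    (hpol.measure_ball_lt_top _ _) hh (δ := R - (r + ‖h‖)) (by linarith) ?_
  · rw [setIntegral_chi_sub_chi hΩ hfin] at h1
    simpa [excess] using h1
  · intro x t ht z hz hzA
    have hzA := hzA.1
    rw [mem_ball_iff_norm] at hz hzA ⊢
    have h4 : ‖t • h‖ ≤ ‖h‖ := by
      rw [norm_smul, Real.norm_of_nonneg ht.1]
      exact mul_le_of_le_one_left (norm_nonneg _) ht.2
    have h5 : ‖x - y‖ ≤ ‖z - y‖ + ‖z - (x - t • h)‖ + ‖t • h‖ := by
      rw [show x - y = (z - y) - (z - (x - t • h)) + t • h by abel]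
      exact (norm_add_le _ _).trans (by gcongr; exact norm_sub_le _ _)
    linarith

/-- The half-disc and its reflection through the origin cover the disc; the argument also allows ν =
0. -/
theorem volume_real_halfDisc (ν : Plane) {ρ : ℝ} (hρ : 0 ≤ ρ) :
    ρ ^ 2 * Real.pi ≤ 2 * volume.real {h ∈ Metric.ball (0 : Plane) ρ | 0 ≤ inner ℝ h ν} := by
  set D := {h ∈ Metric.ball (0 : Plane) ρ | 0 ≤ inner ℝ h ν} with hD
  have hDfin : volume D < ∞ := (measure_mono (Set.sep_subset _ _)).trans_lt (volume_ball_lt_top _ _)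
  have h1 : Metric.ball (0 : Plane) ρ ⊆ D ∪ (fun x => -x) ⁻¹' D := by
    intro x hx
    rcases le_total 0 (inner ℝ x ν) with h | h
    · exact Or.inl ⟨hx, h⟩
    · refine Or.inr ⟨by simpa using hx, by simpa [inner_neg_left] using h⟩
  have h2 : volume ((fun x => -x) ⁻¹' D) = volume D := by
    exact Measure.measure_preimage_neg volume D
  have h3 : volume.real ((fun x => -x) ⁻¹' D) = volume.real D := by simp only [measureReal_def, h2]
  rw [← volume_real_ball 0 hρ, two_mul]
  nth_rw 2 [← h3]
  refine (measureReal_mono h1 ?_).trans (measureReal_union_le _ _)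
  exact ((measure_union_le _ _).trans_lt (by rw [h2]; exact ENNReal.add_lt_top.2 ⟨hDfin, hDfin⟩)).ne

/-- Where the volume of `Ω` is small, it is controlled by the excess. -/
theorem IsGaussGreenPolar.volume_real_le_of_small (hpol : IsGaussGreenPolar Ω μ σ)
    (hΩ : MeasurableSet Ω) {s ρ : ℝ} (hρ : 0 < ρ)
    (hsmall : volume.real (Ω ∩ Metric.ball y (s + ρ)) ≤ ρ ^ 2 / 2) :
    volume.real (Ω ∩ Metric.ball y s) ≤ 2 * ρ * excess μ σ y ν (s + 3 * ρ) := by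
  set D := {h ∈ Metric.ball (0 : Plane) ρ | 0 ≤ inner ℝ h ν} with hD
  have hDm : MeasurableSet D := measurableSet_ball.inter (measurableSet_le
    (f := fun _ : Plane => (0 : ℝ)) (g := fun h : Plane => inner ℝ h ν) measurable_const
    (by fun_prop))
  have hDfin : volume D < ∞ := (measure_mono (Set.sep_subset _ _)).trans_lt (volume_ball_lt_top _ _)
  have hd := volume_real_halfDisc ν hρ.le
  rw [← hD] at hd
  have hd' : ρ ^ 2 ≤ volume.real D := by
    have := Real.pi_gt_three
    nlinarith [sq_nonneg ρ]
  set G := Ω ∩ Metric.ball y s with hG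
  have hGm : MeasurableSet G := hΩ.inter measurableSet_ball
  have hGfin : volume G < ∞ := volume_inter_ball_lt_top _ _ _
  -- Double counting. For fixed x ∈ G, at least half of the shifts h ∈ D lead out of Ω, because |D|
  -- ≥ ρ² while Ω has measure at most ρ²/2 nearby. For fixed h ∈ D, the points that enter Ω when
  -- shifted by h are few, by the excess bound, since h ⋅ ν ≥ 0.
  set W : Set (Plane × Plane) := {p | p.1 ∈ G ∧ p.2 ∈ D ∧ p.1 - p.2 ∉ Ω} with hW
  have hWm : MeasurableSet W := (measurable_fst hGm).inter
    ((measurable_snd hDm).inter ((measurable_fst.sub measurable_snd) hΩ.compl))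
  have hlow : volume G * ENNReal.ofReal (volume.real D / 2) ≤ (volume.prod volume) W := by
    rw [Measure.prod_apply hWm, mul_comm, ← setLIntegral_const]
    refine (setLIntegral_mono' hGm fun x hx => ?_).trans (setLIntegral_le_lintegral G _)
    have hpre : volume ((fun h => x - h) ⁻¹' (Ω ∩ Metric.ball y (s + ρ))) =
        volume (Ω ∩ Metric.ball y (s + ρ)) :=
      (Measure.measurePreserving_sub_left volume x).measure_preimage
        (hΩ.inter measurableSet_ball).nullMeasurableSet
    have hSfin : volume (Prod.mk x ⁻¹' W) < ∞ :=
      (measure_mono fun h hh => hh.2.1).trans_lt hDfin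
    have hcov : D ⊆ (Prod.mk x ⁻¹' W) ∪ (fun h => x - h) ⁻¹' (Ω ∩ Metric.ball y (s + ρ)) := by
      intro h hh
      by_cases hxh : x - h ∈ Ω
      · refine Or.inr ⟨hxh, ?_⟩
        have h1 := hx.2
        have h2 := hh.1
        rw [mem_ball_iff_norm] at h1 ⊢
        rw [mem_ball_zero_iff] at h2
        rw [show x - h - y = (x - y) - h by abel]
        exact (norm_sub_le _ _).trans_lt (by linarith)
      · exact Or.inl ⟨hx, hh, hxh⟩
    have h3 : volume.real D ≤ volume.real (Prod.mk x ⁻¹' W) +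
        volume.real (Ω ∩ Metric.ball y (s + ρ)) := by
      have h4 : volume.real (Ω ∩ Metric.ball y (s + ρ)) =
        volume.real ((fun h => x - h) ⁻¹' (Ω ∩ Metric.ball y (s + ρ))) := by
        simp only [measureReal_def, hpre]
      rw [h4]
      refine (measureReal_mono hcov ?_).trans (measureReal_union_le _ _)
      refine ((measure_union_le _ _).trans_lt ?_).ne
      rw [hpre]
      exact ENNReal.add_lt_top.2 ⟨hSfin, volume_inter_ball_lt_top _ _ _⟩
    rw [ENNReal.ofReal_le_iff_le_toReal hSfin.ne, ← measureReal_def]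
    linarith
  have hup : (volume.prod volume) W ≤
      volume D * ENNReal.ofReal (ρ * excess μ σ y ν (s + 3 * ρ)) := by
    rw [Measure.prod_apply_symm hWm, mul_comm, ← lintegral_indicator_const hDm]
    refine lintegral_mono fun h => ?_
    by_cases hh : h ∈ D
    · rw [Set.indicator_of_mem hh]
      have hhn : ‖h‖ < ρ := by simpa using hh.1
      have h1 := hpol.volume_real_translate_le (y := y) hΩ hh.2 (r := s + ρ) (R := s + 3 * ρ)
        (by linarith)
      have h2 : volume ((fun x => x + h) ⁻¹' ((fun x => (x, h)) ⁻¹' W)) =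
          volume ((fun x => (x, h)) ⁻¹' W) := measure_preimage_add_right volume h _
      rw [← h2]
      have h3 : (fun x => x + h) ⁻¹' ((fun x => (x, h)) ⁻¹' W) ⊆
          (Metric.ball y (s + ρ) \ Ω) ∩ (fun x => x + h) ⁻¹' Ω := by
        rintro x ⟨hx1, -, hx2⟩
        simp only [add_sub_cancel_right] at hx2
        refine ⟨⟨?_, hx2⟩, hx1.1⟩
        have h4 := hx1.2
        rw [mem_ball_iff_norm] at h4 ⊢
        rw [show x - y = (x + h - y) - h by abel]
        exact (norm_sub_le _ _).trans_lt (by linarith)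
      refine (measure_mono h3).trans ?_
      rw [← ofReal_measureReal (((measure_mono (Set.inter_subset_left.trans
        Set.sdiff_subset)).trans_lt (volume_ball_lt_top y (s + ρ))).ne)]
      exact ENNReal.ofReal_le_ofReal (h1.trans
        (mul_le_mul_of_nonneg_right hhn.le (excess_nonneg _)))
    · rw [Set.indicator_of_notMem hh, nonpos_iff_eq_zero]
      refine measure_mono_null (t := ∅) (fun x hx => hh hx.2.1) (by simp)
  have h1 := ENNReal.toReal_mono (ENNReal.mul_lt_top hDfin ENNReal.ofReal_lt_top).ne
    (hlow.trans hup)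
  rw [ENNReal.toReal_mul, ENNReal.toReal_mul, ENNReal.toReal_ofReal (by positivity),
    ENNReal.toReal_ofReal (mul_nonneg hρ.le (excess_nonneg _)), ← measureReal_def,
    ← measureReal_def] at h1
  have hdpos : 0 < volume.real D := lt_of_lt_of_le (by positivity) hd'
  have h2 : volume.real D * (volume.real G / 2) ≤
      volume.real D * (ρ * excess μ σ y ν (s + 3 * ρ)) := by linarith
  have := le_of_mul_le_mul_left h2 hdpos
  linarith

/-- Lower density bound for the volume of `Ω` at points where the normal hardly oscillates. -/
theorem IsGaussGreenPolar.volume_real_inter_ball_ge (hpol : IsGaussGreenPolar Ω μ σ)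
    (hΩ : MeasurableSet Ω) (hν : ‖ν‖ = 1) {r ε C : ℝ}
    (hε : 0 ≤ ε) (hε1 : 6 * ε ≤ 1) (hεC : 384 * ε * C ≤ 1)
    (hpos : ∀ s, 0 < s → 0 < μ (Metric.ball y s))
    (hE : ∀ s, 0 < s → s ≤ r → excess μ σ y ν s ≤ ε * μ.real (Metric.ball y s))
    (hM : ∀ s, 0 < s → s ≤ r → μ.real (Metric.ball y s) ≤ C * s)
    {s : ℝ} (hs : 0 < s) (hsr : s ≤ r) :
    s ^ 2 / 1152 ≤ volume.real (Ω ∩ Metric.ball y s) := by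
  by_contra! hlt
  -- The radii u_k decrease from s towards s/2 in steps of 6ρ_k, with ρ_k halved each time. The
  -- constant 1152 makes s²/1152 = ρ₀²/2, the smallness needed at k = 0. The iteration forces
  -- μ(B_{s/2}) = 0, which contradicts y being in the support of μ.
  set ρ : ℕ → ℝ := fun k => s / 24 * (1 / 2) ^ k with hρ
  set u : ℕ → ℝ := fun k => s / 2 + 12 * ρ k with hu
  have hρpos : ∀ k, 0 < ρ k := fun k => by positivity
  have hρle : ∀ k, ρ k ≤ s / 24 := fun k =>
    mul_le_of_le_one_right (by positivity) (pow_le_one₀ (by norm_num) (by norm_num))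
  have hρs : ∀ k, ρ (k + 1) = ρ k / 2 := fun k => by simp only [hρ, pow_succ]; ring
  have hus : ∀ k, u (k + 1) + 6 * ρ k = u k := fun k => by simp only [hu, hρs]; ring
  have hupos : ∀ k, s / 2 < u k := fun k => by simp only [hu]; linarith [hρpos k]
  have hule : ∀ k, u k ≤ s := fun k => by simp only [hu]; linarith [hρle k]
  have key : ∀ k, μ.real (Metric.ball y (u k)) ≤ (1 / 2) ^ k * μ.real (Metric.ball y s) ∧
      volume.real (Ω ∩ Metric.ball y (u k)) ≤ ρ k ^ 2 / 2 := by
    intro k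
    induction k with
    | zero =>
      have h0 : u 0 = s := by simp only [hu, hρ]; ring
      rw [h0]
      refine ⟨by simp, hlt.le.trans (le_of_eq ?_)⟩
      simp only [hρ]; ring
    | succ k ih =>
      have hEk : excess μ σ y ν (u k) ≤ ε * μ.real (Metric.ball y (u k)) :=
        hE _ (by linarith [hupos k]) ((hule k).trans hsr)
      have hV : ∀ a, a ≤ u k → volume.real (Ω ∩ Metric.ball y a) ≤ ρ k ^ 2 / 2 := fun a ha =>
        (volume_real_inter_ball_mono ha).trans ih.2
      have h1 := hpol.measureReal_ball_le (y := y) hΩ hν (u (k + 1)) (hρpos k)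
      have h2 := hpol.volume_real_le_of_small (y := y) (ν := ν) hΩ (s := u (k + 1) + 3 * ρ k)
        (hρpos k) (hV _ (by linarith [hus k, hρpos k]))
      have h3 := hpol.volume_real_le_of_small (y := y) (ν := ν) hΩ (s := u (k + 1))
        (hρpos k) (hV _ (by linarith [hus k, hρpos k]))
      rw [show u (k + 1) + 3 * ρ k + 3 * ρ k = u k by linarith [hus k]] at h2
      have h4 : excess μ σ y ν (u (k + 1) + 3 * ρ k) ≤ excess μ σ y ν (u k) :=
        hpol.excess_mono (by linarith [hus k, hρpos k])
      -- One excess comes from the perimeter–volume inequality and two from the bound on the volume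
      -- at radius u_{k+1} + 3ρ_k. With 6ε ≤ 1 the perimeter is then halved; 384εC ≤ 1 keeps the
      -- volume below ρ_{k+1}²/2.
      have h5 : μ.real (Metric.ball y (u (k + 1))) ≤ 3 * excess μ σ y ν (u k) := by
        have h6 : ρ k * (μ.real (Metric.ball y (u (k + 1)))) ≤
            ρ k * (3 * excess μ σ y ν (u k)) := by
          nlinarith [hρpos k]
        exact le_of_mul_le_mul_left h6 (hρpos k)
      have hM0 : 0 ≤ μ.real (Metric.ball y (u k)) := measureReal_nonneg
      refine ⟨?_, ?_⟩
      · rw [pow_succ]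
        nlinarith [ih.1]
      · have h7 : volume.real (Ω ∩ Metric.ball y (u (k + 1))) ≤
            2 * ρ k * (ε * ((1 / 2) ^ k * (C * s))) := by
          refine h3.trans ?_
          have h8 := hM s hs hsr
          have h9 : (0 : ℝ) ≤ (1 / 2) ^ k := by positivity
          have h10 : μ.real (Metric.ball y (u k)) ≤ (1 / 2) ^ k * (C * s) :=
            ih.1.trans (mul_le_mul_of_nonneg_left h8 h9)
          have := hρpos k
          gcongr
          exact h4.trans (hEk.trans (mul_le_mul_of_nonneg_left h10 hε))
        refine h7.trans ?_
        rw [hρs]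
        have h11 : (1 / 2 : ℝ) ^ k * s = 24 * ρ k := by simp only [hρ]; ring
        have h12 : 2 * ρ k * (ε * ((1 / 2) ^ k * (C * s))) =
            2 * ρ k * (24 * ε * C * ρ k) := by
          rw [show ε * ((1 / 2 : ℝ) ^ k * (C * s)) = ε * C * ((1 / 2) ^ k * s) by ring, h11]; ring
        rw [h12]
        nlinarith [sq_nonneg (ρ k)]
  have hlim : Tendsto (fun k : ℕ => (1 / 2 : ℝ) ^ k * μ.real (Metric.ball y s)) atTop (𝓝 0) := by
    simpa using (tendsto_pow_atTop_nhds_zero_of_lt_one (r := (1 / 2 : ℝ)) (by norm_num)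
      (by norm_num)).mul_const (μ.real (Metric.ball y s))
  have h0 : μ.real (Metric.ball y (s / 2)) ≤ 0 := ge_of_tendsto' hlim fun k =>
    (hpol.measureReal_ball_mono (hupos k).le).trans (key k).1
  have h1 : 0 < μ.real (Metric.ball y (s / 2)) :=
    ENNReal.toReal_pos (hpos _ (by positivity)).ne' (hpol.measure_ball_lt_top _ _).ne
  linarith

/-- If the complement of `Ω` has positive density at `y`, then `Ω` occupies a small part of the
half-disc on the positive side of `ν`. -/
theorem IsGaussGreenPolar.volume_real_halfDisc_le (hpol : IsGaussGreenPolar Ω μ σ)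
    (hΩ : MeasurableSet Ω) (hν : ‖ν‖ = 1) {r δ : ℝ} (hr : 0 < r) (hδ1 : δ ≤ 1) :
    volume.real (Ωᶜ ∩ Metric.ball y (δ * r)) *
      volume.real {x ∈ Ω ∩ Metric.ball y r | δ * r < inner ℝ (x - y) ν} ≤
      (2 * r) ^ 2 * Real.pi * (2 * r * excess μ σ y ν (4 * r)) := by
  set N := Ωᶜ ∩ Metric.ball y (δ * r) with hN
  set G := {x ∈ Ω ∩ Metric.ball y r | δ * r < inner ℝ (x - y) ν} with hG
  have hNm : MeasurableSet N := hΩ.compl.inter measurableSet_ball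
  have hGm : MeasurableSet G := (hΩ.inter measurableSet_ball).inter (measurableSet_lt
    (f := fun _ : Plane => δ * r) (g := fun x : Plane => inner ℝ (x - y) ν) measurable_const
    (by fun_prop))
  -- Every point of G lies higher in direction ν than every point of N, so each shift h from N to G
  -- has h ⋅ ν ≥ 0 and |h| < 2r, and carries little mass by the excess bound. Fubini in h bounds |N|
  -- |G|.
  set W : Set (Plane × Plane) := {p | p.1 ∈ N ∧ p.1 + p.2 ∈ G} with hW
  have hWm : MeasurableSet W := (measurable_fst hNm).inter
    ((measurable_fst.add measurable_snd) hGm)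
  have hlow : volume N * volume G = (volume.prod volume) W := by
    rw [Measure.prod_apply hWm, mul_comm, ← lintegral_indicator_const hNm]
    refine lintegral_congr fun x => ?_
    by_cases hx : x ∈ N
    · rw [Set.indicator_of_mem hx]
      have h2 : volume ((fun h => x + h) ⁻¹' G) = volume G := measure_preimage_add volume x G
      rw [← h2]
      congr 1 with h
      simp [hW, hx]
    · rw [Set.indicator_of_notMem hx]
      symm
      exact measure_mono_null (t := ∅) (fun h hh => hx hh.1) (by simp)
  have hup : (volume.prod volume) W ≤ volume (Metric.ball (0 : Plane) (2 * r)) *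
      ENNReal.ofReal (2 * r * excess μ σ y ν (4 * r)) := by
    rw [Measure.prod_apply_symm hWm, mul_comm,
      ← lintegral_indicator_const (measurableSet_ball (x := (0 : Plane)) (ε := 2 * r))]
    refine lintegral_mono fun h => ?_
    rcases ((fun x => (x, h)) ⁻¹' W).eq_empty_or_nonempty with he | ⟨x, hx⟩
    · rw [he, measure_empty]; exact zero_le
    have hxN := hx.1.2
    have hxG := hx.2.1.2
    simp only [mem_ball_iff_norm] at hxN hxG
    have hδr : δ * r ≤ r := mul_le_of_le_one_left hr.le hδ1
    have hhn : ‖h‖ < 2 * r := by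
      rw [show h = (x + h - y) - (x - y) by abel]
      exact (norm_sub_le _ _).trans_lt (by linarith)
    have hinner : 0 ≤ inner ℝ h ν := by
      have h1 : δ * r < inner ℝ (x + h - y) ν := hx.2.2
      have h2 := le_of_abs_le (abs_real_inner_le_norm (x - y) ν)
      rw [hν, mul_one] at h2
      have h3 : inner ℝ h ν = inner ℝ (x + h - y) ν - inner ℝ (x - y) ν := by
        rw [← inner_sub_left]; congr 1; abel
      linarith
    rw [Set.indicator_of_mem (by simpa using hhn)]
    have h1 := hpol.volume_real_translate_le (y := y) hΩ hinner (r := r) (R := 4 * r)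
      (by linarith)
    have h3 : (fun x => (x, h)) ⁻¹' W ⊆ (Metric.ball y r \ Ω) ∩ (fun x => x + h) ⁻¹' Ω := by
      rintro z ⟨hz1, hz2⟩
      exact ⟨⟨Metric.ball_subset_ball hδr hz1.2, hz1.1⟩, hz2.1.1⟩
    refine (measure_mono h3).trans ?_
    rw [← ofReal_measureReal (((measure_mono (Set.inter_subset_left.trans
      Set.sdiff_subset)).trans_lt (volume_ball_lt_top y r)).ne)]
    exact ENNReal.ofReal_le_ofReal (h1.trans
      (mul_le_mul_of_nonneg_right hhn.le (excess_nonneg _)))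
  have h1 := ENNReal.toReal_mono (ENNReal.mul_lt_top (volume_ball_lt_top 0 (2 * r))
    ENNReal.ofReal_lt_top).ne (hlow.le.trans hup)
  rw [ENNReal.toReal_mul, ENNReal.toReal_mul,
    ENNReal.toReal_ofReal (mul_nonneg (by positivity) (excess_nonneg _)), ← measureReal_def,
    ← measureReal_def, ← measureReal_def, volume_real_ball 0 (by positivity)] at h1
  exact h1

end Polar

/-! ### Coordinates and rectangles adapted to a normal direction -/

theorem rotate_zero (ν x : Plane) : rotate ν x 0 = ν 1 * x 0 - ν 0 * x 1 := by
  simp [rotate, e₁, e₂, perp, PiLp.inner_apply, Fin.sum_univ_two]; ring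

theorem rotate_one (ν x : Plane) : rotate ν x 1 = inner ℝ ν x := by
  simp [rotate, e₁, e₂]

theorem rotate_one_eq (ν x : Plane) : rotate ν x 1 = ν 0 * x 0 + ν 1 * x 1 := by
  simp [rotate, e₁, e₂, PiLp.inner_apply, Fin.sum_univ_two]; ring

theorem norm_sq_eq (x : Plane) : ‖x‖ ^ 2 = x 0 ^ 2 + x 1 ^ 2 := by
  simp [EuclideanSpace.norm_sq_eq, Fin.sum_univ_two]

theorem norm_rotate {ν : Plane} (hν : ‖ν‖ = 1) (x : Plane) : ‖rotate ν x‖ = ‖x‖ := by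
  have h1 : ν 0 ^ 2 + ν 1 ^ 2 = 1 := by rw [← norm_sq_eq, hν, one_pow]
  rw [← sq_eq_sq₀ (norm_nonneg _) (norm_nonneg _), norm_sq_eq, norm_sq_eq x, rotate_zero,
    rotate_one_eq]
  linear_combination (x 0 ^ 2 + x 1 ^ 2) * h1

/-- The rotation `R_ν` as a linear isometry. -/
def rotateEquiv (ν : Plane) (hν : ‖ν‖ = 1) : Plane ≃ₗᵢ[ℝ] Plane :=
  LinearIsometry.toLinearIsometryEquiv
    { toFun := rotate ν
      map_add' := fun x y => by
        ext i; fin_cases i <;> simp [rotate_zero, rotate_one_eq] <;> ring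
      map_smul' := fun c x => by
        ext i; fin_cases i <;> simp [rotate_zero, rotate_one_eq] <;> ring
      norm_map' := norm_rotate hν } rfl

theorem rotateEquiv_apply (ν : Plane) (hν : ‖ν‖ = 1) (x : Plane) :
    rotateEquiv ν hν x = rotate ν x := rfl

theorem volume_preserving_coord :
    MeasurePreserving (fun x : Plane => (x 0, x 1)) volume volume :=
  (volume_preserving_finTwoArrow ℝ).comp (PiLp.volume_preserving_ofLp (Fin 2))

theorem volume_coord_rect {I J : Set ℝ} (hI : MeasurableSet I) (hJ : MeasurableSet J) :
    volume {x : Plane | x 0 ∈ I ∧ x 1 ∈ J} = volume I * volume J := by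
  have h1 := volume_preserving_coord.measure_preimage (s := I ×ˢ J) (hI.prod hJ).nullMeasurableSet
  rw [Measure.volume_eq_prod, Measure.prod_prod] at h1
  exact h1

/-- The rectangle with sides `I` along `ν^⊥` and `J` along `ν`, in the frame with origin `y`. -/
def rect (y ν : Plane) (I J : Set ℝ) : Set Plane :=
  {x | rotate ν (x - y) 0 ∈ I ∧ rotate ν (x - y) 1 ∈ J}

theorem measurable_rotate_sub {ν : Plane} (hν : ‖ν‖ = 1) (y : Plane) :
    Measurable fun x => rotate ν (x - y) :=
  (rotateEquiv ν hν).continuous.measurable.comp (measurable_sub_const y)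

theorem measurableSet_rect {ν : Plane} (hν : ‖ν‖ = 1) (y : Plane) {I J : Set ℝ}
    (hI : MeasurableSet I) (hJ : MeasurableSet J) : MeasurableSet (rect y ν I J) := by
  have h := measurable_rotate_sub hν y
  have h0 : Measurable fun x => rotate ν (x - y) 0 :=
    (EuclideanSpace.proj (𝕜 := ℝ) (0 : Fin 2) : Plane →L[ℝ] ℝ).measurable.comp h
  have h1 : Measurable fun x => rotate ν (x - y) 1 :=
    (EuclideanSpace.proj (𝕜 := ℝ) (1 : Fin 2) : Plane →L[ℝ] ℝ).measurable.comp h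
  exact (h0 hI).inter (h1 hJ)

theorem volume_rect {ν : Plane} (hν : ‖ν‖ = 1) (y : Plane) {I J : Set ℝ}
    (hI : MeasurableSet I) (hJ : MeasurableSet J) :
    volume (rect y ν I J) = volume I * volume J := by
  rw [← volume_coord_rect hI hJ]
  have h1 : MeasurePreserving (fun x => rotate ν (x - y)) (volume : Measure Plane) volume :=
    (rotateEquiv ν hν).measurePreserving.comp (measurePreserving_sub_right volume y)
  have hm : MeasurableSet {x : Plane | x 0 ∈ I ∧ x 1 ∈ J} :=
    ((EuclideanSpace.proj (𝕜 := ℝ) (0 : Fin 2) : Plane →L[ℝ] ℝ).measurable hI).inter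
      ((EuclideanSpace.proj (𝕜 := ℝ) (1 : Fin 2) : Plane →L[ℝ] ℝ).measurable hJ)
  exact h1.measure_preimage hm.nullMeasurableSet

theorem rotate_sub (ν x x' : Plane) : rotate ν (x - x') = rotate ν x - rotate ν x' := by
  ext i; fin_cases i <;> simp [rotate_zero, rotate_one_eq] <;> ring

theorem rotate_add_smul_zero (ν x y : Plane) (c : ℝ) :
    rotate ν (x + c • ν - y) 0 = rotate ν (x - y) 0 := by
  simp [rotate_zero]; ring

theorem rotate_add_smul_one {ν : Plane} (hν : ‖ν‖ = 1) (x y : Plane) (c : ℝ) :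
    rotate ν (x + c • ν - y) 1 = rotate ν (x - y) 1 + c := by
  have h1 : ν 0 ^ 2 + ν 1 ^ 2 = 1 := by rw [← norm_sq_eq, hν, one_pow]
  simp [rotate_one_eq]; linear_combination c * h1

theorem abs_coord_le_norm (x : Plane) (i : Fin 2) : |x i| ≤ ‖x‖ := by
  simpa using PiLp.norm_apply_le x i

theorem norm_le_add_abs (x : Plane) : ‖x‖ ≤ |x 0| + |x 1| := by
  refine le_of_sq_le_sq ?_ (by positivity)
  rw [norm_sq_eq, add_sq, sq_abs, sq_abs]
  nlinarith [mul_nonneg (abs_nonneg (x 0)) (abs_nonneg (x 1))]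

theorem abs_rotate_sub_le {ν : Plane} (hν : ‖ν‖ = 1) (x x' y : Plane) (i : Fin 2) :
    |rotate ν (x - y) i - rotate ν (x' - y) i| ≤ ‖x - x'‖ := by
  have h1 : rotate ν (x - y) i - rotate ν (x' - y) i = rotate ν (x - x') i := by
    rw [show x - x' = (x - y) - (x' - y) by abel, rotate_sub ν (x - y)]; rfl
  rw [h1, ← norm_rotate hν (x - x')]
  exact abs_coord_le_norm _ i

theorem norm_sub_le_rotate {ν : Plane} (hν : ‖ν‖ = 1) (x y : Plane) :
    ‖x - y‖ ≤ |rotate ν (x - y) 0| + |rotate ν (x - y) 1| := by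
  rw [← norm_rotate hν (x - y)]; exact norm_le_add_abs _

theorem isBounded_rect {ν : Plane} (hν : ‖ν‖ = 1) (y : Plane) {I J : Set ℝ} {R : ℝ}
    (hI : ∀ a ∈ I, |a| ≤ R) (hJ : ∀ a ∈ J, |a| ≤ R) : Bornology.IsBounded (rect y ν I J) := by
  refine (Metric.isBounded_closedBall (x := y) (r := R + R)).subset fun x hx => ?_
  rw [mem_closedBall_iff_norm]
  exact (norm_sub_le_rotate hν x y).trans (add_le_add (hI _ hx.1) (hJ _ hx.2))

/-! ### Sharp perimeter bounds from translated rectangles -/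

section Polar

variable {Ω : Set Plane} {μ : Measure Plane} {σ : Plane → Plane} {y ν : Plane}

/-- Small sets that contain `y` have perimeter at most their diameter, up to the excess. -/
theorem IsGaussGreenPolar.measureReal_rect_le (hpol : IsGaussGreenPolar Ω μ σ)
    (hΩ : MeasurableSet Ω) (hν : ‖ν‖ = 1) {d τ a : ℝ} (hd : 0 < d) (hτ : 0 < τ) (hτd : τ ≤ d)
    (ha : -d ≤ a) (ha0 : a ≤ 0) :
    μ.real (rect y ν (Set.Icc a (a + d)) (Set.Icc (-d) d)) ≤
      d + 2 * τ + excess μ σ y ν (8 * d) := by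
  -- A contains the segments x + [0, d]ν from points x of the given rectangle, with margin τ.
  -- Translating A by -dν can gain at most the strip of width d + 2τ and height d just below it,
  -- whatever Ω is; division by d leaves the width.
  set A := rect y ν (Set.Ioo (a - τ) (a + d + τ)) (Set.Ioo (-d - τ) (2 * d + τ)) with hA
  have hAm : MeasurableSet A := measurableSet_rect hν y measurableSet_Ioo measurableSet_Ioo
  have hAb : Bornology.IsBounded A := isBounded_rect hν y (R := 3 * d)
    (fun b hb => abs_le.2 ⟨by linarith [hb.1], by linarith [hb.2]⟩)
    (fun b hb => abs_le.2 ⟨by linarith [hb.1], by linarith [hb.2]⟩)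
  have h1 := (hpol.setIntegral_translate_normal hΩ (A := A) (U := Metric.ball y (8 * d))
    (V := rect y ν (Set.Icc a (a + d)) (Set.Icc (-d) d)) hAm hAb measurableSet_ball
    (hpol.measure_ball_lt_top _ _) (measurableSet_rect hν y measurableSet_Icc measurableSet_Icc) hν
    hd.le (δ := τ) hτ ?_ ?_).1
  · have hSvol : volume (rect y ν (Set.Ioo (a - τ) (a + d + τ))
        (Set.Ioc (-2 * d - τ) (-d - τ))) = ENNReal.ofReal (d + 2 * τ) * ENNReal.ofReal d := by
      rw [volume_rect hν y measurableSet_Ioo measurableSet_Ioc, Real.volume_Ioo, Real.volume_Ioc]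
      congr 2 <;> ring
    have hSfin : volume (rect y ν (Set.Ioo (a - τ) (a + d + τ))
        (Set.Ioc (-2 * d - τ) (-d - τ))) < ∞ := by
      rw [hSvol]; exact ENNReal.mul_lt_top ENNReal.ofReal_lt_top ENNReal.ofReal_lt_top
    have hAfin : volume A < ∞ := hAb.measure_lt_top
    have hAΩ : volume (A ∩ Ω) < ∞ := (measure_mono Set.inter_subset_left).trans_lt hAfin
    have h2 := setIntegral_chi_sub_chi hΩ hAfin (-(d • ν))
    simp_rw [← sub_eq_add_neg] at h2
    rw [h2] at h1
    have h3 := measureReal_inter_preimage_le (A := A) (B := Ω) (-(d • ν))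
      (C := (A ∩ Ω) ∪ rect y ν (Set.Ioo (a - τ) (a + d + τ)) (Set.Ioc (-2 * d - τ) (-d - τ)))
      ((measure_union_le _ _).trans_lt (ENNReal.add_lt_top.2 ⟨hAΩ, hSfin⟩)) ?_
    · simp_rw [← sub_eq_add_neg] at h3
      have h4 := h3.trans (measureReal_union_le _ _)
      have h5 : volume.real (rect y ν (Set.Ioo (a - τ) (a + d + τ))
          (Set.Ioc (-2 * d - τ) (-d - τ))) = (d + 2 * τ) * d := by
        rw [measureReal_def, hSvol, ENNReal.toReal_mul, ENNReal.toReal_ofReal (by positivity),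
          ENNReal.toReal_ofReal hd.le]
      rw [h5] at h4
      have h6 : d * (μ.real (rect y ν (Set.Icc a (a + d)) (Set.Icc (-d) d)) -
          ∫ x in Metric.ball y (8 * d), ‖σ x - ν‖ ∂μ) ≤ d * (d + 2 * τ) := by linarith
      have h7 := le_of_mul_le_mul_left h6 hd
      rw [excess]
      linarith
    · intro x hx hxΩ
      rw [← neg_smul] at hxΩ ⊢
      have h0 := rotate_add_smul_zero ν x y (-d)
      have h1 := rotate_add_smul_one hν x y (-d)
      by_cases hb : -d - τ < rotate ν (x + -d • ν - y) 1
      · refine Or.inl ⟨⟨h0 ▸ hx.1, hb, ?_⟩, hxΩ⟩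
        have := hx.2.2
        linarith
      · refine Or.inr ⟨h0 ▸ hx.1, ?_, not_lt.1 hb⟩
        have := hx.2.1
        linarith
  · intro x t ht z hz hzA
    rw [mem_ball_iff_norm] at hz ⊢
    have h2 := norm_smul_unit_le hν ht hd.le
    have h3 := norm_sub_le_rotate hν z y
    have h4 : |rotate ν (z - y) 0| ≤ 2 * d :=
      abs_le.2 ⟨by linarith [hzA.1.1], by linarith [hzA.1.2]⟩
    have h5 : |rotate ν (z - y) 1| ≤ 3 * d :=
      abs_le.2 ⟨by linarith [hzA.2.1], by linarith [hzA.2.2]⟩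
    have h6 : ‖x - y‖ ≤ ‖z - y‖ + ‖z - (x + (t * d) • ν)‖ + ‖(t * d) • ν‖ := by
      rw [show x - y = (z - y) - (z - (x + (t * d) • ν)) - (t * d) • ν by abel]
      exact (norm_sub_le _ _).trans (by gcongr; exact norm_sub_le _ _)
    linarith
  · intro x hx t ht z hz
    rw [mem_ball_iff_norm] at hz
    have h0 := abs_rotate_sub_le hν z (x + (t * d) • ν) y 0
    have h1 := abs_rotate_sub_le hν z (x + (t * d) • ν) y 1
    rw [rotate_add_smul_zero] at h0
    rw [rotate_add_smul_one hν] at h1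
    have h2 := abs_lt.1 (h0.trans_lt hz)
    have h3 := abs_lt.1 (h1.trans_lt hz)
    have h4 : 0 ≤ t * d := mul_nonneg ht.1 hd.le
    have h5 : t * d ≤ d := mul_le_of_le_one_left hd.le ht.2
    have h6 := hx.1
    have h7 := hx.2
    rw [Set.mem_Icc] at h6 h7
    exact ⟨⟨by linarith, by linarith⟩, ⟨by linarith, by linarith⟩⟩

/-- If `Ω` is close to a half-plane in `B_r(y)`, its perimeter there is almost `2r`. -/
theorem IsGaussGreenPolar.measureReal_ball_ge (hpol : IsGaussGreenPolar Ω μ σ)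
    (hΩ : MeasurableSet Ω) (hν : ‖ν‖ = 1) {r κ δ : ℝ} (hr : 0 < r) (hκ : 0 < κ) (hκ1 : 2 * κ ≤ 1)
    (hδ : 0 < δ) (hδκ : 2 * δ ≤ κ) :
    2 * (1 - 2 * κ) * (κ - 2 * δ) * r ^ 2
      - volume.real {x ∈ Ω ∩ Metric.ball y r | δ * r < inner ℝ (x - y) ν}
      - volume.real {x ∈ Ωᶜ ∩ Metric.ball y r | δ * r < inner ℝ (x - y) (-ν)} ≤
      κ * r * μ.real (Metric.ball y r) := by
  -- A slab at heights between δr and (κ - δ)r, where Ω is nearly absent. Shifted down by κr it lies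
  -- at heights between -(κ - δ)r and -δr, where Ω is nearly full. The gain is thus almost |A|, and
  -- it is at most κr times the perimeter in B_r.
  set A := rect y ν (Set.Ioo (-((1 - 2 * κ) * r)) ((1 - 2 * κ) * r))
    (Set.Ioo (δ * r) ((κ - δ) * r)) with hA
  have hκr : 0 < κ * r := by positivity
  have hδr : 0 < δ * r := by positivity
  have h1κ : 0 ≤ (1 - 2 * κ) * r := mul_nonneg (by linarith) hr.le
  have hδκr : 2 * (δ * r) ≤ κ * r := by nlinarith
  have hAm : MeasurableSet A := measurableSet_rect hν y measurableSet_Ioo measurableSet_Ioo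
  have hAsub : ∀ x ∈ A, ‖x - y‖ < (1 - κ) * r := fun x hx => by
    refine (norm_sub_le_rotate hν x y).trans_lt ?_
    have h4 : |rotate ν (x - y) 0| < (1 - 2 * κ) * r := abs_lt.2 hx.1
    have h5 : |rotate ν (x - y) 1| ≤ κ * r :=
      abs_le.2 ⟨by linarith [hx.2.1], by nlinarith [hx.2.2]⟩
    nlinarith
  have hAb : Bornology.IsBounded A := (Metric.isBounded_ball (x := y) (r := (1 - κ) * r)).subset
    fun x hx => mem_ball_iff_norm.2 (hAsub x hx)
  have hAfin : volume A < ∞ := hAb.measure_lt_top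
  have h1 := (hpol.setIntegral_translate_normal hΩ (A := A) (U := Metric.ball y r)
    (V := ∅) hAm hAb measurableSet_ball (hpol.measure_ball_lt_top _ _) MeasurableSet.empty hν
    hκr.le (δ := κ * r) hκr ?_ (by simp)).2
  · refine le_trans ?_ h1
    have h2 := setIntegral_chi_sub_chi hΩ hAfin (-((κ * r) • ν))
    have hAvol : volume.real A = 2 * (1 - 2 * κ) * (κ - 2 * δ) * r ^ 2 := by
      rw [measureReal_def, volume_rect hν y measurableSet_Ioo measurableSet_Ioo, Real.volume_Ioo,
        Real.volume_Ioo, ENNReal.toReal_mul, ENNReal.toReal_ofReal (by linarith),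
        ENNReal.toReal_ofReal (by nlinarith)]
      ring
    have h3 : volume.real (A ∩ Ω) ≤
        volume.real {x ∈ Ω ∩ Metric.ball y r | δ * r < inner ℝ (x - y) ν} := by
      refine measureReal_mono (fun x hx => ⟨⟨hx.2, ?_⟩, ?_⟩)
        ((measure_mono (Set.sep_subset _ _)).trans_lt (volume_inter_ball_lt_top _ _ _)).ne
      · rw [mem_ball_iff_norm]
        exact (hAsub x hx.1).trans_le (by nlinarith)
      · rw [real_inner_comm, ← rotate_one]; exact hx.1.2.1
    have h4 := measureReal_inter_preimage_le (A := A) (B := Ωᶜ) (-((κ * r) • ν))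
      (C := {x ∈ Ωᶜ ∩ Metric.ball y r | δ * r < inner ℝ (x - y) (-ν)})
      ((measure_mono (Set.sep_subset _ _)).trans_lt (volume_inter_ball_lt_top _ _ _)) ?_
    · have h5 : volume.real A ≤ volume.real (A ∩ (fun x => x + -((κ * r) • ν)) ⁻¹' Ω) +
          volume.real (A ∩ (fun x => x + -((κ * r) • ν)) ⁻¹' Ωᶜ) := by
        refine (measureReal_mono (fun x hx => ?_) ?_).trans (measureReal_union_le _ _)
        · by_cases hxΩ : x + -((κ * r) • ν) ∈ Ω
          · exact Or.inl ⟨hx, hxΩ⟩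
          · exact Or.inr ⟨hx, hxΩ⟩
        · exact ((measure_mono (Set.union_subset Set.inter_subset_left
            Set.inter_subset_left)).trans_lt hAfin).ne
      have h6 : ∫ x in A, (chi Ω (x - (κ * r) • ν) - chi Ω x) =
          volume.real (A ∩ (fun x => x + -((κ * r) • ν)) ⁻¹' Ω) - volume.real (A ∩ Ω) := by
        rw [← h2]; simp only [sub_eq_add_neg]
      rw [h6]
      rw [hAvol] at h5
      linarith
    · intro x hx hxΩ
      have hx' : x + -((κ * r) • ν) = x + (-(κ * r)) • ν := by rw [neg_smul]
      rw [hx'] at hxΩ ⊢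
      refine ⟨⟨hxΩ, ?_⟩, ?_⟩
      · rw [mem_ball_iff_norm]
        have h6 := hAsub x hx
        have h7 : ‖x + (-(κ * r)) • ν - y‖ ≤ ‖x - y‖ + ‖(-(κ * r)) • ν‖ := by
          rw [show x + (-(κ * r)) • ν - y = (x - y) + (-(κ * r)) • ν by abel]
          exact norm_add_le _ _
        rw [norm_smul, hν, mul_one, norm_neg, Real.norm_of_nonneg hκr.le] at h7
        nlinarith
      · rw [real_inner_comm, inner_neg_left, ← rotate_one, rotate_add_smul_one hν]
        have := hx.2.2
        nlinarith
  · intro x t ht z hz hzA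
    rw [mem_ball_iff_norm] at hz ⊢
    have h2 := norm_sub_le_rotate hν (z + (-(t * (κ * r))) • ν) y
    rw [rotate_add_smul_zero, rotate_add_smul_one hν] at h2
    have h3 : 0 ≤ t * (κ * r) := mul_nonneg ht.1 hκr.le
    have h4 : t * (κ * r) ≤ κ * r := mul_le_of_le_one_left hκr.le ht.2
    have h5 : |rotate ν (z - y) 0| < (1 - 2 * κ) * r := abs_lt.2 hzA.1
    have h6 : |rotate ν (z - y) 1 + -(t * (κ * r))| ≤ κ * r :=
      abs_le.2 ⟨by linarith [hzA.2.1], by nlinarith [hzA.2.2]⟩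
    have h7 : ‖x - y‖ ≤ ‖z + (-(t * (κ * r))) • ν - y‖ + ‖z - (x + (t * (κ * r)) • ν)‖ := by
      rw [show x - y = (z + (-(t * (κ * r))) • ν - y) - (z - (x + (t * (κ * r)) • ν)) by
        rw [neg_smul]; abel]
      exact norm_sub_le _ _
    nlinarith

end Polar

/-! ### Densities at points of the reduced boundary -/

/-- `ν` is the limit of the averages of `σ` on balls around the point `y` of the support of `μ`. -/
def IsNormalAt (μ : Measure Plane) (σ : Plane → Plane) (y ν : Plane) : Prop :=
  (∀ r : ℝ, 0 < r → 0 < μ (Metric.ball y r)) ∧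
    Tendsto (fun r : ℝ => ⨍ x in Metric.ball y r, σ x ∂μ) (𝓝[>] 0) (𝓝 ν) ∧ ‖ν‖ = 1

section Polar

variable {Ω : Set Plane} {μ : Measure Plane} {σ : Plane → Plane} {y ν : Plane}

theorem IsGaussGreenPolar.integrableOn (hpol : IsGaussGreenPolar Ω μ σ) {U : Set Plane}
    (hUμ : μ U < ∞) : IntegrableOn σ U μ := by
  have : IsFiniteMeasure (μ.restrict U) := ⟨by simpa using hUμ⟩
  refine Integrable.of_bound (C := 1) hpol.2.1.aestronglyMeasurable ?_
  filter_upwards [ae_restrict_of_ae hpol.2.2.1] with x hx using hx.le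

theorem exists_forall_Ioc_of_eventually {p : ℝ → Prop} (h : ∀ᶠ s in 𝓝[>] (0 : ℝ), p s) :
    ∃ r > 0, ∀ s, 0 < s → s ≤ r → p s := by
  obtain ⟨u, hu, hsub⟩ := mem_nhdsGT_iff_exists_Ioc_subset.1 h
  exact ⟨u, hu, fun s hs hsr => hsub ⟨hs, hsr⟩⟩

/-- For unit vectors |σ - ν|² = 2(1 - ν⋅σ), and the average of ν⋅σ tends to 1. Young's inequality |σ
- ν| ≤ ε/2 + |σ - ν|²/(2ε) passes from the square to the first power, which explains the threshold 1
- ε²/2. -/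
theorem IsNormalAt.exists_excess_le (hpol : IsGaussGreenPolar Ω μ σ) (hn : IsNormalAt μ σ y ν)
    {ε : ℝ} (hε : 0 < ε) :
    ∃ r > 0, ∀ s, 0 < s → s ≤ r → excess μ σ y ν s ≤ ε * μ.real (Metric.ball y s) := by
  obtain ⟨hpos, htend, hν⟩ := hn
  have h1 : Tendsto (fun r : ℝ => inner ℝ ν (⨍ x in Metric.ball y r, σ x ∂μ)) (𝓝[>] 0) (𝓝 1) := by
    have := (tendsto_const_nhds (x := ν)).inner (𝕜 := ℝ) htend
    rwa [real_inner_self_eq_norm_sq, hν, one_pow] at this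
  obtain ⟨r, hr, h2⟩ := exists_forall_Ioc_of_eventually
    (h1.eventually (lt_mem_nhds (show 1 - ε ^ 2 / 2 < 1 by linarith [pow_pos hε 2])))
  refine ⟨r, hr, fun s hs hsr => ?_⟩
  have h3 := h2 s hs hsr
  set B := Metric.ball y s
  have hBfin : μ B < ∞ := hpol.measure_ball_lt_top y s
  have hBpos : 0 < μ.real B := ENNReal.toReal_pos (hpos s hs).ne' hBfin.ne
  rw [setAverage_eq, real_inner_smul_right, ← integral_inner (hpol.integrableOn hBfin),
    inv_mul_eq_div, lt_div_iff₀ hBpos] at h3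
  have hInt : IntegrableOn (fun x => inner ℝ ν (σ x)) B μ :=
    (hpol.integrableOn hBfin).const_inner ν
  have hc : ∀ c : ℝ, IntegrableOn (fun _ => c) B μ := fun c => integrableOn_const hBfin.ne
  have h4 : excess μ σ y ν s ≤ ∫ x in B, (ε / 2 + (1 - inner ℝ ν (σ x)) / ε) ∂μ := by
    refine integral_mono_ae (hpol.integrableOn_norm_sub hBfin ν)
      ((hc _).add (((hc 1).sub hInt).div_const ε)) ?_
    filter_upwards [ae_restrict_of_ae hpol.2.2.1] with x hx
    have h5 : ‖σ x - ν‖ ^ 2 = 2 * (1 - inner ℝ ν (σ x)) := by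
      rw [norm_sub_sq_real, hx, hν, real_inner_comm]; ring
    have h6 : 1 - inner ℝ ν (σ x) = ‖σ x - ν‖ ^ 2 / 2 := by linarith
    have h7 : ‖σ x - ν‖ ≤ ε / 2 + ‖σ x - ν‖ ^ 2 / 2 / ε := by
      rw [← sub_nonneg]
      have : ε / 2 + ‖σ x - ν‖ ^ 2 / 2 / ε - ‖σ x - ν‖ = (ε - ‖σ x - ν‖) ^ 2 / (2 * ε) := by
        field_simp; ring
      rw [this]; positivity
    simpa only [h6] using h7
  have h8 : ∫ x in B, (ε / 2 + (1 - inner ℝ ν (σ x)) / ε) ∂μ =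
      ε / 2 * μ.real B + (μ.real B - ∫ x in B, inner ℝ ν (σ x) ∂μ) / ε := by
    have h9 : IntegrableOn (fun x => (1 - inner ℝ ν (σ x)) / ε) B μ :=
      ((hc 1).sub hInt).div_const ε
    rw [integral_add (hc _) h9, integral_div, integral_div, integral_sub (hc 1) hInt]
    simp only [integral_const, measureReal_restrict_apply_univ, smul_eq_mul, mul_one]
    ring
  rw [h8] at h4
  refine h4.trans ?_
  have h9 : (μ.real B - ∫ x in B, inner ℝ ν (σ x) ∂μ) / ε ≤ ε / 2 * μ.real B := by
    rw [div_le_iff₀ hε]; nlinarith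
  linarith

theorem IsNormalAt.exists_measureReal_le (hpol : IsGaussGreenPolar Ω μ σ) (hΩ : MeasurableSet Ω)
    (hn : IsNormalAt μ σ y ν) :
    ∃ C > 0, ∃ r > 0, ∀ s, 0 < s → s ≤ r → μ.real (Metric.ball y s) ≤ C * s := by
  obtain ⟨r, hr, h⟩ := hn.exists_excess_le hpol (ε := 1 / 8) (by norm_num)
  obtain ⟨C, hC, h'⟩ := hpol.exists_measureReal_ball_le hΩ hn.2.2 hr
    (fun s hs hsr => (h s hs hsr).trans (le_of_eq (by ring)))
  exact ⟨C, hC, r, hr, h'⟩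

/-- The upper density bound turns smallness relative to μ(B_s) into smallness relative to s, the
scale at which volumes are compared. -/
theorem IsNormalAt.exists_excess_le_mul (hpol : IsGaussGreenPolar Ω μ σ) (hΩ : MeasurableSet Ω)
    (hn : IsNormalAt μ σ y ν) {ε : ℝ} (hε : 0 < ε) :
    ∃ r > 0, ∀ s, 0 < s → s ≤ r → excess μ σ y ν s ≤ ε * s := by
  obtain ⟨C, hC, r, hr, h⟩ := hn.exists_measureReal_le hpol hΩ
  obtain ⟨r', hr', h'⟩ := hn.exists_excess_le hpol (ε := ε / C) (by positivity)
  refine ⟨min r r', lt_min hr hr', fun s hs hsr => ?_⟩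
  refine (h' s hs (hsr.trans (min_le_right _ _))).trans ?_
  have := h s hs (hsr.trans (min_le_left _ _))
  calc ε / C * μ.real (Metric.ball y s) ≤ ε / C * (C * s) := by gcongr
    _ = ε * s := by field_simp

theorem IsNormalAt.exists_volume_real_ge (hpol : IsGaussGreenPolar Ω μ σ) (hΩ : MeasurableSet Ω)
    (hn : IsNormalAt μ σ y ν) :
    ∃ r > 0, ∀ s, 0 < s → s ≤ r → s ^ 2 / 1152 ≤ volume.real (Ω ∩ Metric.ball y s) := by
  obtain ⟨C, hC, r, hr, h⟩ := hn.exists_measureReal_le hpol hΩ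
  obtain ⟨r', hr', h'⟩ := hn.exists_excess_le hpol (ε := min (1 / 6) (1 / (384 * C)))
    (by positivity)
  refine ⟨min r r', lt_min hr hr', fun s hs hsr => ?_⟩
  refine hpol.volume_real_inter_ball_ge hΩ hn.2.2 (r := min r r')
    (ε := min (1 / 6) (1 / (384 * C))) (C := C) (by positivity) ?_ ?_ hn.1
    (fun s hs hsr => h' s hs (hsr.trans (min_le_right _ _)))
    (fun s hs hsr => h s hs (hsr.trans (min_le_left _ _))) hs hsr
  · linarith [min_le_left (1 / 6 : ℝ) (1 / (384 * C))]
  · have h1 := min_le_right (1 / 6 : ℝ) (1 / (384 * C))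
    rw [le_div_iff₀ (by positivity)] at h1
    linarith

theorem IsNormalAt.neg (hn : IsNormalAt μ σ y ν) : IsNormalAt μ (fun x => -σ x) y (-ν) := by
  refine ⟨hn.1, ?_, by rw [norm_neg]; exact hn.2.2⟩
  have := hn.2.1.neg
  simpa only [setAverage_eq, integral_neg, smul_neg] using this

/-- The complement has positive density at y, by the volume bound applied to -σ and -ν. Dividing the
product estimate for the two volumes by that density leaves only the excess. This replaces
convergence of blow-ups to a half-plane. -/
theorem IsNormalAt.exists_halfDisc_le (hpol : IsGaussGreenPolar Ω μ σ) (hΩ : MeasurableSet Ω)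
    (hn : IsNormalAt μ σ y ν) {κ : ℝ} (hκ : 0 < κ) (hκ1 : κ ≤ 1) :
    ∃ r > 0, ∀ s, 0 < s → s ≤ r →
      volume.real {x ∈ Ω ∩ Metric.ball y s | κ ^ 2 * s < inner ℝ (x - y) ν} ≤ κ ^ 2 * s ^ 2 / 2 := by
  obtain ⟨r, hr, h⟩ := hn.neg.exists_volume_real_ge (hpol.compl hΩ.nullMeasurableSet) hΩ.compl
  -- 294912 = 256 · 1152: the factor 1152 is the density constant of the complement, and 256 absorbs
  -- π ≤ 4, the radii 2s and 4s, and the final 1/2.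
  obtain ⟨r', hr', h'⟩ := hn.exists_excess_le_mul hpol hΩ (ε := κ ^ 6 / 294912) (by positivity)
  refine ⟨min r (r' / 4), by positivity, fun s hs hsr => ?_⟩
  have hsr1 : s ≤ r := hsr.trans (min_le_left _ _)
  have hsr2 : 4 * s ≤ r' := by linarith [hsr.trans (min_le_right _ _)]
  have hκ2 : κ ^ 2 ≤ 1 := pow_le_one₀ hκ.le hκ1
  have h1 := hpol.volume_real_halfDisc_le (y := y) hΩ hn.2.2 hs hκ2
  have h2 := h (κ ^ 2 * s) (by positivity) ((mul_le_of_le_one_left hs.le hκ2).trans hsr1)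
  have h3 := h' (4 * s) (by positivity) hsr2
  set g := volume.real {x ∈ Ω ∩ Metric.ball y s | κ ^ 2 * s < inner ℝ (x - y) ν}
  have hg : 0 ≤ g := measureReal_nonneg
  have h4 : (κ ^ 2 * s) ^ 2 / 1152 * g ≤
      (2 * s) ^ 2 * 4 * (2 * s * (κ ^ 6 / 294912 * (4 * s))) := by
    refine (mul_le_mul_of_nonneg_right h2 hg).trans (h1.trans ?_)
    have := Real.pi_le_four
    have h5 : 0 ≤ excess μ σ y ν (4 * s) := excess_nonneg _
    gcongr
  have h6 : (κ ^ 2 * s) ^ 2 / 1152 * g ≤ (κ ^ 2 * s) ^ 2 / 1152 * (κ ^ 2 * s ^ 2 / 2) :=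
    h4.trans (le_of_eq (by ring))
  exact le_of_mul_le_mul_left h6 (by positivity)

/-- Lower density of the perimeter measure at points of the reduced boundary. -/
theorem IsNormalAt.exists_measureReal_ball_ge (hpol : IsGaussGreenPolar Ω μ σ)
    (hΩ : MeasurableSet Ω) (hn : IsNormalAt μ σ y ν) {η : ℝ} (hη : 0 < η) :
    ∃ r > 0, ∀ s, 0 < s → s ≤ r → (2 - η) * s ≤ μ.real (Metric.ball y s) := by
  -- With δ = κ² the slab estimate divided by κs² gives 2(1 - 2κ)² - κ ≥ 2 - 9κ ≥ 2 - η.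
  set κ : ℝ := min (η / 9) (1 / 4) with hκdef
  have hκ : 0 < κ := by positivity
  have hκ4 : κ ≤ 1 / 4 := min_le_right _ _
  have hκη : 9 * κ ≤ η := by linarith [min_le_left (η / 9) (1 / 4 : ℝ)]
  obtain ⟨r, hr, h⟩ := hn.exists_halfDisc_le hpol hΩ hκ (by linarith)
  obtain ⟨r', hr', h'⟩ := hn.neg.exists_halfDisc_le (hpol.compl hΩ.nullMeasurableSet) hΩ.compl hκ
    (by linarith)
  refine ⟨min r r', lt_min hr hr', fun s hs hsr => ?_⟩
  have h1 := h s hs (hsr.trans (min_le_left _ _))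
  have h2 := h' s hs (hsr.trans (min_le_right _ _))
  have h3 := hpol.measureReal_ball_ge (y := y) hΩ hn.2.2 hs hκ (by linarith) (δ := κ ^ 2)
    (by positivity) (by nlinarith)
  have h4 : κ * s * ((2 - η) * s) ≤ κ * s * μ.real (Metric.ball y s) := by
    refine le_trans ?_ h3
    have h5 : κ * s * ((2 - η) * s) ≤
        2 * (1 - 2 * κ) * (κ - 2 * κ ^ 2) * s ^ 2 - κ ^ 2 * s ^ 2 := by
      have h6 : 0 ≤ κ * s ^ 2 := by positivity
      have h7 : 2 - η ≤ 2 * (1 - 2 * κ) ^ 2 - κ := by nlinarith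
      calc κ * s * ((2 - η) * s) = κ * s ^ 2 * (2 - η) := by ring
        _ ≤ κ * s ^ 2 * (2 * (1 - 2 * κ) ^ 2 - κ) := mul_le_mul_of_nonneg_left h7 h6
        _ = _ := by ring
    linarith
  exact le_of_mul_le_mul_left h4 (by positivity)

/-- Upper density of the perimeter measure, with respect to arbitrary small sets, at points of the
reduced boundary. -/
theorem IsNormalAt.exists_measure_le (hpol : IsGaussGreenPolar Ω μ σ)
    (hΩ : MeasurableSet Ω) (hn : IsNormalAt μ σ y ν) {η : ℝ} (hη : 0 < η) :
    ∃ r > 0, ∀ d, 0 < d → d ≤ r → ∀ S : Set Plane, y ∈ S → (∀ x ∈ S, ∀ x' ∈ S, dist x x' ≤ d) →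
      μ S ≤ ENNReal.ofReal ((1 + η) * d) := by
  have hν := hn.2.2
  obtain ⟨r, hr, h⟩ := hn.exists_excess_le_mul hpol hΩ (ε := η / 16) (by positivity)
  refine ⟨r / 8, by positivity, fun d hd hdr S hyS hS => ?_⟩
  have h1 := h (8 * d) (by positivity) (by linarith)
  -- Starting the rectangle at the leftmost abscissa of S gives it width d; centring it at y would
  -- give 2d and lose the sharp constant.
  set a := sInf ((fun x => rotate ν (x - y) 0) '' S) with ha
  have hdist : ∀ x ∈ S, ∀ x' ∈ S, ∀ i, |rotate ν (x - y) i - rotate ν (x' - y) i| ≤ d :=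
    fun x hx x' hx' i => (abs_rotate_sub_le hν x x' y i).trans
      (by rw [← dist_eq_norm]; exact hS x hx x' hx')
  have hy : ∀ i, rotate ν (y - y) i = 0 := fun i => by
    fin_cases i <;> simp [rotate_zero, rotate_one_eq]
  have hlow : ∀ x ∈ S, -d ≤ rotate ν (x - y) 0 := fun x hx => by
    have := (abs_le.1 (hdist x hx y hyS 0)).1
    rw [hy] at this; linarith
  have hbdd : BddBelow ((fun x => rotate ν (x - y) 0) '' S) :=
    ⟨-d, by rintro _ ⟨x, hx, rfl⟩; exact hlow x hx⟩
  have hne : ((fun x => rotate ν (x - y) 0) '' S).Nonempty := ⟨_, y, hyS, rfl⟩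
  have hale : ∀ x ∈ S, a ≤ rotate ν (x - y) 0 := fun x hx => csInf_le hbdd ⟨x, hx, rfl⟩
  have ha1 : -d ≤ a := le_csInf hne (by rintro _ ⟨x, hx, rfl⟩; exact hlow x hx)
  have ha0 : a ≤ 0 := by have := hale y hyS; rwa [hy] at this
  have hsub : S ⊆ rect y ν (Set.Icc a (a + d)) (Set.Icc (-d) d) := by
    intro x hx
    have h2 := abs_le.1 (hdist x hx y hyS 1)
    rw [hy, sub_zero] at h2
    refine ⟨⟨hale x hx, ?_⟩, h2⟩
    have h3 : rotate ν (x - y) 0 - d ≤ a := le_csInf hne (by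
      rintro _ ⟨x', hx', rfl⟩
      have := (abs_le.1 (hdist x hx x' hx' 0)).2
      simp only
      linarith)
    linarith
  have hτ : 0 < min (η / 4) 1 * d := by positivity
  have h2 := hpol.measureReal_rect_le (y := y) hΩ hν hd (τ := min (η / 4) 1 * d) hτ
    (mul_le_of_le_one_left hd.le (min_le_right _ _)) ha1 ha0
  have h3 : min (η / 4) 1 * d ≤ η / 4 * d := by gcongr; exact min_le_left _ _
  have hb : Bornology.IsBounded (rect y ν (Set.Icc a (a + d)) (Set.Icc (-d) d)) :=
    isBounded_rect hν y (R := d) (fun b hb => abs_le.2 ⟨by linarith [hb.1], by linarith [hb.2]⟩)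
      (fun b hb => abs_le.2 hb)
  have := hpol.1
  refine (measure_mono hsub).trans ?_
  rw [← ofReal_measureReal hb.measure_lt_top.ne]
  exact ENNReal.ofReal_le_ofReal (by linarith)

end Polar

/-! ### Existence of the Gauss–Green measure -/

/-- Vague compactness: bounded nonnegative densities converge along an ultrafilter to a measure. -/
theorem exists_measure_tendsto_hyperfilter {w : ℕ → Plane → ℝ} (hw : ∀ n x, 0 ≤ w n x)
    (hInt : ∀ n (f : C_c(Plane, ℝ)), Integrable fun x => f x * w n x)
    (hbd : ∀ f : C_c(Plane, ℝ), ∃ B, ∀ n, |∫ x, f x * w n x| ≤ B) :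
    ∃ μ : Measure Plane, IsLocallyFiniteMeasure μ ∧ ∀ f : C_c(Plane, ℝ),
      Tendsto (fun n => ∫ x, f x * w n x) (hyperfilter ℕ) (𝓝 (∫ x, f x ∂μ)) := by
  have hex : ∀ f : C_c(Plane, ℝ), ∃ a,
      Tendsto (fun n => ∫ x, f x * w n x) (hyperfilter ℕ) (𝓝 a) := fun f => by
    obtain ⟨B, hB⟩ := hbd f
    -- Along one fixed ultrafilter every bounded sequence converges, so no diagonal subsequence is
    -- needed and the limit is automatically linear in f.
    obtain ⟨a, -, ha⟩ := (isCompact_Icc (a := -B) (b := B)).ultrafilter_le_nhds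
      ((hyperfilter ℕ).map fun n => ∫ x, f x * w n x)
      (le_principal_iff.2 (mem_map.2 (Eventually.of_forall fun n : ℕ => abs_le.1 (hB n))))
    exact ⟨a, ha⟩
  choose L hL using hex
  let Λ : C_c(Plane, ℝ) →ₚ[ℝ] ℝ := PositiveLinearMap.mk₀
    { toFun := L
      map_add' := fun f g => tendsto_nhds_unique (hL (f + g)) (by
        refine ((hL f).add (hL g)).congr fun n => ?_
        rw [← integral_add (hInt n f) (hInt n g)]
        congr 1 with x
        simp [add_mul])
      map_smul' := fun c f => tendsto_nhds_unique (hL (c • f)) (by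
        refine ((hL f).const_mul c).congr fun n => ?_
        rw [← integral_const_mul]
        congr 1 with x
        simp [mul_assoc]) }
    fun f hf => ge_of_tendsto' (hL f) fun n => integral_nonneg fun x => mul_nonneg (hf x) (hw n x)
  refine ⟨RealRMK.rieszMeasure Λ, inferInstance, fun f => ?_⟩
  rw [RealRMK.integral_rieszMeasure]
  exact hL f

theorem tendsto_difference_quotient {ψ : Plane → ℝ} (hψ : ContDiff ℝ 1 ψ)
    (hc : HasCompactSupport ψ) (Ω : Set Plane) (e : Plane) :
    Tendsto (fun n : ℕ => ∫ x in Ω, ((n : ℝ) + 1) *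
      (ψ (x - (1 / ((n : ℝ) + 1)) • e) - ψ x)) atTop (𝓝 (-∫ x in Ω, fderiv ℝ ψ x e)) := by
  obtain ⟨C, hC⟩ := hψ.lipschitzWith_of_hasCompactSupport hc (by norm_num)
  obtain ⟨R, hR0, hR⟩ := exists_closedBall_of_hasCompactSupport hc
  rw [← integral_neg]
  have hpos : ∀ n : ℕ, (0 : ℝ) < (n : ℝ) + 1 := fun n => by positivity
  refine tendsto_integral_of_dominated_convergence
    ((Metric.closedBall (0 : Plane) (R + ‖e‖)).indicator fun _ => C * ‖e‖) (fun n => ?_) ?_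
    (fun n => Eventually.of_forall fun x => ?_) (Eventually.of_forall fun x => ?_)
  · exact (continuous_const.mul ((hψ.continuous.comp (by fun_prop)).sub
      hψ.continuous)).aestronglyMeasurable
  · rw [integrable_indicator_iff Metric.isClosed_closedBall.measurableSet]
    exact integrableOn_const (isCompact_closedBall _ _).measure_lt_top.ne
  · by_cases hx : x ∈ Metric.closedBall (0 : Plane) (R + ‖e‖)
    · rw [Set.indicator_of_mem hx, norm_mul, Real.norm_of_nonneg (hpos n).le]
      have h1 := hC.dist_le_mul (x - (1 / ((n : ℝ) + 1)) • e) x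
      have h2 : ‖(1 : ℝ) / ((n : ℝ) + 1)‖ = 1 / ((n : ℝ) + 1) :=
        Real.norm_of_nonneg (by positivity)
      rw [dist_eq_norm, dist_eq_norm, sub_sub_cancel_left, norm_neg, norm_smul, h2] at h1
      calc ((n : ℝ) + 1) * _ ≤ ((n : ℝ) + 1) * (C * (1 / ((n : ℝ) + 1) * ‖e‖)) := by gcongr
        _ = C * ‖e‖ := by field_simp
    · rw [Set.indicator_of_notMem hx]
      rw [mem_closedBall_zero_iff, not_le] at hx
      have hn1 : 1 / ((n : ℝ) + 1) ≤ 1 := by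
        rw [div_le_one (hpos n)]; linarith [n.cast_nonneg (α := ℝ)]
      rw [hR _ (norm_sub_unitInterval_smul (t := 1 / ((n : ℝ) + 1))
        (by rw [Set.uIoc_of_le zero_le_one]; exact ⟨by positivity, hn1⟩) x e hx),
        hR x (by linarith [norm_nonneg e])]
      simp
  · have h1 : HasDerivAt (fun t : ℝ => x - t • e) (-e) 0 := by
      simpa using ((hasDerivAt_id (0 : ℝ)).smul_const e).const_sub x
    have h2 := ((hψ.differentiable (by norm_num)) (x - (0 : ℝ) • e)).hasFDerivAt.comp_hasDerivAt
      (0 : ℝ) h1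
    rw [map_neg, zero_smul, sub_zero] at h2
    have h3 := h2.tendsto_slope_zero_right
    have h4 : Tendsto (fun n : ℕ => 1 / ((n : ℝ) + 1)) atTop (𝓝[>] 0) :=
      tendsto_nhdsWithin_iff.2 ⟨tendsto_one_div_add_atTop_nhds_zero_nat,
        Eventually.of_forall fun n => by simp only [Set.mem_Ioi]; positivity⟩
    refine (h3.comp h4).congr fun n => ?_
    simp

/-- The directional derivative of the characteristic function of a set of finite perimeter is a
difference of two Radon measures. -/
theorem exists_measures_fderiv {Ω : Set Plane} (hΩ : MeasurableSet Ω)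
    (hfin : volume Ω < ∞) (hP : perimeter Ω < ∞) (e : Plane) :
    ∃ μp μm : Measure Plane, IsLocallyFiniteMeasure μp ∧ IsLocallyFiniteMeasure μm ∧
      ∀ ψ : Plane → ℝ, ContDiff ℝ 1 ψ → HasCompactSupport ψ →
        ∫ x in Ω, fderiv ℝ ψ x e = ∫ x, ψ x ∂μp - ∫ x, ψ x ∂μm := by
  let s : ℕ → ℝ := fun n => 1 / ((n : ℝ) + 1)
  have hs : ∀ n, 0 < s n := fun n => by simp only [s]; positivity
  let d : ℕ → Plane → ℝ := fun n x => chi Ω (x + s n • e) - chi Ω x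
  have hdm : ∀ n, Measurable (d n) := fun n =>
    ((measurable_chi hΩ).comp (measurable_id.add_const _)).sub (measurable_chi hΩ)
  have hdi : ∀ n, Integrable (d n) := fun n => integrable_chi_sub_chi hΩ hfin _
  -- the functional with weight `c * d` restricted to a measurable set, for a sign `c`
  have main : ∀ (A : ℕ → Set Plane) (c : ℝ), |c| = 1 → (∀ n, MeasurableSet (A n)) →
      (∀ n x, 0 ≤ (A n).indicator (fun x => c * d n x) x) →
      ∃ μ : Measure Plane, IsLocallyFiniteMeasure μ ∧ ∀ f : C_c(Plane, ℝ),
        Tendsto (fun n => ∫ x, f x * ((s n)⁻¹ * (A n).indicator (fun x => c * d n x) x))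
          (hyperfilter ℕ) (𝓝 (∫ x, f x ∂μ)) := by
    intro A c hc hA h0
    refine exists_measure_tendsto_hyperfilter (fun n x => mul_nonneg (inv_nonneg.2 (hs n).le)
      (h0 n x)) (fun n f => ?_) (fun f => ?_)
    · obtain ⟨M, hM⟩ := f.continuous.bounded_above_of_compact_support f.hasCompactSupport
      exact ((((hdi n).const_mul c).indicator (hA n)).const_mul _).bdd_mul
        f.continuous.aestronglyMeasurable (Eventually.of_forall hM)
    · obtain ⟨M, hM⟩ := f.continuous.bounded_above_of_compact_support f.hasCompactSupport
      have hM0 : 0 ≤ M := (norm_nonneg _).trans (hM 0)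
      refine ⟨M * ‖e‖ * (perimeter Ω).toReal, fun n => ?_⟩
      -- The sign and the indicator are absorbed into the test function, which is then merely
      -- bounded and measurable; the L¹ bound by the perimeter covers this case.
      have h1 := abs_integral_mul_chi_sub_chi_le hΩ hfin hP (M := M)
        (g := (A n).indicator fun x => c * f x)
        ((f.continuous.measurable.const_mul c).indicator (hA n)) (fun x => by
          by_cases hx : x ∈ A n
          · rw [Set.indicator_of_mem hx, abs_mul, hc, one_mul]; exact hM x
          · rw [Set.indicator_of_notMem hx, abs_zero]; exact hM0) (s n • e)
      have h2 : ∫ x, f x * ((s n)⁻¹ * (A n).indicator (fun x => c * d n x) x) =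
          (s n)⁻¹ * ∫ x, (A n).indicator (fun x => c * f x) x *
            (chi Ω (x + s n • e) - chi Ω x) := by
        rw [← integral_const_mul]
        congr 1 with x
        by_cases hx : x ∈ A n
        · simp only [Set.indicator_of_mem hx, d]; ring
        · simp [Set.indicator_of_notMem hx]
      rw [h2, abs_mul, abs_of_pos (inv_pos.2 (hs n)), inv_mul_le_iff₀ (hs n)]
      refine h1.trans (le_of_eq ?_)
      rw [norm_smul, Real.norm_of_nonneg (hs n).le]; ring
  -- The positive parts of the quotients yield the subtracted measure `μm`, because integration by
  -- parts changes the sign.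
  obtain ⟨μm, hμm, hm⟩ := main (fun n => {x | 0 ≤ d n x}) 1 (by simp)
    (fun n => measurableSet_le measurable_const (hdm n)) (fun n x => by
      refine Set.indicator_nonneg (fun x hx => ?_) x
      simpa using hx)
  obtain ⟨μp, hμp, hp⟩ := main (fun n => {x | 0 ≤ d n x}ᶜ) (-1) (by simp)
    (fun n => (measurableSet_le measurable_const (hdm n)).compl) (fun n x => by
      refine Set.indicator_nonneg (fun x hx => ?_) x
      simp only [Set.mem_compl_iff, Set.mem_ofPred_eq, not_le] at hx
      linarith)
  refine ⟨μp, μm, hμp, hμm, fun ψ hψ hc => ?_⟩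
  let f : C_c(Plane, ℝ) := ⟨⟨ψ, hψ.continuous⟩, hc⟩
  have hfψ : ∀ x, f x = ψ x := fun x => rfl
  have h1 := (hm f).sub (hp f)
  have h2 := (tendsto_difference_quotient hψ hc Ω e).mono_left Nat.hyperfilter_le_atTop
  have h3 : ∀ n : ℕ, ∫ x in Ω, ((n : ℝ) + 1) * (ψ (x - (1 / ((n : ℝ) + 1)) • e) - ψ x) =
      (∫ x, f x * ((s n)⁻¹ * {x | 0 ≤ d n x}.indicator (fun x => 1 * d n x) x)) -
        ∫ x, f x * ((s n)⁻¹ * {x | 0 ≤ d n x}ᶜ.indicator (fun x => -1 * d n x) x) := by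
    intro n
    rw [integral_const_mul, integral_sub_translate hψ hc, ← integral_mul_chi_sub_chi hψ hc hΩ,
      ← integral_const_mul]
    have hi : ∀ (A : Set Plane) (c : ℝ), MeasurableSet A → Integrable fun x => f x * ((s n)⁻¹ *
        A.indicator (fun x => c * d n x) x) := fun A c hA => by
      obtain ⟨M, hM⟩ := f.continuous.bounded_above_of_compact_support f.hasCompactSupport
      exact ((((hdi n).const_mul c).indicator hA).const_mul _).bdd_mul
        f.continuous.aestronglyMeasurable (Eventually.of_forall hM)
    have hA : MeasurableSet {x | 0 ≤ d n x} := measurableSet_le measurable_const (hdm n)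
    rw [← integral_sub (hi _ _ hA) (hi _ _ hA.compl)]
    congr 1 with x
    rw [hfψ]
    have hsn : (s n)⁻¹ = (n : ℝ) + 1 := by simp [s]
    rw [hsn]
    by_cases hx : x ∈ {x | 0 ≤ d n x}
    · rw [Set.indicator_of_mem hx, Set.indicator_of_notMem (by simpa using hx)]
      simp only [d, s]; ring
    · rw [Set.indicator_of_notMem hx, Set.indicator_of_mem hx]
      simp only [d, s]; ring
  have h4 := tendsto_nhds_unique (h2.congr h3) h1
  simp only [hfψ] at h4
  linarith

section TestField

variable {T : Plane → Plane}

theorem IsTestField.contDiff_coord (hT : IsTestField T) (i : Fin 2) :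
    ContDiff ℝ 1 (fun x => T x i) :=
  (EuclideanSpace.proj (𝕜 := ℝ) i : Plane →L[ℝ] ℝ).contDiff.comp hT.1

theorem IsTestField.hasCompactSupport_coord (hT : IsTestField T) (i : Fin 2) :
    HasCompactSupport (fun x => T x i) := by
  refine hT.2.mono fun x hx => ?_
  contrapose! hx
  simp only [Function.mem_support, not_not] at hx ⊢
  simp [hx]

theorem IsTestField.fderiv_coord (hT : IsTestField T) (i : Fin 2) (x e : Plane) :
    fderiv ℝ (fun x => T x i) x e = (fderiv ℝ T x e) i := by
  have h1 := ((EuclideanSpace.proj (𝕜 := ℝ) i : Plane →L[ℝ] ℝ).hasFDerivAt.comp x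
    (hT.1.differentiable (by norm_num) x).hasFDerivAt).fderiv
  have h2 : (fun x => T x i) = (EuclideanSpace.proj (𝕜 := ℝ) i : Plane →L[ℝ] ℝ) ∘ T := rfl
  rw [h2, h1]; rfl

theorem IsTestField.setIntegral_divergence (hT : IsTestField T) (Ω : Set Plane) :
    ∫ x in Ω, divergence T x = (∫ x in Ω, fderiv ℝ (fun x => T x 0) x e₁) +
      ∫ x in Ω, fderiv ℝ (fun x => T x 1) x e₂ := by
  have hi : ∀ i e, Integrable (fun x => fderiv ℝ (fun x => T x i) x e) := fun i e => by
    refine (((hT.contDiff_coord i).continuous_fderiv (by norm_num)).clm_apply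
      continuous_const).integrable_of_hasCompactSupport ?_
    refine ((hT.hasCompactSupport_coord i).fderiv (𝕜 := ℝ)).mono fun x hx => ?_
    contrapose! hx
    simp only [Function.mem_support, not_not] at hx ⊢
    simp [hx]
  rw [← integral_add (hi 0 e₁).integrableOn (hi 1 e₂).integrableOn]
  simp_rw [hT.fderiv_coord]
  rfl

end TestField

theorem integrable_mul_rnDeriv {a m : Measure Plane} [IsLocallyFiniteMeasure m]
    (ham : a ≤ m) {f : Plane → ℝ} (hf : Continuous f) (hc : HasCompactSupport f) :
    Integrable (fun x => f x * (a.rnDeriv m x).toReal) m := by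
  refine (hf.integrable_of_hasCompactSupport hc).mul_bdd (c := 1)
    (Measure.measurable_rnDeriv a m).ennreal_toReal.aestronglyMeasurable ?_
  filter_upwards [Measure.rnDeriv_le_one_of_le ham] with x hx
  rw [Real.norm_of_nonneg ENNReal.toReal_nonneg]
  exact ENNReal.toReal_le_of_le_ofReal zero_le_one (by simpa using hx)

theorem integral_mul_rnDeriv {a m : Measure Plane} [IsLocallyFiniteMeasure m]
    [IsLocallyFiniteMeasure a] (ham : a ≤ m) (f : Plane → ℝ) :
    ∫ x, f x * (a.rnDeriv m x).toReal ∂m = ∫ x, f x ∂a := by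
  rw [← integral_rnDeriv_smul (Measure.absolutelyContinuous_of_le ham)]
  simp_rw [smul_eq_mul, mul_comm]

/-- The structure theorem: a set of finite perimeter has a Gauss–Green measure. -/
theorem exists_isGaussGreenPolar {Ω : Set Plane} (hΩ : MeasurableSet Ω)
    (hfin : volume Ω < ∞) (hP : perimeter Ω < ∞) :
    ∃ (μ : Measure Plane) (σ : Plane → Plane), IsGaussGreenPolar Ω μ σ := by
  obtain ⟨a, b, ha, hb, hab⟩ := exists_measures_fderiv hΩ hfin hP e₁
  obtain ⟨c, d, hc, hd, hcd⟩ := exists_measures_fderiv hΩ hfin hP e₂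
  -- A common dominating measure: all four measures have densities at most 1 with respect to m, so
  -- the vector measure has a bounded density G.
  set m : Measure Plane := (a + b) + (c + d) with hm
  have hml : IsLocallyFiniteMeasure m := by
    refine ⟨fun x => ?_⟩
    have : ∀ k : Measure Plane, IsLocallyFiniteMeasure k → k (Metric.ball x 1) < ∞ :=
      fun k _ => measure_ball_lt_top
    refine ⟨Metric.ball x 1, Metric.ball_mem_nhds x one_pos, ?_⟩
    simp only [hm, Measure.add_apply, ENNReal.add_lt_top]
    exact ⟨⟨this a ha, this b hb⟩, this c hc, this d hd⟩
  have hma : a ≤ m := Measure.le_add_right (Measure.le_add_right le_rfl)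
  have hmb : b ≤ m := Measure.le_add_right (Measure.le_add_left le_rfl)
  have hmc : c ≤ m := Measure.le_add_left (Measure.le_add_right le_rfl)
  have hmd : d ≤ m := Measure.le_add_left (Measure.le_add_left le_rfl)
  let D : Measure Plane → Plane → ℝ := fun k x => (k.rnDeriv m x).toReal
  have hDm : ∀ k, Measurable (D k) := fun k => (Measure.measurable_rnDeriv k m).ennreal_toReal
  let G : Plane → Plane := fun x => !₂[D a x - D b x, D c x - D d x]
  have hGm : Measurable G := by
    refine (PiLp.volume_preserving_toLp (Fin 2)).measurable.comp (measurable_pi_iff.2 fun i => ?_)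
    fin_cases i
    · exact (hDm a).sub (hDm b)
    · exact (hDm c).sub (hDm d)
  let w : Plane → ℝ≥0∞ := fun x => ENNReal.ofReal ‖G x‖
  have hwm : Measurable w := hGm.norm.ennreal_ofReal
  have hD1 : ∀ k ≤ m, ∀ᵐ x ∂m, |D k x| ≤ 1 := fun k hk => by
    filter_upwards [Measure.rnDeriv_le_one_of_le hk] with x hx
    rw [abs_of_nonneg ENNReal.toReal_nonneg]
    exact ENNReal.toReal_le_of_le_ofReal zero_le_one (by simpa using hx)
  have hw4 : w ≤ᵐ[m] fun _ => ENNReal.ofReal 4 := by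
    filter_upwards [hD1 a hma, hD1 b hmb, hD1 c hmc, hD1 d hmd] with x h1 h2 h3 h4
    refine ENNReal.ofReal_le_ofReal ((norm_le_add_abs _).trans ?_)
    have h5 : |D a x - D b x| ≤ |D a x| + |D b x| := abs_sub _ _
    have h6 : |D c x - D d x| ≤ |D c x| + |D d x| := abs_sub _ _
    simp only [G, Matrix.cons_val_zero, Matrix.cons_val_one]
    linarith
  -- Polar decomposition G = |G| (G/|G|). Where G = 0 the second factor is 0 by convention, but this
  -- set is null for |G| m.
  refine ⟨m.withDensity w, fun x => ‖G x‖⁻¹ • G x, ?_, ?_, ?_, fun T hT => ?_⟩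
  · refine ⟨fun x => ⟨Metric.ball x 1, Metric.ball_mem_nhds x one_pos, ?_⟩⟩
    rw [withDensity_apply _ measurableSet_ball]
    refine (lintegral_mono_ae (ae_restrict_of_ae hw4)).trans_lt ?_
    rw [setLIntegral_const]
    exact ENNReal.mul_lt_top ENNReal.ofReal_lt_top measure_ball_lt_top
  · exact hGm.norm.inv.smul hGm
  · rw [ae_withDensity_iff hwm]
    refine Eventually.of_forall fun x hx => ?_
    have : ‖G x‖ ≠ 0 := fun h => hx (by simp only [w, h, ENNReal.ofReal_zero])
    rw [norm_smul, norm_inv, norm_norm, inv_mul_cancel₀ this]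
  · rw [integral_withDensity_eq_integral_toReal_smul hwm
      (Eventually.of_forall fun x => ENNReal.ofReal_lt_top), hT.setIntegral_divergence,
      hab _ (hT.contDiff_coord 0) (hT.hasCompactSupport_coord 0),
      hcd _ (hT.contDiff_coord 1) (hT.hasCompactSupport_coord 1),
      ← integral_mul_rnDeriv hma, ← integral_mul_rnDeriv hmb, ← integral_mul_rnDeriv hmc,
      ← integral_mul_rnDeriv hmd]
    have hI : ∀ k ≤ m, ∀ i, Integrable (fun x => T x i * D k x) m := fun k hk i =>
      integrable_mul_rnDeriv hk (hT.contDiff_coord i).continuous (hT.hasCompactSupport_coord i)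
    have hA : Integrable (fun x => T x 0 * D a x - T x 0 * D b x) m :=
      (hI a hma 0).sub (hI b hmb 0)
    have hC : Integrable (fun x => T x 1 * D c x - T x 1 * D d x) m :=
      (hI c hmc 1).sub (hI d hmd 1)
    rw [← integral_sub (hI a hma 0) (hI b hmb 0), ← integral_sub (hI c hmc 1) (hI d hmd 1),
      ← integral_add hA hC]
    congr 1 with x
    have h1 : (w x).toReal * inner ℝ (T x) (‖G x‖⁻¹ • G x) = inner ℝ (T x) (G x) := by
      rw [ENNReal.toReal_ofReal (norm_nonneg _), real_inner_smul_right, ← mul_assoc]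
      by_cases h0 : G x = 0
      · simp [h0]
      · rw [mul_inv_cancel₀ (norm_ne_zero_iff.2 h0), one_mul]
    rw [smul_eq_mul, h1]
    simp [PiLp.inner_apply, Fin.sum_univ_two, G]
    ring

/-! ### Uniqueness of the Gauss–Green measure and its total mass -/

section Uniqueness

variable {Ω : Set Plane} {μ μ' : Measure Plane} {σ σ' : Plane → Plane}

theorem IsGaussGreenPolar.integral_smul_eq (hpol : IsGaussGreenPolar Ω μ σ)
    (hpol' : IsGaussGreenPolar Ω μ' σ') {ψ : Plane → ℝ} (hψ : ContDiff ℝ 1 ψ)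
    (hc : HasCompactSupport ψ) : ∫ x, ψ x • σ x ∂μ = ∫ x, ψ x • σ' x ∂μ' := by
  have key : ∀ {μ : Measure Plane} {σ : Plane → Plane}, IsGaussGreenPolar Ω μ σ → ∀ h : Plane,
      inner ℝ h (∫ x, ψ x • σ x ∂μ) = ∫ x in Ω, fderiv ℝ ψ x h := by
    intro μ σ hpol h
    have := hpol.1
    have hInt : Integrable (fun x => ψ x • σ x) μ := by
      refine (hψ.continuous.integrable_of_hasCompactSupport hc).norm.mono'
        (hψ.continuous.aestronglyMeasurable.smul hpol.2.1.aestronglyMeasurable) ?_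
      filter_upwards [hpol.2.2.1] with x hx
      rw [norm_smul, hx, mul_one]
    rw [← integral_inner hInt, hpol.setIntegral_fderiv hψ hc]
    simp_rw [real_inner_smul_right]
  refine ext_inner_left ℝ fun h => ?_
  rw [key hpol, key hpol']

/-- Relative to m = μ + μ' both vector measures have locally integrable densities with the same
integrals against test functions, hence equal almost everywhere. Taking norms identifies the
densities of μ and μ', and dividing by them identifies the normals. -/
theorem IsGaussGreenPolar.unique (hpol : IsGaussGreenPolar Ω μ σ)
    (hpol' : IsGaussGreenPolar Ω μ' σ') : μ = μ' ∧ σ =ᵐ[μ] σ' := by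
  have h1 := hpol.1
  have h2 := hpol'.1
  set m := μ + μ' with hm
  have hml : IsLocallyFiniteMeasure m := by
    refine ⟨fun x => ⟨Metric.ball x 1, Metric.ball_mem_nhds x one_pos, ?_⟩⟩
    simp only [hm, Measure.add_apply, ENNReal.add_lt_top]
    exact ⟨hpol.measure_ball_lt_top x 1, hpol'.measure_ball_lt_top x 1⟩
  have hle : μ ≤ m := Measure.le_add_right le_rfl
  have hle' : μ' ≤ m := Measure.le_add_left le_rfl
  have hwd : m.withDensity (μ.rnDeriv m) = μ :=
    Measure.withDensity_rnDeriv_eq _ _ (Measure.absolutelyContinuous_of_le hle)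
  have hwd' : m.withDensity (μ'.rnDeriv m) = μ' :=
    Measure.withDensity_rnDeriv_eq _ _ (Measure.absolutelyContinuous_of_le hle')
  have hn : ∀ᵐ x ∂m, μ.rnDeriv m x ≠ 0 → ‖σ x‖ = 1 := by
    rw [← ae_withDensity_iff (Measure.measurable_rnDeriv _ _), hwd]; exact hpol.2.2.1
  have hn' : ∀ᵐ x ∂m, μ'.rnDeriv m x ≠ 0 → ‖σ' x‖ = 1 := by
    rw [← ae_withDensity_iff (Measure.measurable_rnDeriv _ _), hwd']; exact hpol'.2.2.1
  set f : Plane → Plane := fun x => (μ.rnDeriv m x).toReal • σ x with hf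
  set f' : Plane → Plane := fun x => (μ'.rnDeriv m x).toReal • σ' x with hf'
  have hfn : ∀ᵐ x ∂m, ‖f x‖ = (μ.rnDeriv m x).toReal := by
    filter_upwards [hn] with x hx
    by_cases h0 : μ.rnDeriv m x = 0
    · simp [hf, h0]
    · rw [hf, norm_smul, hx h0, mul_one, Real.norm_of_nonneg ENNReal.toReal_nonneg]
  have hfn' : ∀ᵐ x ∂m, ‖f' x‖ = (μ'.rnDeriv m x).toReal := by
    filter_upwards [hn'] with x hx
    by_cases h0 : μ'.rnDeriv m x = 0
    · simp [hf', h0]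
    · rw [hf', norm_smul, hx h0, mul_one, Real.norm_of_nonneg ENNReal.toReal_nonneg]
  have hlf : LocallyIntegrable f m := by
    refine (locallyIntegrable_const (1 : ℝ)).mono
      ((Measure.measurable_rnDeriv _ _).ennreal_toReal.smul hpol.2.1).aestronglyMeasurable ?_
    filter_upwards [hfn, Measure.rnDeriv_le_one_of_le hle] with x hx hx1
    rw [hx, norm_one]
    exact ENNReal.toReal_le_of_le_ofReal zero_le_one (by simpa using hx1)
  have hlf' : LocallyIntegrable f' m := by
    refine (locallyIntegrable_const (1 : ℝ)).mono
      ((Measure.measurable_rnDeriv _ _).ennreal_toReal.smul hpol'.2.1).aestronglyMeasurable ?_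
    filter_upwards [hfn', Measure.rnDeriv_le_one_of_le hle'] with x hx hx1
    rw [hx, norm_one]
    exact ENNReal.toReal_le_of_le_ofReal zero_le_one (by simpa using hx1)
  have hff : ∀ᵐ x ∂m, f x = f' x := by
    refine ae_eq_of_integral_contDiff_smul_eq hlf hlf' fun g hg hgc => ?_
    have h3 := hpol.integral_smul_eq hpol' (hg.of_le (by exact_mod_cast le_top)) hgc
    rw [← integral_rnDeriv_smul (Measure.absolutelyContinuous_of_le hle),
      ← integral_rnDeriv_smul (Measure.absolutelyContinuous_of_le hle')] at h3
    simp_rw [hf, hf', smul_comm (g _)]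
    exact h3
  have hrn : μ.rnDeriv m =ᵐ[m] μ'.rnDeriv m := by
    filter_upwards [hff, hfn, hfn', Measure.rnDeriv_lt_top μ m, Measure.rnDeriv_lt_top μ' m] with
      x h3 h4 h5 h6 h7
    rw [← ENNReal.toReal_eq_toReal_iff' h6.ne h7.ne, ← h4, ← h5, h3]
  have hμ : μ = μ' := by rw [← hwd, ← hwd', withDensity_congr_ae hrn]
  refine ⟨hμ, ?_⟩
  have h8 : ∀ᵐ x ∂m, μ.rnDeriv m x ≠ 0 → σ x = σ' x := by
    filter_upwards [hff, hrn, Measure.rnDeriv_lt_top μ m] with x h3 h4 h5 h6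
    simp only [hf, hf', ← h4] at h3
    exact smul_right_injective _ (ENNReal.toReal_pos h6 h5.ne).ne' h3
  rw [← ae_withDensity_iff (Measure.measurable_rnDeriv _ _), hwd] at h8
  exact h8

/-- A smooth substitute for the projection onto the unit ball. Composed with an L¹ approximation of
σ it produces admissible fields; being the identity only up to norm 1 - δ, it requires σ to be
shrunk first. -/
theorem exists_smooth_truncation {δ : ℝ} (hδ : 0 < δ) (hδ1 : δ < 1) :
    ∃ θ : Plane → Plane, θ 0 = 0 ∧ ContDiff ℝ 1 θ ∧ HasCompactSupport θ ∧ (∀ v, ‖θ v‖ ≤ 1) ∧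
      ∀ v, ‖v‖ ≤ 1 - δ → θ v = v := by
  let η : ContDiffBump (0 : Plane) := ⟨1 - δ, 1, by linarith, by linarith⟩
  refine ⟨fun v => η v • v, smul_zero _, η.contDiff.smul contDiff_id,
    η.hasCompactSupport.smul_right, fun v => ?_, fun v hv => ?_⟩
  · by_cases hv : ‖v‖ ≤ 1
    · rw [norm_smul, Real.norm_of_nonneg η.nonneg]
      exact mul_le_one₀ η.le_one (norm_nonneg _) hv
    · have : η v = 0 := η.zero_of_le_dist (by rw [dist_zero_right]; exact (not_le.1 hv).le)
      simp [this]
  · have : η v = 1 := η.one_of_mem_closedBall (by simpa [η] using hv)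
    simp [this]

/-- The total mass of the Gauss–Green measure is the perimeter. -/
theorem IsGaussGreenPolar.perimeter_eq (hpol : IsGaussGreenPolar Ω μ σ) (hP : perimeter Ω < ∞) :
    perimeter Ω = μ Set.univ := by
  have := hpol.1
  refine le_antisymm (iSup₂_le fun T hT => ?_) ?_
  · rw [hpol.2.2.2 T hT.1]
    refine (Real.ofReal_le_enorm _).trans ((enorm_integral_le_lintegral_enorm _).trans ?_)
    rw [← lintegral_one]
    refine lintegral_mono_ae ?_
    filter_upwards [hpol.2.2.1] with x hx
    rw [← ofReal_norm, ← ENNReal.ofReal_one]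
    refine ENNReal.ofReal_le_ofReal ((norm_inner_le_norm _ _).trans ?_)
    rw [hx, mul_one]; exact hT.2 x
  have hball : ∀ n : ℕ, μ (Metric.ball (0 : Plane) n) ≤ perimeter Ω := by
    intro n
    set B := Metric.ball (0 : Plane) (n : ℝ) with hB
    have hBfin : μ B < ∞ := hpol.measure_ball_lt_top _ _
    rw [← ENNReal.toReal_le_toReal hBfin.ne hP.ne, ← measureReal_def]
    have key : ∀ δ : ℝ, 0 < δ → δ < 1 / 2 →
        (1 - δ) * μ.real B ≤ (perimeter Ω).toReal := by
      intro δ hδ hδ1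
      obtain ⟨θ, hθ0, hθc, hθs, hθ1, hθeq⟩ := exists_smooth_truncation hδ (by linarith)
      obtain ⟨L, hL⟩ := hθc.lipschitzWith_of_hasCompactSupport hθs (by norm_num)
      set f : Plane → Plane := B.indicator fun x => (1 - δ) • σ x with hf
      have hfi : Integrable f μ := by
        rw [hf, integrable_indicator_iff measurableSet_ball]
        exact (hpol.integrableOn hBfin).smul (1 - δ)
      have hfn : ∀ᵐ x ∂μ, ‖f x‖ ≤ 1 - δ := by
        filter_upwards [hpol.2.2.1] with x hx
        by_cases hxB : x ∈ B
        · rw [hf, Set.indicator_of_mem hxB, norm_smul, hx, mul_one,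
            Real.norm_of_nonneg (by linarith)]
        · rw [hf, Set.indicator_of_notMem hxB, norm_zero]; linarith
      have hsmall : ∀ ε : ℝ, 0 < ε → (1 - δ) * μ.real B ≤ (perimeter Ω).toReal + L * ε := by
        intro ε hε
        -- A smooth g is L¹(μ)-close to f = (1 - δ)σ on B. Since θ(f) = f almost everywhere and θ is
        -- L-Lipschitz, θ(g) is an admissible field that differs from f by at most Lε in L¹(μ).
        obtain ⟨g, hg1, hg2, hg3⟩ := (memLp_one_iff_integrable.2 hfi).exist_eLpNorm_sub_le
          ENNReal.one_ne_top le_rfl hε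
        have hgi : Integrable g μ := hg2.continuous.integrable_of_hasCompactSupport hg1
        have hTf : IsTestField (fun x => θ (g x)) :=
          ⟨hθc.comp (hg2.of_le (by exact_mod_cast le_top)), hg1.comp_left hθ0⟩
        have hle := setIntegral_divergence_le hP hTf (fun x => hθ1 _)
        rw [hpol.2.2.2 _ hTf] at hle
        have hfg : Integrable (fun x => f x - g x) μ := hfi.sub hgi
        have hdiff : ∫ x, ‖f x - g x‖ ∂μ ≤ ε := by
          rw [eLpNorm_one_eq_lintegral_enorm] at hg3
          rw [integral_norm_eq_lintegral_enorm hfg.aestronglyMeasurable]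
          exact ENNReal.toReal_le_of_le_ofReal hε.le hg3
        have hTi : Integrable (fun x => inner ℝ (θ (g x)) (σ x)) μ := by
          have hTI : Integrable (fun x => θ (g x)) μ :=
            hTf.1.continuous.integrable_of_hasCompactSupport hTf.2
          refine hTI.norm.mono' (hTf.1.continuous.measurable.inner
            hpol.2.1).aestronglyMeasurable ?_
          filter_upwards [hpol.2.2.1] with x hx
          exact (norm_inner_le_norm _ _).trans (by rw [hx, mul_one])
        have hi3 : Integrable (B.indicator fun _ => 1 - δ) μ := by
          rw [integrable_indicator_iff measurableSet_ball]; exact integrableOn_const hBfin.ne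
        have hcmp : ∫ x, B.indicator (fun _ => 1 - δ) x ∂μ ≤
            ∫ x, (inner ℝ (θ (g x)) (σ x) + L * ‖f x - g x‖) ∂μ := by
          refine integral_mono_ae hi3 (hTi.add (hfg.norm.const_mul _)) ?_
          filter_upwards [hpol.2.2.1, hfn] with x hx hx1
          have h1 : B.indicator (fun _ => 1 - δ) x = inner ℝ (f x) (σ x) := by
            by_cases hxB : x ∈ B
            · rw [hf, Set.indicator_of_mem hxB, Set.indicator_of_mem hxB, real_inner_smul_left,
                real_inner_self_eq_norm_sq, hx]; ring
            · rw [hf, Set.indicator_of_notMem hxB, Set.indicator_of_notMem hxB, inner_zero_left]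
          have h2 : inner ℝ (f x) (σ x) = inner ℝ (θ (g x)) (σ x) +
              inner ℝ (f x - θ (g x)) (σ x) := by rw [inner_sub_left]; ring
          have h3 := le_of_abs_le (abs_real_inner_le_norm (f x - θ (g x)) (σ x))
          have h4 := hL.dist_le_mul (f x) (g x)
          rw [hθeq _ hx1, dist_eq_norm, dist_eq_norm] at h4
          rw [hx, mul_one] at h3
          rw [h1, h2]
          linarith
        rw [integral_indicator measurableSet_ball, integral_const, smul_eq_mul,
          measureReal_restrict_apply_univ, integral_add hTi (hfg.norm.const_mul _),
          integral_const_mul] at hcmp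
        have : (L : ℝ) * ∫ x, ‖f x - g x‖ ∂μ ≤ L * ε := by gcongr
        linarith
      refine le_of_forall_pos_le_add fun ε hε => ?_
      refine (hsmall (ε / (L + 1)) (by positivity)).trans ?_
      have : (L : ℝ) * (ε / (L + 1)) ≤ ε := by
        rw [mul_div_assoc', div_le_iff₀ (by positivity)]
        nlinarith [L.coe_nonneg]
      linarith
    have hlim : Tendsto (fun δ : ℝ => (1 - δ) * μ.real B) (𝓝[>] 0) (𝓝 (μ.real B)) := by
      have : Tendsto (fun δ : ℝ => (1 - δ) * μ.real B) (𝓝 0) (𝓝 ((1 - 0) * μ.real B)) := by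
        exact (by fun_prop : Continuous fun δ : ℝ => (1 - δ) * μ.real B).tendsto 0
      rw [sub_zero, one_mul] at this
      exact this.mono_left nhdsWithin_le_nhds
    refine le_of_tendsto hlim ?_
    filter_upwards [Ioo_mem_nhdsGT (show (0 : ℝ) < 1 / 2 by norm_num)] with δ hδ
    exact key δ hδ.1 hδ.2
  have hun : (Set.univ : Set Plane) = ⋃ n : ℕ, Metric.ball 0 (n : ℝ) :=
    (Metric.iUnion_ball_nat 0).symm
  rw [hun, Monotone.measure_iUnion (fun i j hij => Metric.ball_subset_ball (by exact_mod_cast hij))]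
  exact iSup_le hball

end Uniqueness

/-! ### Comparison of a measure with ℋ¹ through its densities -/

section HausdorffComparison

variable {X : Type*} [MetricSpace X] [MeasurableSpace X]

theorem exists_radius_of_density {μ : Measure X} {A U : Set X} {C : ℝ≥0∞} (hAU : A ⊆ U)
    (hU : IsOpen U)
    (h : ∀ y ∈ A, ∃ r > 0, ∀ s, 0 < s → s ≤ r →
      ENNReal.ofReal (2 * s) ≤ C * μ (Metric.closedBall y s)) {δ : ℝ} (hδ : 0 < δ) :
    ∃ R : X → ℝ, ∀ y ∈ A, 0 < R y ∧ R y ≤ δ ∧ ∀ s, 0 < s → s ≤ R y →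
      Metric.closedBall y s ⊆ U ∧ ENNReal.ofReal (2 * s) ≤ C * μ (Metric.closedBall y s) := by
  have h1 : ∀ y, ∃ R : ℝ, y ∈ A → 0 < R ∧ R ≤ δ ∧ ∀ s, 0 < s → s ≤ R →
      Metric.closedBall y s ⊆ U ∧ ENNReal.ofReal (2 * s) ≤ C * μ (Metric.closedBall y s) := by
    intro y
    by_cases hy : y ∈ A
    · obtain ⟨r, hr, hr1⟩ := h y hy
      obtain ⟨ε, hε, hε1⟩ := Metric.isOpen_iff.1 hU y (hAU hy)
      refine ⟨min (min r (ε / 2)) δ, fun _ => ⟨by positivity, min_le_right _ _, fun s hs hsR => ?_⟩⟩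
      have h2 := hsR.trans (min_le_left _ _)
      refine ⟨(Metric.closedBall_subset_ball ?_).trans hε1, hr1 s hs (h2.trans (min_le_left _ _))⟩
      linarith [h2.trans (min_le_right _ _)]
    · exact ⟨0, fun h => absurd h hy⟩
  choose R hR using h1
  exact ⟨R, hR⟩

variable [BorelSpace X]

/-- A measure that is at most `c` times the diameter on all small sets meeting `A` is at most
`c` times the one-dimensional Hausdorff measure on `A`. -/
theorem measure_le_mul_hausdorffMeasure {μ : Measure X} {A : Set X} {c : ℝ} (hc : 0 < c)
    (h : ∀ y ∈ A, ∃ r > 0, ∀ d, 0 < d → d ≤ r → ∀ S : Set X, y ∈ S →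
      (∀ x ∈ S, ∀ x' ∈ S, dist x x' ≤ d) → μ S ≤ ENNReal.ofReal (c * d)) :
    μ A ≤ ENNReal.ofReal c * Measure.hausdorffMeasure 1 A := by
  -- The admissible scale depends on y; A is exhausted by the sets where it is at least 1/(k+1), and
  -- on each of these any fine cover can be estimated term by term.
  let p : ℕ → X → Prop := fun k y => ∀ d : ℝ, 0 < d → d ≤ 1 / ((k : ℝ) + 1) → ∀ S : Set X, y ∈ S →
      (∀ x ∈ S, ∀ x' ∈ S, dist x x' ≤ d) → μ S ≤ ENNReal.ofReal (c * d)
  have hA : A = ⋃ k : ℕ, {y ∈ A | p k y} := by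
    ext y
    simp only [Set.mem_iUnion]
    refine ⟨fun hy => ?_, fun ⟨k, hk⟩ => hk.1⟩
    obtain ⟨r, hr, h1⟩ := h y hy
    obtain ⟨k, hk⟩ := exists_nat_one_div_lt hr
    exact ⟨k, hy, fun d hd hdk => h1 d hd (hdk.trans hk.le)⟩
  have hmono : Monotone fun k : ℕ => {y ∈ A | p k y} := by
    intro k l hkl y hy
    refine ⟨hy.1, fun d hd hdl => hy.2 d hd (hdl.trans ?_)⟩
    gcongr
  conv_lhs => rw [hA]
  rw [hmono.measure_iUnion]
  refine iSup_le fun k => ?_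
  set B := {y ∈ A | p k y}
  refine le_trans ?_ (mul_le_mul_right (measure_mono (Set.sep_subset _ _ : B ⊆ A)) _)
  set δ : ℝ := 1 / (2 * ((k : ℝ) + 1)) with hδdef
  have hδ : 0 < δ := by positivity
  have hδ' : δ < 1 / ((k : ℝ) + 1) := by rw [hδdef]; gcongr; linarith [k.cast_nonneg (α := ℝ)]
  rw [Measure.hausdorffMeasure_apply]
  refine le_trans ?_ (mul_le_mul_right (le_iSup₂_of_le (ENNReal.ofReal δ)
    (ENNReal.ofReal_pos.2 hδ) le_rfl) _)
  have hc0 : ENNReal.ofReal c ≠ 0 := (ENNReal.ofReal_pos.2 hc).ne'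
  rw [ENNReal.mul_iInf_of_ne hc0 ENNReal.ofReal_ne_top]
  refine le_iInf fun t => ?_
  rw [ENNReal.mul_iInf_of_ne hc0 ENNReal.ofReal_ne_top]
  refine le_iInf fun ht => ?_
  rw [ENNReal.mul_iInf_of_ne hc0 ENNReal.ofReal_ne_top]
  refine le_iInf fun hd => ?_
  rw [← ENNReal.tsum_mul_left]
  have hBt : B ⊆ ⋃ n, B ∩ t n := by
    rw [← Set.inter_iUnion]; exact fun x hx => ⟨hx, ht hx⟩
  refine (measure_mono hBt).trans ((measure_iUnion_le _).trans (ENNReal.tsum_le_tsum fun n => ?_))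
  rcases (B ∩ t n).eq_empty_or_nonempty with h0 | ⟨y, hyB, hyt⟩
  · rw [h0, measure_empty]; exact zero_le
  refine (measure_mono Set.inter_subset_right).trans ?_
  have hne : (t n).Nonempty := ⟨y, hyt⟩
  rw [iSup_pos hne, ENNReal.rpow_one]
  have hfin : Metric.ediam (t n) ≠ ∞ := ((hd n).trans_lt ENNReal.ofReal_lt_top).ne
  set e := (Metric.ediam (t n)).toReal with he
  have heδ : e ≤ δ := ENNReal.toReal_le_of_le_ofReal hδ.le (hd n)
  -- The diameter e may be 0, while the hypothesis needs d > 0; hence the limit from the right.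
  have hmain : ∀ᶠ d in 𝓝[>] e, μ (t n) ≤ ENNReal.ofReal (c * d) := by
    filter_upwards [Ioo_mem_nhdsGT (heδ.trans_lt hδ')] with d hd'
    refine hyB.2 d (ENNReal.toReal_nonneg.trans_lt hd'.1) hd'.2.le _ hyt fun x hx x' hx' => ?_
    refine le_trans ?_ hd'.1.le
    rw [dist_edist]
    exact ENNReal.toReal_mono hfin (Metric.edist_le_ediam_of_mem hx hx')
  have hlim : Tendsto (fun d => ENNReal.ofReal (c * d)) (𝓝[>] e) (𝓝 (ENNReal.ofReal (c * e))) :=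
    (ENNReal.continuous_ofReal.comp (continuous_const.mul continuous_id)).continuousWithinAt.tendsto
  refine (ge_of_tendsto hlim hmain).trans_eq ?_
  rw [ENNReal.ofReal_mul hc.le, he, ENNReal.ofReal_toReal hfin]

theorem hausdorffMeasure_le_of_closedBall_covering {A : Set X} {K : ℝ≥0∞}
    (h : ∀ n : ℕ, ∃ (u : Set X) (r : X → ℝ), u.Countable ∧ (∀ x ∈ u, r x ≤ 1 / ((n : ℝ) + 1)) ∧
      A ⊆ (⋃ x ∈ u, Metric.closedBall x (r x)) ∧ ∑' x : u, ENNReal.ofReal (2 * r x) ≤ K) :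
    Measure.hausdorffMeasure 1 A ≤ K := by
  choose u r hu hr hA hK using h
  have := fun n => (hu n).to_subtype
  have hdiam : ∀ (x : X) (s : ℝ), Metric.ediam (Metric.closedBall x s) ≤ ENNReal.ofReal (2 * s) := by
    intro x s
    refine Metric.ediam_le fun a ha b hb => ?_
    rw [edist_dist]
    refine ENNReal.ofReal_le_ofReal ?_
    have h1 := dist_triangle_right a b x
    rw [Metric.mem_closedBall] at ha hb
    linarith
  have hlim : Tendsto (fun n : ℕ => ENNReal.ofReal (2 * (1 / ((n : ℝ) + 1)))) atTop (𝓝 0) := by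
    have h1 := (tendsto_one_div_add_atTop_nhds_zero_nat (𝕜 := ℝ)).const_mul 2
    rw [mul_zero] at h1
    have h2 := ENNReal.tendsto_ofReal h1
    rwa [ENNReal.ofReal_zero] at h2
  refine (Measure.hausdorffMeasure_le_liminf_tsum 1 A (l := atTop) _ hlim
    (fun n (x : u n) => Metric.closedBall (x : X) (r n x)) ?_ ?_).trans ?_
  · refine Eventually.of_forall fun n x => (hdiam _ _).trans (ENNReal.ofReal_le_ofReal ?_)
    linarith [hr n x x.2]
  · refine Eventually.of_forall fun n => ?_
    rw [← Set.biUnion_eq_iUnion (u n) fun x _ => Metric.closedBall x (r n x)]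
    exact hA n
  · refine liminf_le_of_le (by isBoundedDefault) fun b hb => ?_
    obtain ⟨n, hn⟩ := hb.exists
    refine hn.trans (le_trans (ENNReal.tsum_le_tsum fun x => ?_) (hK n))
    rw [ENNReal.rpow_one]; exact hdiam _ _

theorem tsum_ofReal_le_of_pairwiseDisjoint {μ : Measure X} {u U : Set X} {r : X → ℝ} {C : ℝ≥0∞}
    (hu : u.Countable) (hd : u.PairwiseDisjoint fun x => Metric.closedBall x (r x))
    (hU : ∀ x ∈ u, Metric.closedBall x (r x) ⊆ U)
    (hC : ∀ x ∈ u, ENNReal.ofReal (2 * r x) ≤ C * μ (Metric.closedBall x (r x))) :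
    ∑' x : u, ENNReal.ofReal (2 * r x) ≤ C * μ U := by
  refine (ENNReal.tsum_le_tsum fun x : u => hC x x.2).trans ?_
  rw [ENNReal.tsum_mul_left, ← measure_biUnion hu hd fun x _ => Metric.isClosed_closedBall.measurableSet]
  exact mul_le_mul_right (measure_mono (Set.iUnion₂_subset hU)) _

variable [SecondCountableTopology X]

/-- The fivefold Vitali covering inside an open set of small measure loses only a constant factor,
which is harmless for null sets. It handles the part of A missed by the Besicovitch covers, where
the constant must stay sharp. -/
theorem hausdorffMeasure_eq_zero_of_density {μ : Measure X} [μ.OuterRegular] {A : Set X}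
    {C : ℝ≥0∞} (hC : C ≠ ∞)
    (h : ∀ y ∈ A, ∃ r > 0, ∀ s, 0 < s → s ≤ r →
      ENNReal.ofReal (2 * s) ≤ C * μ (Metric.closedBall y s)) (h0 : μ A = 0) :
    Measure.hausdorffMeasure 1 A = 0 := by
  have key : ∀ ε : ℝ≥0∞, 0 < ε → Measure.hausdorffMeasure 1 A ≤ 5 * (C * ε) := by
    intro ε hε
    obtain ⟨U, hAU, hU, hμU⟩ := A.exists_isOpen_lt_of_lt ε (h0 ▸ hε)
    refine hausdorffMeasure_le_of_closedBall_covering fun n => ?_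
    obtain ⟨R, hR⟩ := exists_radius_of_density hAU hU h
      (show 0 < 1 / (5 * ((n : ℝ) + 1)) by positivity)
    obtain ⟨u, huA, hdis, hcov⟩ := Vitali.exists_disjoint_subfamily_covering_enlargement_closedBall
      A id R _ (fun y hy => (hR y hy).2.1) 5 (by norm_num)
    have hcount : u.Countable := by
      refine hdis.countable_of_nonempty_interior fun y hy => ⟨y, ?_⟩
      exact Metric.ball_subset_interior_closedBall (Metric.mem_ball_self (hR y (huA hy)).1)
    refine ⟨u, fun y => 5 * R y, hcount, fun y hy => ?_, fun y hy => ?_, ?_⟩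
    · have := (hR y (huA hy)).2.1
      rw [one_div, mul_inv, ← one_div ((n : ℝ) + 1)] at this
      linarith
    · obtain ⟨b, hb, hsub⟩ := hcov y hy
      exact Set.mem_biUnion hb (hsub (Metric.mem_closedBall_self (hR y hy).1.le))
    · have h1 : ∀ x : u, ENNReal.ofReal (2 * (5 * R x)) = 5 * ENNReal.ofReal (2 * R x) := by
        intro x
        rw [show 2 * (5 * R x) = 5 * (2 * R x) by ring, ENNReal.ofReal_mul (by norm_num)]
        norm_num
      simp_rw [h1, ENNReal.tsum_mul_left]
      refine mul_le_mul_right ((tsum_ofReal_le_of_pairwiseDisjoint hcount hdis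
        (fun x hx => ((hR x (huA hx)).2.2 _ (hR x (huA hx)).1 le_rfl).1)
        (fun x hx => ((hR x (huA hx)).2.2 _ (hR x (huA hx)).1 le_rfl).2)).trans ?_) _
      exact mul_le_mul_right hμU.le _
  have hlim : Tendsto (fun ε : ℝ≥0∞ => 5 * (C * ε)) (𝓝[>] 0) (𝓝 0) := by
    have h1 : Tendsto (fun ε : ℝ≥0∞ => 5 * (C * ε)) (𝓝 0) (𝓝 (5 * (C * 0))) :=
      ENNReal.Tendsto.const_mul (ENNReal.Tendsto.const_mul tendsto_id (Or.inr hC))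
        (Or.inr (by norm_num))
    rw [mul_zero, mul_zero] at h1
    exact h1.mono_left nhdsWithin_le_nhds
  exact nonpos_iff_eq_zero.1 (ge_of_tendsto hlim (eventually_mem_nhdsWithin.mono key))

/-- A measure whose lower one-dimensional density is at least `1 / C` at every point of `A`
is at least `1 / C` times the one-dimensional Hausdorff measure on `A`. -/
theorem hausdorffMeasure_le_mul_measure [HasBesicovitchCovering X] {μ : Measure X}
    [μ.OuterRegular] [SFinite μ] {A : Set X} {C : ℝ≥0∞} (hC : C ≠ ∞)
    (h : ∀ y ∈ A, ∃ r > 0, ∀ s, 0 < s → s ≤ r →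
      ENNReal.ofReal (2 * s) ≤ C * μ (Metric.closedBall y s)) (hA : μ A ≠ ∞) :
    Measure.hausdorffMeasure 1 A ≤ C * μ A := by
  have key : ∀ ε : ℝ≥0∞, 0 < ε → Measure.hausdorffMeasure 1 A ≤ C * (μ A + ε) := by
    intro ε hε
    obtain ⟨U, hAU, hU, hμU⟩ := A.exists_isOpen_lt_of_lt (μ A + ε)
      (ENNReal.lt_add_right hA hε.ne')
    have hstep : ∀ n : ℕ, ∃ (t : Set X) (r : X → ℝ), t.Countable ∧
        (∀ x ∈ t, r x ≤ 1 / ((n : ℝ) + 1)) ∧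
        μ (A \ ⋃ x ∈ t, Metric.closedBall x (r x)) = 0 ∧
        ∑' x : t, ENNReal.ofReal (2 * r x) ≤ C * (μ A + ε) := by
      intro n
      obtain ⟨R, hR⟩ := exists_radius_of_density hAU hU h
        (show 0 < 1 / ((n : ℝ) + 1) by positivity)
      obtain ⟨t, r, ht, htA, hr, hnull, hdis⟩ := Besicovitch.exists_disjoint_closedBall_covering_ae μ
        (fun _ => Set.univ) A (fun x _ δ hδ => by simpa using Set.nonempty_Ioo.2 hδ) R
        (fun y hy => (hR y hy).1)
      refine ⟨t, r, ht, fun x hx => (hr x hx).2.2.le.trans (hR x (htA hx)).2.1, hnull, ?_⟩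
      refine (tsum_ofReal_le_of_pairwiseDisjoint ht hdis
        (fun x hx => ((hR x (htA hx)).2.2 _ (hr x hx).2.1 (hr x hx).2.2.le).1)
        (fun x hx => ((hR x (htA hx)).2.2 _ (hr x hx).2.1 (hr x hx).2.2.le).2)).trans ?_
      exact mul_le_mul_right hμU.le _
    choose t r ht hr hnull hsum using hstep
    set G : ℕ → Set X := fun n => ⋃ x ∈ t n, Metric.closedBall x (r n x) with hG
    -- Points in every G n are covered at all scales with sum at most C(μ(A) + ε). The others form a
    -- μ-null, hence ℋ¹-null, set.
    have hsub : A ⊆ (A ∩ ⋂ n, G n) ∪ ⋃ n, A \ G n := by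
      intro x hx
      by_cases hxG : x ∈ ⋂ n, G n
      · exact Or.inl ⟨hx, hxG⟩
      · obtain ⟨n, hn⟩ := not_forall.1 (mt Set.mem_iInter.2 hxG)
        exact Or.inr (Set.mem_iUnion.2 ⟨n, hx, hn⟩)
    have h0 : Measure.hausdorffMeasure 1 (⋃ n, A \ G n) = 0 :=
      measure_iUnion_null fun n => hausdorffMeasure_eq_zero_of_density hC
        (fun y hy => h y hy.1) (hnull n)
    refine (measure_mono hsub).trans ((measure_union_le _ _).trans ?_)
    rw [h0, add_zero]
    refine hausdorffMeasure_le_of_closedBall_covering fun n => ⟨t n, r n, ht n, hr n, ?_, hsum n⟩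
    exact fun x hx => Set.mem_iInter.1 hx.2 n
  have hlim : Tendsto (fun ε : ℝ≥0∞ => C * (μ A + ε)) (𝓝[>] 0) (𝓝 (C * μ A)) := by
    have h1 : Tendsto (fun ε : ℝ≥0∞ => C * (μ A + ε)) (𝓝 0) (𝓝 (C * (μ A + 0))) :=
      ENNReal.Tendsto.const_mul (tendsto_const_nhds.add tendsto_id) (Or.inr hC)
    rw [add_zero] at h1
    exact h1.mono_left nhdsWithin_le_nhds
  exact ge_of_tendsto hlim (eventually_mem_nhdsWithin.mono key)

end HausdorffComparison

/-! ### De Giorgi's theorem on the reduced boundary -/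

section ReducedBoundary

variable {Ω : Set Plane} {μ : Measure Plane} {σ : Plane → Plane} {y ν : Plane}

theorem iUnion_closedBall_eq_ball {X : Type*} [PseudoMetricSpace X] (y : X) {r : ℝ} {s : ℕ → ℝ}
    (hs : ∀ n, s n < r) (hlim : Tendsto s atTop (𝓝 r)) :
    ⋃ n, Metric.closedBall y (s n) = Metric.ball y r := by
  ext x
  simp only [Set.mem_iUnion, Metric.mem_closedBall, Metric.mem_ball]
  refine ⟨fun ⟨n, hn⟩ => hn.trans_lt (hs n), fun hx => ?_⟩
  obtain ⟨n, hn⟩ := (hlim.eventually (lt_mem_nhds hx)).exists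
  exact ⟨n, hn.le⟩

/-- Besicovitch differentiation speaks of closed balls, the normal of open ones. An open ball is an
increasing union of closed ones, so its average is a limit of theirs. -/
theorem IsGaussGreenPolar.tendsto_average_ball (hpol : IsGaussGreenPolar Ω μ σ)
    (hpos : ∀ r : ℝ, 0 < r → 0 < μ (Metric.ball y r))
    (h : Tendsto (fun r : ℝ => ⨍ x in Metric.closedBall y r, σ x ∂μ) (𝓝[>] 0) (𝓝 ν)) :
    Tendsto (fun r : ℝ => ⨍ x in Metric.ball y r, σ x ∂μ) (𝓝[>] 0) (𝓝 ν) := by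
  rw [Metric.nhds_basis_closedBall.tendsto_right_iff] at h ⊢
  intro ε hε
  obtain ⟨δ, hδ, h1⟩ := exists_forall_Ioc_of_eventually (h ε hε)
  filter_upwards [Ioc_mem_nhdsGT hδ] with r hr
  obtain ⟨s, hsm, hs, hlim⟩ := exists_seq_strictMono_tendsto' hr.1
  have hun := iUnion_closedBall_eq_ball y (fun n => (hs n).2) hlim
  have hmono : Monotone fun n => Metric.closedBall y (s n) :=
    fun m n hmn => Metric.closedBall_subset_closedBall (hsm.monotone hmn)
  have hfin := hpol.measure_ball_lt_top y r
  have hI : Tendsto (fun n => ∫ x in Metric.closedBall y (s n), σ x ∂μ) atTop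
      (𝓝 (∫ x in Metric.ball y r, σ x ∂μ)) := by
    rw [← hun]
    refine tendsto_setIntegral_of_monotone (fun n => measurableSet_closedBall) hmono ?_
    rw [hun]; exact hpol.integrableOn hfin
  have hM : Tendsto (fun n => μ.real (Metric.closedBall y (s n))) atTop
      (𝓝 (μ.real (Metric.ball y r))) := by
    refine (ENNReal.tendsto_toReal hfin.ne).comp ?_
    rw [← hun]
    exact tendsto_measure_iUnion_atTop hmono
  have hne : μ.real (Metric.ball y r) ≠ 0 := (ENNReal.toReal_pos (hpos r hr.1).ne' hfin.ne).ne'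
  have hav : Tendsto (fun n => ⨍ x in Metric.closedBall y (s n), σ x ∂μ) atTop
      (𝓝 (⨍ x in Metric.ball y r, σ x ∂μ)) := by
    simp_rw [setAverage_eq]
    exact (hM.inv₀ hne).smul hI
  exact Metric.isClosed_closedBall.mem_of_tendsto hav
    (Eventually.of_forall fun n => h1 _ (hs n).1 ((hs n).2.le.trans hr.2))

theorem IsGaussGreenPolar.ae_isNormalAt (hpol : IsGaussGreenPolar Ω μ σ) :
    ∀ᵐ y ∂μ, IsNormalAt μ σ y (σ y) := by
  have := hpol.1
  have hloc : LocallyIntegrable σ μ := fun x =>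
    ⟨Metric.ball x 1, Metric.ball_mem_nhds x one_pos,
      hpol.integrableOn (hpol.measure_ball_lt_top x 1)⟩
  filter_upwards [(Besicovitch.vitaliFamily μ).ae_tendsto_average hloc, hpol.2.2.1,
    Measure.support_mem_ae (μ := μ)] with y h1 h2 h3
  have hpos : ∀ r : ℝ, 0 < r → 0 < μ (Metric.ball y r) := fun r hr =>
    (Measure.mem_support_iff_forall y).1 h3 _ (Metric.ball_mem_nhds y hr)
  exact ⟨hpos, hpol.tendsto_average_ball hpos (h1.comp (Besicovitch.tendsto_filterAt μ y)), h2⟩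

/-- Uniqueness of the polar decomposition allows one fixed pair (μ, σ) to replace the existential
quantifier. -/
theorem IsGaussGreenPolar.isOutwardNormal_iff (hpol : IsGaussGreenPolar Ω μ σ) :
    IsOutwardNormal Ω y ν ↔ IsNormalAt μ σ y ν := by
  refine ⟨fun ⟨μ', σ', hpol', h1, h2, h3⟩ => ?_, fun h => ⟨μ, σ, hpol, h⟩⟩
  obtain ⟨rfl, hσ⟩ := hpol.unique hpol'
  refine ⟨h1, h2.congr fun r => ?_, h3⟩
  exact average_congr (ae_restrict_of_ae hσ.symm)

theorem IsGaussGreenPolar.outwardNormal_eq (hpol : IsGaussGreenPolar Ω μ σ)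
    (hn : IsNormalAt μ σ y ν) : outwardNormal Ω y = ν := by
  have hex : ∃ ν, IsOutwardNormal Ω y ν := ⟨ν, hpol.isOutwardNormal_iff.2 hn⟩
  rw [outwardNormal, dif_pos hex]
  exact tendsto_nhds_unique (hpol.isOutwardNormal_iff.1 hex.choose_spec).2.1 hn.2.1

theorem IsGaussGreenPolar.ae_mem_reducedBoundary (hpol : IsGaussGreenPolar Ω μ σ) :
    ∀ᵐ y ∂μ, y ∈ reducedBoundary Ω ∧ outwardNormal Ω y = σ y ∧ ‖σ y‖ = 1 := by
  filter_upwards [hpol.ae_isNormalAt] with y hy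
  exact ⟨⟨_, hpol.isOutwardNormal_iff.2 hy⟩, hpol.outwardNormal_eq hy, hy.2.2⟩

/-- The lower density 2 - η on balls and the upper density 1 + η on small sets give the two
inequalities as η tends to 0. No measurability of A is required. -/
theorem IsGaussGreenPolar.measure_eq_hausdorffMeasure (hpol : IsGaussGreenPolar Ω μ σ)
    (hΩ : MeasurableSet Ω) {A : Set Plane} (hA : A ⊆ reducedBoundary Ω) (hfin : μ A ≠ ∞) :
    Measure.hausdorffMeasure 1 A = μ A := by
  have := hpol.1
  have hn : ∀ y ∈ A, ∃ ν, IsNormalAt μ σ y ν := fun y hy =>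
    (hA hy).imp fun ν h => hpol.isOutwardNormal_iff.1 h
  refine le_antisymm ?_ ?_
  · have key : ∀ η : ℝ, 0 < η → η < 1 →
        Measure.hausdorffMeasure 1 A ≤ ENNReal.ofReal (2 / (2 - η)) * μ A := by
      intro η hη hη1
      refine hausdorffMeasure_le_mul_measure ENNReal.ofReal_ne_top (fun y hy => ?_) hfin
      obtain ⟨ν, hν⟩ := hn y hy
      obtain ⟨r, hr, h1⟩ := hν.exists_measureReal_ball_ge hpol hΩ hη
      refine ⟨r, hr, fun s hs hsr => ?_⟩
      refine le_trans ?_ (mul_le_mul_right (measure_mono Metric.ball_subset_closedBall) _)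
      rw [← ofReal_measureReal (hpol.measure_ball_lt_top y s).ne,
        ← ENNReal.ofReal_mul (by apply div_nonneg <;> linarith)]
      refine ENNReal.ofReal_le_ofReal ?_
      rw [div_mul_eq_mul_div, le_div_iff₀ (by linarith)]
      linarith [h1 s hs hsr]
    have hlim : Tendsto (fun η : ℝ => ENNReal.ofReal (2 / (2 - η)) * μ A) (𝓝[>] 0) (𝓝 (μ A)) := by
      have h1 : ContinuousAt (fun η : ℝ => 2 / (2 - η)) 0 := by
        refine ContinuousAt.div continuousAt_const (by fun_prop) (by norm_num)
      have h2 := ENNReal.Tendsto.mul_const (b := μ A)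
        (ENNReal.tendsto_ofReal (h1.tendsto.mono_left (nhdsWithin_le_nhds (s := Set.Ioi 0)))) (Or.inr hfin)
      simpa using h2
    refine ge_of_tendsto hlim ?_
    filter_upwards [Ioo_mem_nhdsGT (zero_lt_one (α := ℝ))] with η hη
    exact key η hη.1 hη.2
  · by_cases htop : Measure.hausdorffMeasure 1 A = ∞
    · rw [htop]; exact le_top
    have key : ∀ η : ℝ, 0 < η → μ A ≤ ENNReal.ofReal (1 + η) * Measure.hausdorffMeasure 1 A := by
      intro η hη
      refine measure_le_mul_hausdorffMeasure (by linarith) fun y hy => ?_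
      obtain ⟨ν, hν⟩ := hn y hy
      exact hν.exists_measure_le hpol hΩ hη
    have hlim : Tendsto (fun η : ℝ => ENNReal.ofReal (1 + η) * Measure.hausdorffMeasure 1 A)
        (𝓝[>] 0) (𝓝 (Measure.hausdorffMeasure 1 A)) := by
      have h1 : ContinuousAt (fun η : ℝ => 1 + η) 0 := by fun_prop
      have h2 := ENNReal.Tendsto.mul_const (b := Measure.hausdorffMeasure 1 A)
        (ENNReal.tendsto_ofReal (h1.tendsto.mono_left (nhdsWithin_le_nhds (s := Set.Ioi 0)))) (Or.inr htop)
      simpa using h2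
    exact ge_of_tendsto hlim (eventually_mem_nhdsWithin.mono key)

/-- De Giorgi's theorem: the Gauss–Green measure is the one-dimensional Hausdorff measure on the
reduced boundary. -/
theorem IsGaussGreenPolar.restrict_hausdorffMeasure (hpol : IsGaussGreenPolar Ω μ σ)
    (hΩ : MeasurableSet Ω) (hfin : μ Set.univ ≠ ∞) :
    (Measure.hausdorffMeasure 1).restrict (reducedBoundary Ω) = μ := by
  refine Measure.ext fun B hB => ?_
  -- Only B needs to be measurable here; measurability of the reduced boundary is not needed.
  rw [Measure.restrict_apply hB, hpol.measure_eq_hausdorffMeasure hΩ Set.inter_subset_right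
    (measure_ne_top_of_subset (Set.subset_univ _) hfin)]
  refine measure_congr ?_
  filter_upwards [hpol.ae_mem_reducedBoundary] with y hy
  exact propext ⟨fun h => h.1, fun h => ⟨h, hy.1⟩⟩

end ReducedBoundary

/-! ### The screened kernel and its flux -/

section Kernel

variable {κ : ℝ}

theorem integrable_exp_neg_norm (hκ : 0 < κ) :
    Integrable (fun z : Plane => Real.exp (-(κ * ‖z‖))) := by
  have h := (integrable_fun_norm_addHaar (volume : Measure Plane)
    (f := fun r => Real.exp (-(κ * r)))).2
  refine h ?_
  have h1 := integrableOn_rpow_mul_exp_neg_mul_rpow (s := 1) (p := 1) (by norm_num) one_pos hκ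
  simpa [finrank_euclideanSpace] using h1

theorem integrable_exp_neg_norm_div (hκ : 0 < κ) :
    Integrable (fun z : Plane => Real.exp (-(κ * ‖z‖)) / ‖z‖) := by
  have h := (integrable_fun_norm_addHaar (volume : Measure Plane)
    (f := fun r => Real.exp (-(κ * r)) / r)).2
  refine h ((exp_neg_integrableOn_Ioi 0 hκ).congr_fun (fun r hr => ?_) measurableSet_Ioi)
  have : r ≠ 0 := (Set.mem_Ioi.1 hr).ne'
  simp only [finrank_euclideanSpace, Fintype.card_fin, smul_eq_mul]
  rw [show 2 - 1 = 1 from rfl, pow_one]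
  field_simp

/-- The kernel `(s ⋅ z) e^{-κ|z|} / (κ|z|²)`. -/
def flux (κ : ℝ) (s z : Plane) : ℝ :=
  inner ℝ s z * (Real.exp (-(κ * ‖z‖)) / (κ * ‖z‖ ^ 2))

theorem measurable_flux (κ : ℝ) {X : Type*} [MeasurableSpace X] {s z : X → Plane}
    (hs : Measurable s) (hz : Measurable z) : Measurable fun x => flux κ (s x) (z x) := by
  unfold flux
  fun_prop

theorem flux_neg (κ : ℝ) (s z : Plane) : flux κ s (-z) = -flux κ s z := by
  simp [flux]

theorem abs_flux_le (hκ : 0 < κ) {s : Plane} (hs : ‖s‖ = 1) (z : Plane) :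
    |flux κ s z| ≤ κ⁻¹ * (Real.exp (-(κ * ‖z‖)) / ‖z‖) := by
  have h1 := abs_real_inner_le_norm s z
  rw [hs, one_mul] at h1
  rcases eq_or_ne z 0 with rfl | hz
  · simp [flux]
  have hz' : 0 < ‖z‖ := norm_pos_iff.2 hz
  rw [flux, abs_mul, abs_of_nonneg (a := Real.exp (-(κ * ‖z‖)) / (κ * ‖z‖ ^ 2)) (by positivity)]
  calc |inner ℝ s z| * (Real.exp (-(κ * ‖z‖)) / (κ * ‖z‖ ^ 2))
      ≤ ‖z‖ * (Real.exp (-(κ * ‖z‖)) / (κ * ‖z‖ ^ 2)) := by gcongr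
    _ = _ := by field_simp

theorem integrable_flux (hκ : 0 < κ) {s : Plane} (hs : ‖s‖ = 1) : Integrable (flux κ s) :=
  ((integrable_exp_neg_norm_div hκ).const_mul κ⁻¹).mono'
    (measurable_flux κ measurable_const measurable_id).aestronglyMeasurable
    (Eventually.of_forall (abs_flux_le hκ hs))

theorem integral_flux (κ : ℝ) (s : Plane) : ∫ z, flux κ s z = 0 := by
  have h := integral_neg_eq_self (flux κ s) volume
  simp_rw [flux_neg, integral_neg] at h
  linarith

theorem integral_abs_sin : ∫ θ in Set.Ioo (-Real.pi) Real.pi, |Real.sin θ| = 4 := by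
  have hπ := Real.pi_pos
  rw [← integral_Ioc_eq_integral_Ioo, ← intervalIntegral.integral_of_le (by linarith),
    ← intervalIntegral.integral_add_adjacent_intervals (b := 0)
      (Real.continuous_sin.abs.intervalIntegrable _ _)
      (Real.continuous_sin.abs.intervalIntegrable _ _)]
  have h1 : ∫ θ in (-Real.pi)..0, |Real.sin θ| = ∫ θ in (-Real.pi)..0, -Real.sin θ := by
    refine intervalIntegral.integral_congr fun θ hθ => ?_
    rw [Set.uIcc_of_le (by linarith)] at hθ
    exact abs_of_nonpos (Real.sin_nonpos_of_nonpos_of_neg_pi_le hθ.2 hθ.1)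
  have h2 : ∫ θ in (0 : ℝ)..Real.pi, |Real.sin θ| = ∫ θ in (0 : ℝ)..Real.pi, Real.sin θ := by
    refine intervalIntegral.integral_congr fun θ hθ => ?_
    rw [Set.uIcc_of_le hπ.le] at hθ
    exact abs_of_nonneg (Real.sin_nonneg_of_nonneg_of_le_pi hθ.1 hθ.2)
  rw [h1, h2, intervalIntegral.integral_neg, integral_sin, integral_sin]
  norm_num

/-- In polar coordinates aligned with s the radial part is κ⁻¹ ∫ e^{-κr} dr = κ⁻² and the angular
part is ∫ |sin θ| dθ = 4. -/
theorem integral_abs_flux (hκ : 0 < κ) {s : Plane} (hs : ‖s‖ = 1) :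
    ∫ z, |flux κ s z| = 4 / κ ^ 2 := by
  let G : ℝ × ℝ → ℝ := fun p =>
    |p.2 * (Real.exp (-(κ * √(p.1 ^ 2 + p.2 ^ 2))) / (κ * (p.1 ^ 2 + p.2 ^ 2)))|
  have h1 : ∀ z, |flux κ s z| = G ((rotateEquiv s hs z) 0, (rotateEquiv s hs z) 1) := by
    intro z
    have hn : (rotateEquiv s hs z 0) ^ 2 + (rotateEquiv s hs z 1) ^ 2 = ‖z‖ ^ 2 := by
      rw [← norm_sq_eq, (rotateEquiv s hs).norm_map]
    simp only [G, hn, Real.sqrt_sq (norm_nonneg z)]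
    rw [rotateEquiv_apply, rotate_one, flux]
  have hGm : Measurable G := by
    simp only [G]
    fun_prop
  have hco := integral_map volume_preserving_coord.measurable.aemeasurable
    (hGm.aestronglyMeasurable (μ := Measure.map (fun x : Plane => (x 0, x 1)) volume))
  rw [volume_preserving_coord.map_eq] at hco
  simp_rw [h1]
  rw [(rotateEquiv s hs).measurePreserving.integral_comp
    (rotateEquiv s hs).toHomeomorph.measurableEmbedding (fun w : Plane => G (w 0, w 1)),
    ← hco, ← integral_comp_polarCoord_symm, polarCoord_target]
  have h2 : ∀ p ∈ Set.Ioi (0 : ℝ) ×ˢ Set.Ioo (-Real.pi) Real.pi,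
      p.1 • G (polarCoord.symm p) = (κ⁻¹ * Real.exp (-κ * p.1)) * |Real.sin p.2| := by
    rintro ⟨r, θ⟩ ⟨hr, -⟩
    have hr0 : 0 < r := hr
    have h3 : (r * Real.cos θ) ^ 2 + (r * Real.sin θ) ^ 2 = r ^ 2 := by
      rw [mul_pow, mul_pow, ← mul_add, Real.cos_sq_add_sin_sq, mul_one]
    simp only [polarCoord_symm_apply, G, h3, Real.sqrt_sq hr0.le, smul_eq_mul]
    rw [abs_mul, abs_mul, abs_of_pos hr0,
      abs_of_nonneg (a := Real.exp (-(κ * r)) / (κ * r ^ 2)) (by positivity), neg_mul]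
    field_simp
  rw [setIntegral_congr_fun (measurableSet_Ioi.prod measurableSet_Ioo) h2, Measure.volume_eq_prod,
    setIntegral_prod_mul (fun r => κ⁻¹ * Real.exp (-κ * r)) (fun θ => |Real.sin θ|),
    integral_abs_sin, integral_const_mul, integral_exp_mul_Ioi (by linarith)]
  simp only [mul_zero, Real.exp_zero]
  field_simp

theorem integrableOn_exp_neg_div {a : ℝ} (ha : 0 < a) :
    IntegrableOn (fun t : ℝ => Real.exp (-(a / t)) / t ^ 2) (Set.Ioc 0 1) ∧
      ∫ t in Set.Ioc (0 : ℝ) 1, Real.exp (-(a / t)) / t ^ 2 = Real.exp (-a) / a := by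
  -- This is the antiderivative e^{-a/t}/a extended continuously by 0 to t ≤ 0, so that the
  -- fundamental theorem applies up to the endpoint 0.
  let g : ℝ → ℝ := fun t => expNegInvGlue (t / a) / a
  have hcont : Continuous g := by
    have : Continuous expNegInvGlue := (expNegInvGlue.contDiff (n := 0)).continuous
    fun_prop
  have hpos : ∀ t, 0 < t → g t = Real.exp (-(a / t)) / a := by
    intro t ht
    simp only [g, expNegInvGlue, not_le.2 (div_pos ht ha), if_false, inv_div]
  have hderiv : ∀ t ∈ Set.Ioo (0 : ℝ) 1, HasDerivAt g (Real.exp (-(a / t)) / t ^ 2) t := by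
    intro t ht
    have h1 : HasDerivAt (fun t => Real.exp (-(a / t)) / a) (Real.exp (-(a / t)) / t ^ 2) t := by
      have h2 := (((hasDerivAt_inv ht.1.ne').const_mul (-a)).exp).div_const a
      have h3 : (fun t : ℝ => Real.exp (-(a / t)) / a) = fun t => Real.exp (-a * t⁻¹) / a := by
        ext t; rw [neg_mul, div_eq_mul_inv a t]
      have h4 : Real.exp (-(a / t)) / t ^ 2 = Real.exp (-a * t⁻¹) * (-a * -(t ^ 2)⁻¹) / a := by
        rw [neg_mul a, div_eq_mul_inv a]
        field_simp
      rw [h3, h4]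
      exact h2
    refine h1.congr_of_eventuallyEq ?_
    filter_upwards [lt_mem_nhds ht.1] with u hu using hpos u hu
  have hInt := intervalIntegral.integrableOn_deriv_of_nonneg hcont.continuousOn hderiv
    (fun t _ => by positivity)
  refine ⟨hInt, ?_⟩
  rw [← intervalIntegral.integral_of_le zero_le_one,
    intervalIntegral.integral_eq_sub_of_hasDerivAt_of_le zero_le_one hcont.continuousOn hderiv
      ((intervalIntegrable_iff_integrableOn_Ioc_of_le zero_le_one).2 hInt), hpos 1 one_pos]
  simp [g, expNegInvGlue]

/-- Averaging the first moment of `e^{-κ|h|} / |h|` over the dilations by `t ∈ (0, 1]`. -/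
theorem integral_dilations (hκ : 0 < κ) {s : Plane} (hs : ‖s‖ = 1) {φ : Plane → ℝ}
    (hφ : Measurable φ) {M : ℝ} (hM : ∀ z, |φ z| ≤ M) :
    ∫ t in Set.Ioc (0 : ℝ) 1, ∫ h, φ (t • h) * inner ℝ s h * (Real.exp (-(κ * ‖h‖)) / ‖h‖) =
      ∫ z, φ z * flux κ s z := by
  -- The integrand after z = th: the Jacobian contributes t⁻², and the powers of t from s⋅h and
  -- 1/|h| cancel. Integration over t then leaves φ times the flux.
  let F : ℝ → Plane → ℝ := fun t z =>
    φ z * inner ℝ s z / ‖z‖ * (Real.exp (-(κ * ‖z‖ / t)) / t ^ 2)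
  have hFm : Measurable (Function.uncurry F) := by
    have h1 : Measurable fun p : ℝ × Plane => φ p.2 := hφ.comp measurable_snd
    simp only [Function.uncurry_def, F]
    fun_prop
  have hinner : ∀ t ∈ Set.Ioc (0 : ℝ) 1,
      ∫ h, φ (t • h) * inner ℝ s h * (Real.exp (-(κ * ‖h‖)) / ‖h‖) = ∫ z, F t z := by
    intro t ht
    have ht0 := ht.1.ne'
    have h1 := Measure.integral_comp_smul (volume : Measure Plane) (F t) t
    rw [finrank_euclideanSpace, Fintype.card_fin,
      abs_of_nonneg (by positivity), smul_eq_mul, eq_inv_mul_iff_mul_eq₀ (by positivity), ← integral_const_mul] at h1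
    rw [← h1]
    congr 1 with h
    simp only [F, norm_smul, Real.norm_of_nonneg ht.1.le, real_inner_smul_right]
    rcases eq_or_ne h 0 with rfl | hh
    · simp
    have : ‖h‖ ≠ 0 := norm_ne_zero_iff.2 hh
    rw [show κ * (t * ‖h‖) / t = κ * ‖h‖ by field_simp]
    field_simp
  have hz : ∀ z : Plane, z ≠ 0 → Integrable (fun t => F t z) (volume.restrict (Set.Ioc 0 1)) ∧
      ∫ t in Set.Ioc (0 : ℝ) 1, F t z = φ z * flux κ s z ∧
      ∫ t in Set.Ioc (0 : ℝ) 1, ‖F t z‖ = |φ z * flux κ s z| := by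
    intro z hz
    have hz' : 0 < ‖z‖ := norm_pos_iff.2 hz
    obtain ⟨h1, h2⟩ := integrableOn_exp_neg_div (mul_pos hκ hz')
    refine ⟨h1.const_mul _, ?_, ?_⟩
    · rw [integral_const_mul, h2, flux]
      field_simp
    · simp_rw [F, norm_mul]
      rw [integral_const_mul]
      have h3 : ∀ t : ℝ, ‖Real.exp (-(κ * ‖z‖ / t)) / t ^ 2‖ =
          Real.exp (-(κ * ‖z‖ / t)) / t ^ 2 := fun t => Real.norm_of_nonneg (by positivity)
      simp_rw [h3]
      rw [h2, ← abs_of_nonneg (a := Real.exp (-(κ * ‖z‖)) / (κ * ‖z‖)) (by positivity),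
        Real.norm_eq_abs, ← abs_mul, flux]
      congr 1
      field_simp
  have hne : ∀ᵐ z : Plane, z ≠ 0 := by
    rw [ae_iff]; simp
  have hfi : Integrable (fun z => φ z * flux κ s z) :=
    (integrable_flux hκ hs).bdd_mul hφ.aestronglyMeasurable (Eventually.of_forall hM)
  have hFi : Integrable (Function.uncurry F) ((volume.restrict (Set.Ioc 0 1)).prod volume) := by
    rw [integrable_prod_iff' hFm.aestronglyMeasurable]
    refine ⟨hne.mono fun z h => (hz z h).1, ?_⟩
    refine hfi.abs.congr ?_
    filter_upwards [hne] with z h using (hz z h).2.2.symm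
  rw [setIntegral_congr_fun measurableSet_Ioc hinner, integral_integral_swap hFi]
  exact integral_congr_ae (hne.mono fun z h => (hz z h).2.1)

end Kernel

/-! ### The double integral in terms of the Gauss–Green measure -/

section Nonlocal

variable {Ω : Set Plane} {μ : Measure Plane} {σ : Plane → Plane} {κ : ℝ}

/-- The factor h⋅σ cancels the singularity 1/|h|, so the triple integrand is dominated by M
e^{-κ|h|} and Fubini applies; for fixed y the average over dilations is the flux. -/
theorem IsGaussGreenPolar.integral_kernel_mul (hpol : IsGaussGreenPolar Ω μ σ)
    (hΩ : MeasurableSet Ω) [IsFiniteMeasure μ] (hκ : 0 < κ) {ψ : Plane → ℝ} (hψ : ContDiff ℝ 1 ψ)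
    (hc : HasCompactSupport ψ) {M : ℝ} (hM : ∀ x, |ψ x| ≤ M) :
    ∫ h, Real.exp (-(κ * ‖h‖)) / ‖h‖ * (-∫ x, ψ x * (chi Ω (x + h) - chi Ω x)) =
      ∫ y, (∫ z, ψ (y - z) * flux κ (σ y) z) ∂μ := by
  let ρ : Measure ℝ := volume.restrict (Set.Ioc 0 1)
  let f : Plane × (ℝ × Plane) → ℝ := fun p =>
    ψ (p.2.2 - p.2.1 • p.1) * inner ℝ (σ p.2.2) p.1 * (Real.exp (-(κ * ‖p.1‖)) / ‖p.1‖)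
  have hM0 : 0 ≤ M := (abs_nonneg _).trans (hM 0)
  have hfm : Measurable f := by
    have h1 : Measurable fun p : Plane × (ℝ × Plane) => ψ (p.2.2 - p.2.1 • p.1) :=
      hψ.continuous.measurable.comp (by fun_prop)
    have h2 : Measurable fun p : Plane × (ℝ × Plane) => σ p.2.2 := hpol.2.1.comp (by fun_prop)
    exact (h1.mul (h2.inner measurable_fst)).mul (by fun_prop)
  have hae : ∀ᵐ p ∂((volume : Measure Plane).prod (ρ.prod μ)), ‖σ p.2.2‖ = 1 :=
    (Measure.quasiMeasurePreserving_snd.comp Measure.quasiMeasurePreserving_snd).ae hpol.2.2.1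
  have hf : Integrable f ((volume : Measure Plane).prod (ρ.prod μ)) := by
    have hb : Integrable (fun p : Plane × (ℝ × Plane) => M * Real.exp (-(κ * ‖p.1‖)))
        ((volume : Measure Plane).prod (ρ.prod μ)) :=
      ((integrable_exp_neg_norm hκ).const_mul M).comp_fst _
    refine hb.mono' hfm.aestronglyMeasurable ?_
    filter_upwards [hae] with p hp
    have h1 := abs_real_inner_le_norm (σ p.2.2) p.1
    rw [hp, one_mul] at h1
    rcases eq_or_ne p.1 0 with h0 | h0
    · simp only [f, h0, inner_zero_right, mul_zero, zero_mul, norm_zero]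
      positivity
    have h2 : 0 < ‖p.1‖ := norm_pos_iff.2 h0
    simp only [f, Real.norm_eq_abs, abs_mul]
    rw [abs_of_nonneg (a := Real.exp (-(κ * ‖p.1‖)) / ‖p.1‖) (by positivity)]
    calc _ ≤ M * ‖p.1‖ * (Real.exp (-(κ * ‖p.1‖)) / ‖p.1‖) := by gcongr; exact hM _
      _ = _ := by field_simp
  have h1 : ∀ᵐ h : Plane,
      Real.exp (-(κ * ‖h‖)) / ‖h‖ * (-∫ x, ψ x * (chi Ω (x + h) - chi Ω x)) =
        ∫ q, f (h, q) ∂(ρ.prod μ) := by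
    filter_upwards [hf.prod_right_ae] with h hh
    rw [hpol.integral_mul_chi_sub_chi hΩ hψ hc, neg_neg,
      intervalIntegral.integral_of_le zero_le_one, integral_prod _ hh, ← integral_const_mul]
    congr 1 with t
    rw [← integral_const_mul]
    congr 1 with y
    simp only [f, real_inner_comm h]
    ring
  rw [integral_congr_ae h1, integral_integral_swap (f := fun h q => f (h, q)) hf,
    integral_prod_symm _ hf.integral_prod_right]
  refine integral_congr_ae ?_
  filter_upwards [hpol.2.2.1] with y hy
  exact integral_dilations hκ hy (φ := fun z => ψ (y - z))
    (hψ.continuous.measurable.comp (measurable_const.sub measurable_id)) fun z => hM _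

theorem measurable_chi_translate (hΩ : MeasurableSet Ω) :
    Measurable fun p : Plane × Plane => chi Ω (p.2 + p.1) - chi Ω p.2 :=
  ((measurable_chi hΩ).comp (measurable_snd.add measurable_fst)).sub
    ((measurable_chi hΩ).comp measurable_snd)

theorem measurable_integral_chi_translate (hΩ : MeasurableSet Ω) {g : Plane → ℝ}
    (hg : Measurable g) : Measurable fun h => ∫ x, g x * (chi Ω (x + h) - chi Ω x) := by
  have h1 : Measurable fun p : Plane × Plane => g p.2 * (chi Ω (p.2 + p.1) - chi Ω p.2) :=
    (hg.comp measurable_snd).mul (measurable_chi_translate hΩ)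
  exact (h1.stronglyMeasurable.integral_prod_right' (ν := volume)).measurable

theorem norm_kernel_mul_le (hΩ : MeasurableSet Ω) (hfin : volume Ω < ∞) (hP : perimeter Ω < ∞)
    {g : Plane → ℝ} (hg : Measurable g) (hM : ∀ x, |g x| ≤ 1) (κ : ℝ) (h : Plane) :
    ‖Real.exp (-(κ * ‖h‖)) / ‖h‖ * (-∫ x, g x * (chi Ω (x + h) - chi Ω x))‖ ≤
      (perimeter Ω).toReal * Real.exp (-(κ * ‖h‖)) := by
  have h1 := abs_integral_mul_chi_sub_chi_le hΩ hfin hP hg hM h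
  rw [norm_mul, norm_neg, Real.norm_eq_abs, Real.norm_eq_abs,
    abs_of_nonneg (a := Real.exp (-(κ * ‖h‖)) / ‖h‖) (by positivity)]
  rcases eq_or_ne h 0 with rfl | h0
  · simp
  have h2 : 0 < ‖h‖ := norm_pos_iff.2 h0
  calc _ ≤ Real.exp (-(κ * ‖h‖)) / ‖h‖ * (1 * ‖h‖ * (perimeter Ω).toReal) := by gcongr
    _ = _ := by field_simp

theorem abs_chi_le_one (x : Plane) : |chi Ω x| ≤ 1 := by
  rw [abs_of_nonneg (chi_nonneg _ _)]; exact chi_le_one _ _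

/-- Mollifications of χ converge only Lebesgue-almost everywhere, yet after the integration in z
only this is needed. The two sides are dominated by P e^{-κ|h|} and by 4/κ². -/
theorem IsGaussGreenPolar.integral_kernel_mul_chi (hpol : IsGaussGreenPolar Ω μ σ)
    (hΩ : MeasurableSet Ω) (hfin : volume Ω < ∞) (hP : perimeter Ω < ∞) [IsFiniteMeasure μ]
    (hκ : 0 < κ) :
    ∫ h, Real.exp (-(κ * ‖h‖)) / ‖h‖ * (-∫ x, chi Ω x * (chi Ω (x + h) - chi Ω x)) =
      ∫ y, (∫ z, chi Ω (y - z) * flux κ (σ y) z) ∂μ := by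
  obtain ⟨ψ, hψ, hc, hM, hlim, -⟩ := exists_mollification (measurable_chi hΩ) abs_chi_le_one
  have hψm : ∀ n, Measurable (ψ n) := fun n => (hψ n).continuous.measurable
  refine tendsto_nhds_unique
    (f := fun n => ∫ h, Real.exp (-(κ * ‖h‖)) / ‖h‖ *
      (-∫ x, ψ n x * (chi Ω (x + h) - chi Ω x))) (l := atTop) ?_ ?_
  · refine tendsto_integral_of_dominated_convergence
      (fun h => (perimeter Ω).toReal * Real.exp (-(κ * ‖h‖))) (fun n => ?_)
      ((integrable_exp_neg_norm hκ).const_mul _)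
      (fun n => Eventually.of_forall (norm_kernel_mul_le hΩ hfin hP (hψm n) (hM n) κ))
      (Eventually.of_forall fun h => ?_)
    · have h1 := measurable_integral_chi_translate hΩ (hψm n)
      exact Measurable.aestronglyMeasurable (Measurable.mul (by fun_prop) h1.neg)
    · exact (tendsto_integral_mul_of_bounded (fun n => (hψm n).aestronglyMeasurable) hM hlim
        (integrable_chi_sub_chi hΩ hfin h)).neg.const_mul _
  · simp_rw [fun n => hpol.integral_kernel_mul hΩ hκ (hψ n) (hc n) (hM n)]
    refine tendsto_integral_of_dominated_convergence (fun _ => 4 / κ ^ 2) (fun n => ?_)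
      (integrable_const _) (fun n => ?_) ?_
    · have h1 : Measurable fun p : Plane × Plane => ψ n (p.1 - p.2) * flux κ (σ p.1) p.2 :=
        ((hψm n).comp (measurable_fst.sub measurable_snd)).mul
          (measurable_flux κ (hpol.2.1.comp measurable_fst) measurable_snd)
      exact (h1.stronglyMeasurable.integral_prod_right' (ν := volume)).aestronglyMeasurable
    · filter_upwards [hpol.2.2.1] with y hy
      rw [← integral_abs_flux hκ hy]
      refine norm_integral_le_of_norm_le (integrable_flux hκ hy).abs
        (Eventually.of_forall fun z => ?_)
      rw [norm_mul]
      exact mul_le_of_le_one_left (abs_nonneg _) (hM n _)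
    · filter_upwards [hpol.2.2.1] with y hy
      refine tendsto_integral_mul_of_bounded (ψ := fun n z => ψ n (y - z))
        (fun n => ((hψm n).comp (measurable_const.sub measurable_id)).aestronglyMeasurable)
        (fun n z => hM n _) ?_ (integrable_flux hκ hy)
      exact (quasiMeasurePreserving_sub_left volume y).ae hlim

theorem chi_mul_sub (x x' : Plane) :
    -(chi Ω x * (chi Ω x' - chi Ω x)) = chi Ω x * (1 - chi Ω x') := by
  by_cases hx : x ∈ Ω
  · rw [chi_of_mem hx]; ring
  · rw [chi_of_notMem hx]; ring

theorem nonlocalTerm_eq_lintegral (hΩ : MeasurableSet Ω) (hfin : volume Ω < ∞) (lam α : ℝ) :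
    nonlocalTerm lam α Ω = ∫⁻ h, ENNReal.ofReal (Real.exp (-(lam * α * ‖h‖)) / ‖h‖ *
      (-∫ x, chi Ω x * (chi Ω (x + h) - chi Ω x))) := by
  set K : Plane → ℝ := fun h => Real.exp (-(lam * α * ‖h‖)) / ‖h‖ with hK
  have hKm : Measurable K := by simp only [hK]; fun_prop
  have hK0 : ∀ h, 0 ≤ K h := fun h => by simp only [hK]; positivity
  have h1 : ∀ x, ∫⁻ y in Ωᶜ, ENNReal.ofReal (K (x - y)) =
      ∫⁻ h, ENNReal.ofReal ((1 - chi Ω (x + h)) * K h) := by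
    intro x
    rw [← lintegral_indicator hΩ.compl, ← lintegral_add_left_eq_self _ x]
    refine lintegral_congr fun h => ?_
    have h2 : K (x - (x + h)) = K h := by simp [hK]
    by_cases hx : x + h ∈ Ω
    · rw [Set.indicator_of_notMem (by simpa using hx), chi_of_mem hx, sub_self, zero_mul,
        ENNReal.ofReal_zero]
    · rw [Set.indicator_of_mem (by simpa using hx), chi_of_notMem hx, sub_zero, one_mul, h2]
  have h3 : nonlocalTerm lam α Ω =
      ∫⁻ x, ∫⁻ h, ENNReal.ofReal (chi Ω x * (1 - chi Ω (x + h)) * K h) := by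
    change ∫⁻ x in Ω, ∫⁻ y in Ωᶜ, ENNReal.ofReal (K (x - y)) = _
    rw [← lintegral_indicator hΩ]
    refine lintegral_congr fun x => ?_
    by_cases hx : x ∈ Ω
    · rw [Set.indicator_of_mem hx, h1, chi_of_mem hx]
      simp_rw [one_mul]
    · rw [Set.indicator_of_notMem hx, chi_of_notMem hx]
      simp
  rw [h3, lintegral_lintegral_swap]
  · refine lintegral_congr fun h => ?_
    rw [← integral_neg, ← integral_const_mul, ofReal_integral_eq_lintegral_ofReal]
    · refine lintegral_congr fun x => ?_
      rw [chi_mul_sub, mul_comm]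
    · exact (((integrable_chi_sub_chi hΩ hfin h).bdd_mul (measurable_chi hΩ).aestronglyMeasurable
        (Eventually.of_forall abs_chi_le_one)).neg).const_mul _
    · refine Eventually.of_forall fun x => ?_
      simp only [chi_mul_sub]
      exact mul_nonneg (hK0 h) (mul_nonneg (chi_nonneg _ _) (sub_nonneg.2 (chi_le_one _ _)))
  · have h4 : Measurable fun p : Plane × Plane => chi Ω (p.1 + p.2) :=
      (measurable_chi hΩ).comp (measurable_fst.add measurable_snd)
    have h5 : Measurable fun p : Plane × Plane => chi Ω p.1 :=
      (measurable_chi hΩ).comp measurable_fst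
    exact (((h5.mul (measurable_const.sub h4)).mul
      (hKm.comp measurable_snd)).ennreal_ofReal).aemeasurable

/-- The double integral in terms of the Gauss–Green measure. -/
theorem IsGaussGreenPolar.nonlocalTerm_eq (hpol : IsGaussGreenPolar Ω μ σ)
    (hΩ : MeasurableSet Ω) (hfin : volume Ω < ∞) (hP : perimeter Ω < ∞) [IsFiniteMeasure μ]
    {lam α : ℝ} (hlam : 0 < lam) (hα : 0 < α) :
    nonlocalTerm lam α Ω < ∞ ∧ (nonlocalTerm lam α Ω).toReal =
      ∫ y, (∫ z, chi Ω (y - z) * flux (lam * α) (σ y) z) ∂μ := by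
  have hκ := mul_pos hlam hα
  set f : Plane → ℝ := fun h => Real.exp (-(lam * α * ‖h‖)) / ‖h‖ *
      (-∫ x, chi Ω x * (chi Ω (x + h) - chi Ω x)) with hf
  have hfi : Integrable f := by
    refine ((integrable_exp_neg_norm hκ).const_mul (perimeter Ω).toReal).mono' ?_
      (Eventually.of_forall (norm_kernel_mul_le hΩ hfin hP (measurable_chi hΩ) abs_chi_le_one _))
    have h1 := measurable_integral_chi_translate hΩ (measurable_chi hΩ)
    exact Measurable.aestronglyMeasurable (Measurable.mul (by fun_prop) h1.neg)
  have hf0 : ∀ h, 0 ≤ f h := fun h => by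
    refine mul_nonneg (by positivity) ?_
    rw [← integral_neg]
    refine integral_nonneg fun x => ?_
    simp only [chi_mul_sub]
    exact mul_nonneg (chi_nonneg _ _) (sub_nonneg.2 (chi_le_one _ _))
  rw [nonlocalTerm_eq_lintegral hΩ hfin,
    ← ofReal_integral_eq_lintegral_ofReal hfi (Eventually.of_forall hf0)]
  refine ⟨ENNReal.ofReal_lt_top, ?_⟩
  rw [ENNReal.toReal_ofReal (integral_nonneg hf0), ← hpol.integral_kernel_mul_chi hΩ hfin hP hκ]

end Nonlocal

/-! ### Comparing the set with its tangent half-plane -/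

section Bulk

variable {Ω : Set Plane} {μ : Measure Plane} {σ : Plane → Plane} {κ : ℝ} {s y : Plane}

theorem measurableSet_halfPlane (s : Plane) : MeasurableSet (halfPlane s) :=
  measurableSet_lt (f := fun x => inner ℝ s x) (g := fun _ => 0) (by fun_prop) (by fun_prop)

theorem measurableSet_preimage_translate (hΩ : MeasurableSet Ω) (y : Plane) :
    MeasurableSet {z | y + z ∈ Ω} :=
  measurable_const_add y hΩ

/-- The integral of `|s ⋅ z| e^{-κ|z|} / (κ|z|²)` over `H₋⁰(s) Δ (Ω - y)`. -/
def bulk (κ : ℝ) (Ω : Set Plane) (s y : Plane) : ℝ≥0∞ :=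
  ∫⁻ z in halfPlane s ∆ {z | y + z ∈ Ω}, ENNReal.ofReal |flux κ s z|

theorem flux_nonpos (hκ : 0 < κ) {z : Plane} (hz : inner ℝ s z ≤ 0) : flux κ s z ≤ 0 :=
  mul_nonpos_of_nonpos_of_nonneg hz (by positivity)

theorem flux_nonneg (hκ : 0 < κ) {z : Plane} (hz : 0 ≤ inner ℝ s z) : 0 ≤ flux κ s z :=
  mul_nonneg hz (by positivity)

/-- The first term is the negative part of the flux, its absolute value on the half-plane. Adding
the flux on Ω - y cancels it on the overlap and adds the positive part outside. -/
theorem indicator_abs_flux (hκ : 0 < κ) (z : Plane) :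
    (halfPlane s ∆ {z | y + z ∈ Ω}).indicator (fun z => |flux κ s z|) z =
      (|flux κ s z| - flux κ s z) / 2 + chi Ω (y + z) * flux κ s z := by
  by_cases hH : inner ℝ s z < 0
  · have hzH : z ∈ halfPlane s := hH
    have h1 := abs_of_nonpos (flux_nonpos hκ hH.le)
    by_cases hE : y + z ∈ Ω
    · have hzE : z ∈ {z | y + z ∈ Ω} := hE
      rw [Set.indicator_of_notMem (by simp [Set.mem_symmDiff, hzH, hE]), chi_of_mem hE, h1]; ring
    · rw [Set.indicator_of_mem (by simp [Set.mem_symmDiff, hzH, hE]), chi_of_notMem hE, h1]; ring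
  · have hzH : z ∉ halfPlane s := hH
    have h1 := abs_of_nonneg (flux_nonneg hκ (not_lt.1 hH))
    by_cases hE : y + z ∈ Ω
    · rw [Set.indicator_of_mem (by simp [Set.mem_symmDiff, hzH, hE]), chi_of_mem hE, h1]; ring
    · rw [Set.indicator_of_notMem (by simp [Set.mem_symmDiff, hzH, hE]), chi_of_notMem hE, h1]; ring

theorem integrable_chi_mul_flux (hΩ : MeasurableSet Ω) (hκ : 0 < κ) (hs : ‖s‖ = 1) (y : Plane) :
    Integrable fun z => chi Ω (y + z) * flux κ s z :=
  (integrable_flux hκ hs).bdd_mul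
    ((measurable_chi hΩ).comp (measurable_const_add y)).aestronglyMeasurable
    (Eventually.of_forall fun _ => abs_chi_le_one _)

/-- By oddness, the negative part of the flux carries half of 4/κ², and the reflection z ↦ -z turns
y + z into y - z with a change of sign. -/
theorem bulk_eq (hΩ : MeasurableSet Ω) (hκ : 0 < κ) (hs : ‖s‖ = 1) (y : Plane) :
    0 ≤ 2 / κ ^ 2 - ∫ z, chi Ω (y - z) * flux κ s z ∧
      bulk κ Ω s y = ENNReal.ofReal (2 / κ ^ 2 - ∫ z, chi Ω (y - z) * flux κ s z) := by
  have hS := (measurableSet_halfPlane s).symmDiff (measurableSet_preimage_translate hΩ y)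
  have hfi := integrable_flux hκ hs
  have hI : Integrable fun z => (|flux κ s z| - flux κ s z) / 2 :=
    (hfi.abs.sub hfi).div_const 2
  have h1 : ∫ z in halfPlane s ∆ {z | y + z ∈ Ω}, |flux κ s z| =
      2 / κ ^ 2 - ∫ z, chi Ω (y - z) * flux κ s z := by
    rw [← integral_indicator hS]
    simp_rw [indicator_abs_flux hκ]
    rw [integral_add hI (integrable_chi_mul_flux hΩ hκ hs y), integral_div,
      integral_sub hfi.abs hfi, integral_abs_flux hκ hs, integral_flux,
      ← integral_neg_eq_self (fun z => chi Ω (y + z) * flux κ s z)]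
    simp_rw [flux_neg, mul_neg, integral_neg, ← sub_eq_add_neg]
    ring
  rw [← h1]
  refine ⟨integral_nonneg fun z => abs_nonneg _, ?_⟩
  rw [bulk, ofReal_integral_eq_lintegral_ofReal hfi.abs.integrableOn
    (Eventually.of_forall fun z => abs_nonneg _)]

theorem IsGaussGreenPolar.lintegral_bulk (hpol : IsGaussGreenPolar Ω μ σ)
    (hΩ : MeasurableSet Ω) (hfin : volume Ω < ∞) (hP : perimeter Ω < ∞) [IsFiniteMeasure μ]
    {lam α : ℝ} (hlam : 0 < lam) (hα : 0 < α) :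
    0 ≤ 2 / (lam * α) ^ 2 * (perimeter Ω).toReal - (nonlocalTerm lam α Ω).toReal ∧
      ∫⁻ y, bulk (lam * α) Ω (σ y) y ∂μ = ENNReal.ofReal
        (2 / (lam * α) ^ 2 * (perimeter Ω).toReal - (nonlocalTerm lam α Ω).toReal) := by
  have hκ := mul_pos hlam hα
  set κ := lam * α
  have hI : Integrable (fun y => ∫ z, chi Ω (y - z) * flux κ (σ y) z) μ := by
    refine Integrable.of_bound (C := 4 / κ ^ 2) ?_ ?_
    · have h1 : Measurable fun p : Plane × Plane => chi Ω (p.1 - p.2) * flux κ (σ p.1) p.2 :=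
        ((measurable_chi hΩ).comp (measurable_fst.sub measurable_snd)).mul
          (measurable_flux κ (hpol.2.1.comp measurable_fst) measurable_snd)
      exact (h1.stronglyMeasurable.integral_prod_right' (ν := volume)).aestronglyMeasurable
    · filter_upwards [hpol.2.2.1] with y hy
      rw [← integral_abs_flux hκ hy]
      refine norm_integral_le_of_norm_le (integrable_flux hκ hy).abs
        (Eventually.of_forall fun z => ?_)
      rw [norm_mul]
      exact mul_le_of_le_one_left (abs_nonneg _) (abs_chi_le_one _)
  have h1 : 2 / κ ^ 2 * (perimeter Ω).toReal - (nonlocalTerm lam α Ω).toReal =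
      ∫ y, (2 / κ ^ 2 - ∫ z, chi Ω (y - z) * flux κ (σ y) z) ∂μ := by
    rw [integral_sub (integrable_const _) hI, (hpol.nonlocalTerm_eq hΩ hfin hP hlam hα).2,
      integral_const, hpol.perimeter_eq hP, smul_eq_mul, mul_comm, measureReal_def]
  have h0 : ∀ᵐ y ∂μ, 0 ≤ 2 / κ ^ 2 - ∫ z, chi Ω (y - z) * flux κ (σ y) z := by
    filter_upwards [hpol.2.2.1] with y hy using (bulk_eq hΩ hκ hy y).1
  rw [h1]
  refine ⟨integral_nonneg_of_ae h0, ?_⟩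
  have hd : Integrable (fun y => 2 / κ ^ 2 - ∫ z, chi Ω (y - z) * flux κ (σ y) z) μ :=
    (integrable_const _).sub hI
  rw [ofReal_integral_eq_lintegral_ofReal hd h0]
  refine lintegral_congr_ae ?_
  filter_upwards [hpol.2.2.1] with y hy using (bulk_eq hΩ hκ hy y).2

end Bulk

/-! ### Linear changes of variables to the stated kernels -/

section ChangeOfVariables

theorem setLIntegral_linear_image (M : Matrix (Fin 2) (Fin 2) ℝ) (hM : M.det ≠ 0)
    {f : Plane → Plane} (hf : ∀ z i, f z i = M i 0 * z 0 + M i 1 * z 1) :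
    Function.Bijective f ∧ ∀ S : Set Plane, MeasurableSet S → ∀ g : Plane → ℝ≥0∞,
      ∫⁻ w in f '' S, g w = ENNReal.ofReal |M.det| * ∫⁻ z in S, g (f z) := by
  let L : Plane →ₗ[ℝ] Plane := Matrix.toEuclideanLin M
  have hdet : LinearMap.det L = M.det := by
    simp only [L, Matrix.toLpLin_eq_toLin, LinearMap.det_toLin]
  have hfL : f = L := by
    ext z i
    rw [hf, Matrix.toLpLin_apply]
    simp [Matrix.mulVec, dotProduct, Fin.sum_univ_two]
  have hunit : IsUnit L := by
    rw [LinearMap.isUnit_iff_isUnit_det, hdet]; exact hM.isUnit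
  have hbij : Function.Bijective f := by
    rw [hfL]; exact (Module.End.isUnit_iff _).1 hunit
  refine ⟨hbij, fun S hS g => ?_⟩
  rw [lintegral_image_eq_lintegral_abs_det_fderiv_mul volume hS
    (f' := fun _ => LinearMap.toContinuousLinearMap L)
    (fun x _ => hfL ▸ (LinearMap.toContinuousLinearMap L).hasFDerivWithinAt) hbij.injective.injOn,
    lintegral_const_mul' _ _ ENNReal.ofReal_ne_top, LinearMap.det_toContinuousLinearMap, hdet]

variable {Ω : Set Plane} {lam α : ℝ} {s : Plane}

/-- A linear bijection commutes with symmetric differences, so only the image of the half-plane, the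
Jacobian and the factor c between the kernels matter. Both stated forms are instances. -/
theorem setLIntegral_symmDiff_image (hΩ : MeasurableSet Ω) (M : Matrix (Fin 2) (Fin 2) ℝ)
    (hM : 0 < M.det) {f : Plane → Plane} (hf : ∀ z i, f z i = M i 0 * z 0 + M i 1 * z 1)
    {s' : Plane} (hH : ∀ z, f z ∈ halfPlane s' ↔ z ∈ halfPlane s) {c : ℝ} (hc : 0 ≤ c)
    {κ : ℝ} {g : Plane → ℝ} (hg : ∀ z, g (f z) = c * |flux κ s z|) (y : Plane) :
    ∫⁻ w in halfPlane s' ∆ ((fun x => f (x - y)) '' Ω), ENNReal.ofReal (g w) =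
      ENNReal.ofReal (M.det * c) * bulk κ Ω s y := by
  obtain ⟨hbij, hInt⟩ := setLIntegral_linear_image M hM.ne' hf
  have h1 : halfPlane s' = f '' halfPlane s := by
    have : f ⁻¹' halfPlane s' = halfPlane s := Set.ext hH
    rw [← this, Set.image_preimage_eq _ hbij.surjective]
  have h2 : (fun x => f (x - y)) '' Ω = f '' {z | y + z ∈ Ω} := by
    ext w
    constructor
    · rintro ⟨x, hx, rfl⟩
      exact ⟨x - y, by simpa using hx, rfl⟩
    · rintro ⟨z, hz, rfl⟩
      exact ⟨y + z, hz, by simp⟩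
  rw [h1, h2, ← Set.image_symmDiff hbij.injective, hInt _
    ((measurableSet_halfPlane s).symmDiff (measurableSet_preimage_translate hΩ y))]
  simp_rw [hg, ENNReal.ofReal_mul hc]
  rw [lintegral_const_mul' _ _ ENNReal.ofReal_ne_top, abs_of_pos hM, ← mul_assoc,
    ENNReal.ofReal_mul hM.le, bulk]

theorem setLIntegral_dilation (hΩ : MeasurableSet Ω) (hlam : 0 < lam) (hα : 0 < α) (s y : Plane) :
    ∫⁻ z in halfPlane s ∆ ((fun x => lam • (x - y)) '' Ω),
      ENNReal.ofReal (|inner ℝ s (‖z‖⁻¹ • z)| * (Real.exp (-(α * ‖z‖)) / ‖z‖)) =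
      ENNReal.ofReal (lam ^ 2 * α) * bulk (lam * α) Ω s y := by
  have hdet : (!![lam, 0; 0, lam] : Matrix (Fin 2) (Fin 2) ℝ).det = lam ^ 2 := by
    rw [Matrix.det_fin_two_of]; ring
  rw [← hdet]
  refine setLIntegral_symmDiff_image hΩ _ (by rw [hdet]; positivity) (f := fun z => lam • z)
    (fun z i => ?_) (fun z => ?_) hα.le (fun z => ?_) y
  · fin_cases i <;> simp
  · change inner ℝ s (lam • z) < 0 ↔ inner ℝ s z < 0
    rw [real_inner_smul_right, mul_neg_iff]
    constructor
    · rintro (h | h)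
      · exact h.2
      · linarith [h.1]
    · exact fun h => Or.inl ⟨hlam, h⟩
  · rcases eq_or_ne z 0 with rfl | hz
    · simp [flux]
    have hz' : 0 < ‖z‖ := norm_pos_iff.2 hz
    rw [flux, norm_smul, Real.norm_of_nonneg hlam.le, smul_smul, real_inner_smul_right,
      abs_mul _ (inner ℝ s z), abs_mul (inner ℝ s z), abs_of_nonneg (a := Real.exp (-(lam * α * ‖z‖)) / (lam * α * ‖z‖ ^ 2))
        (by positivity), abs_of_nonneg (a := (lam * ‖z‖)⁻¹ * lam) (by positivity),
      show α * (lam * ‖z‖) = lam * α * ‖z‖ by ring]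
    field_simp

/-- For w = A_λ R_s z one has w₁² + w₂²/λ² = λ²|z|² and w₂ = λ² s⋅z, so the kernels differ by the
factor λα; the Jacobian is λ³. -/
theorem setLIntegral_anisotropic_dilation (hΩ : MeasurableSet Ω) (hlam : 0 < lam) (hα : 0 < α)
    (hs : ‖s‖ = 1) (y : Plane) :
    ∫⁻ z in halfPlane e₂ ∆ ((fun x => dilate lam (rotate s (x - y))) '' Ω),
      ENNReal.ofReal (|z 1| * (Real.exp (-(α * √((z 0) ^ 2 + (z 1) ^ 2 / lam ^ 2))) /
          ((z 0) ^ 2 + (z 1) ^ 2 / lam ^ 2))) =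
      ENNReal.ofReal (lam ^ 4 * α) * bulk (lam * α) Ω s y := by
  let M : Matrix (Fin 2) (Fin 2) ℝ := !![lam * s 1, -(lam * s 0); lam ^ 2 * s 0, lam ^ 2 * s 1]
  have hs2 : s 0 ^ 2 + s 1 ^ 2 = 1 := by rw [← norm_sq_eq, hs, one_pow]
  have hdet : M.det = lam ^ 3 := by
    rw [Matrix.det_fin_two_of]
    linear_combination lam ^ 3 * hs2
  have h0 : ∀ z, dilate lam (rotate s z) 0 = lam * rotate s z 0 := fun z => by
    simp [dilate, e₁, e₂, PiLp.inner_apply, Fin.sum_univ_two]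
  have h1 : ∀ z, dilate lam (rotate s z) 1 = lam ^ 2 * inner ℝ s z := fun z => by
    rw [← rotate_one]
    simp [dilate, e₁, e₂, PiLp.inner_apply, Fin.sum_univ_two]
  rw [show lam ^ 4 * α = M.det * (lam * α) by rw [hdet]; ring]
  refine setLIntegral_symmDiff_image hΩ M (by rw [hdet]; positivity)
    (f := fun z => dilate lam (rotate s z)) (fun z i => ?_) (fun z => ?_) (mul_pos hlam hα).le
    (fun z => ?_) y
  · fin_cases i
    · simp only [Fin.zero_eta, h0, rotate_zero, M]
      simp
      ring
    · simp only [Fin.mk_one, h1, ← rotate_one, rotate_one_eq, M]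
      simp
      ring
  · change inner ℝ e₂ (dilate lam (rotate s z)) < 0 ↔ inner ℝ s z < 0
    have : inner ℝ e₂ (dilate lam (rotate s z)) = dilate lam (rotate s z) 1 := by
      simp [e₂, PiLp.inner_apply, Fin.sum_univ_two]
    rw [this, h1]
    exact ⟨fun h => neg_of_mul_neg_right h (by positivity),
      fun h => mul_neg_of_pos_of_neg (by positivity) h⟩
  · have hn : (dilate lam (rotate s z) 0) ^ 2 + (dilate lam (rotate s z) 1) ^ 2 / lam ^ 2 =
        (lam * ‖z‖) ^ 2 := by
      rw [h0, h1, ← rotate_one, mul_pow lam ‖z‖, ← norm_rotate hs z, norm_sq_eq]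
      field_simp
    simp only [hn]
    rw [Real.sqrt_sq (by positivity), h1, flux, abs_mul, abs_mul,
      abs_of_nonneg (a := Real.exp (-(lam * α * ‖z‖)) / (lam * α * ‖z‖ ^ 2)) (by positivity),
      abs_of_nonneg (a := lam ^ 2) (by positivity),
      show α * (lam * ‖z‖) = lam * α * ‖z‖ by ring]
    field_simp

end ChangeOfVariables

/-! ### Invariance under Lebesgue-null modifications -/

section NullSets

variable {Ω Ω' : Set Plane}

theorem perimeter_congr (h : Ω =ᵐ[volume] Ω') : perimeter Ω = perimeter Ω' := by
  simp only [perimeter, setIntegral_congr_set h]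

theorem isOutwardNormal_congr (h : Ω =ᵐ[volume] Ω') :
    IsOutwardNormal Ω = IsOutwardNormal Ω' := by
  unfold IsOutwardNormal IsGaussGreenPolar
  simp only [setIntegral_congr_set h]

theorem reducedBoundary_congr (h : Ω =ᵐ[volume] Ω') :
    reducedBoundary Ω = reducedBoundary Ω' := by
  simp only [reducedBoundary, isOutwardNormal_congr h]

theorem outwardNormal_congr (h : Ω =ᵐ[volume] Ω') (y : Plane) :
    outwardNormal Ω y = outwardNormal Ω' y := by
  unfold outwardNormal
  rw [isOutwardNormal_congr h]

theorem nonlocalTerm_congr (h : Ω =ᵐ[volume] Ω') (lam α : ℝ) :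
    nonlocalTerm lam α Ω = nonlocalTerm lam α Ω' := by
  simp only [nonlocalTerm, Measure.restrict_congr_set h, Measure.restrict_congr_set h.compl]

theorem image_ae_eq (h : Ω =ᵐ[volume] Ω') {f : Plane → Plane} (hf : Differentiable ℝ f) :
    f '' Ω =ᵐ[volume] f '' Ω' := by
  have key : ∀ S T : Set Plane, volume (S \ T) = 0 → volume (f '' S \ f '' T) = 0 := by
    intro S T h0
    refine measure_mono_null ?_
      (addHaar_image_eq_zero_of_differentiableOn_of_addHaar_eq_zero volume hf.differentiableOn h0)
    rintro _ ⟨⟨x, hx, rfl⟩, hn⟩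
    exact ⟨x, ⟨hx, fun h => hn ⟨x, h, rfl⟩⟩, rfl⟩
  rw [ae_eq_set] at h ⊢
  exact ⟨key _ _ h.1, key _ _ h.2⟩

theorem boundaryBulk_congr (h : Ω =ᵐ[volume] Ω') (lam α : ℝ) :
    boundaryBulk lam α Ω = boundaryBulk lam α Ω' := by
  have h1 : ∀ s y, (halfPlane s ∆ ((fun x => lam • (x - y)) '' Ω) : Set Plane) =ᵐ[volume]
      (halfPlane s ∆ ((fun x => lam • (x - y)) '' Ω') : Set Plane) := fun s y =>
    ae_eq_set_symmDiff (ae_eq_refl _) (image_ae_eq h (by fun_prop))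
  simp only [boundaryBulk, reducedBoundary_congr h, outwardNormal_congr h,
    Measure.restrict_congr_set (h1 _ _)]

theorem anisotropicBoundaryBulk_congr (h : Ω =ᵐ[volume] Ω') (lam α : ℝ) :
    anisotropicBoundaryBulk lam α Ω = anisotropicBoundaryBulk lam α Ω' := by
  have h1 : ∀ s y, (halfPlane e₂ ∆ ((fun x => dilate lam (rotate s (x - y))) '' Ω) : Set Plane)
      =ᵐ[volume] (halfPlane e₂ ∆ ((fun x => dilate lam (rotate s (x - y))) '' Ω') : Set Plane) :=
    fun s y => ae_eq_set_symmDiff (ae_eq_refl _)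
      (image_ae_eq h (by
        simp only [dilate, rotate, ← innerSL_apply_apply ℝ]
        fun_prop))
  simp only [anisotropicBoundaryBulk, reducedBoundary_congr h, outwardNormal_congr h,
    Measure.restrict_congr_set (h1 _ _)]

end NullSets

/-! ### Assembling the representation -/

section Representation

variable {Ω : Set Plane} {lam α : ℝ}

/-- For a Borel set of finite measure and finite perimeter, both boundary integrals are multiples
of the difference between a multiple of the perimeter and the double integral. -/
theorem boundaryBulk_eq (hΩ : MeasurableSet Ω) (hfin : volume Ω < ∞) (hP : perimeter Ω < ∞)
    (hlam : 0 < lam) (hα : 0 < α) :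
    nonlocalTerm lam α Ω < ∞ ∧
    0 ≤ 2 / (lam * α) ^ 2 * (perimeter Ω).toReal - (nonlocalTerm lam α Ω).toReal ∧
    boundaryBulk lam α Ω = ENNReal.ofReal (lam ^ 2 * α *
      (2 / (lam * α) ^ 2 * (perimeter Ω).toReal - (nonlocalTerm lam α Ω).toReal)) ∧
    anisotropicBoundaryBulk lam α Ω = ENNReal.ofReal (lam ^ 4 * α *
      (2 / (lam * α) ^ 2 * (perimeter Ω).toReal - (nonlocalTerm lam α Ω).toReal)) := by
  obtain ⟨μ, σ, hpol⟩ := exists_isGaussGreenPolar hΩ hfin hP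
  have hμ := hpol.perimeter_eq hP
  have : IsFiniteMeasure μ := ⟨hμ ▸ hP⟩
  obtain ⟨h0, hB⟩ := hpol.lintegral_bulk hΩ hfin hP hlam hα
  have hrestrict := hpol.restrict_hausdorffMeasure hΩ (measure_ne_top μ _)
  refine ⟨(hpol.nonlocalTerm_eq hΩ hfin hP hlam hα).1, h0, ?_, ?_⟩
  · rw [ENNReal.ofReal_mul (by positivity), ← hB, ← lintegral_const_mul' _ _ ENNReal.ofReal_ne_top,
      boundaryBulk, hrestrict]
    refine lintegral_congr_ae ?_
    filter_upwards [hpol.ae_mem_reducedBoundary] with y hy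
    rw [hy.2.1]
    exact setLIntegral_dilation hΩ hlam hα (σ y) y
  · rw [ENNReal.ofReal_mul (by positivity), ← hB, ← lintegral_const_mul' _ _ ENNReal.ofReal_ne_top,
      anisotropicBoundaryBulk, hrestrict]
    refine lintegral_congr_ae ?_
    filter_upwards [hpol.ae_mem_reducedBoundary] with y hy
    rw [hy.2.1]
    exact setLIntegral_anisotropic_dilation hΩ hlam hα hy.2.2 y

end Representation

end ScreenedPerimeter

end

theorem lemma3p1 (lam α : ℝ) (hlam : 0 < lam) (hα : 0 < α)
    (Ω : Set ScreenedPerimeter.Plane) (hΩ : Ω ∈ ScreenedPerimeter.admissible Real.pi) :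
    -- all the integrals involved are finite
    ScreenedPerimeter.nonlocalTerm lam α Ω < ∞ ∧
    ScreenedPerimeter.boundaryBulk lam α Ω < ∞ ∧
    ScreenedPerimeter.anisotropicBoundaryBulk lam α Ω < ∞ ∧
    -- the first representation
    ScreenedPerimeter.energy lam α Ω =
      (1 - 1 / (2 * Real.pi * α ^ 2)) * (ScreenedPerimeter.perimeter Ω).toReal +
        1 / (4 * Real.pi * α) * (ScreenedPerimeter.boundaryBulk lam α Ω).toReal ∧
    -- the anisotropically rescaled representation
    ScreenedPerimeter.energy lam α Ω =
      (1 - 1 / (2 * Real.pi * α ^ 2)) * (ScreenedPerimeter.perimeter Ω).toReal +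
        1 / (4 * Real.pi * α * lam ^ 2) *
          (ScreenedPerimeter.anisotropicBoundaryBulk lam α Ω).toReal ∧
    -- the lower bound
    (1 - 1 / (2 * Real.pi * α ^ 2)) * (ScreenedPerimeter.perimeter Ω).toReal ≤
      ScreenedPerimeter.energy lam α Ω := by
  obtain ⟨hnull, hvol, hP⟩ := hΩ
  -- Every quantity depends only on the Lebesgue class of Ω, so a Borel representative may be used.
  obtain ⟨Ω', -, hΩ', hae⟩ := hnull.exists_measurable_superset_ae_eq
  have hvol' : volume Ω' < ∞ := by rw [measure_congr hae, hvol]; exact ENNReal.ofReal_lt_top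
  have hP' : ScreenedPerimeter.perimeter Ω' < ∞ :=
    (ScreenedPerimeter.perimeter_congr hae).trans_lt hP
  obtain ⟨hN, h0, hB, hA⟩ := ScreenedPerimeter.boundaryBulk_eq hΩ' hvol' hP' hlam hα
  rw [ScreenedPerimeter.perimeter_congr hae, ScreenedPerimeter.nonlocalTerm_congr hae] at h0 hB hA
  rw [ScreenedPerimeter.nonlocalTerm_congr hae] at hN
  rw [ScreenedPerimeter.boundaryBulk_congr hae] at hB
  rw [ScreenedPerimeter.anisotropicBoundaryBulk_congr hae] at hA
  have hπ := Real.pi_pos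
  have hfirst : ScreenedPerimeter.energy lam α Ω =
      (1 - 1 / (2 * Real.pi * α ^ 2)) * (ScreenedPerimeter.perimeter Ω).toReal +
        1 / (4 * Real.pi * α) * (ScreenedPerimeter.boundaryBulk lam α Ω).toReal := by
    rw [hB, ENNReal.toReal_ofReal (by positivity), ScreenedPerimeter.energy]
    field_simp
    ring
  refine ⟨hN, hB ▸ ENNReal.ofReal_lt_top, hA ▸ ENNReal.ofReal_lt_top, hfirst, ?_, ?_⟩
  · rw [hA, ENNReal.toReal_ofReal (by positivity), ScreenedPerimeter.energy]
    field_simp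
    ring
  · rw [hfirst]
    have : 0 ≤ 1 / (4 * Real.pi * α) * (ScreenedPerimeter.boundaryBulk lam α Ω).toReal := by
      positivity
    linarith
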